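/- Fix integers $k \ge 1$ and $b \ge 1$. **$k$-caterpillars.** A caterpillar is a tree $T$ containing a path $P$ (the spine, with at least one vertex) such that every edge of $T$ has at least one endpoint in $P$. A $k$-caterpillar is a graph obtained from a caterpillar by replacing each edge that has exactly one endpoint in $P$ by a path of length at least $1$ and at most $k$. **Max $b$-Save.** An instance consists of a finite simple graph $G=(V,E)$, a vertex $s \in V$ and a set $S \subseteq V$. A protection strategy is a set $\Phi \subseteq V \times \{1,\dots,|V|\}$; if $(v,t)\in\Phi$ we say that $v$ is protected at time $t$, and it stays protected from then on. At times $0$ and $1$ only $s$ is burned; for each $t \ge 1$, the vertices burned at time $t+1$ are those burned at time $t$ together with all vertices that are adjacent to a vertex burned at time $t$ and are not protected at time $t$ or earlier. The strategy is valid (for budget $b$) if for every $(v,t)\in\Phi$ the vertex $v$ is not burned at time $t$, and for every $t$ at most $b$ vertices are protected at time $t$. A vertex is saved if, at some time, it is protected or every path from a burned vertex to it contains a protected vertex. The task is to output a valid strategy $\Phi$ that maximizes the number of saved vertices belonging to $S$. **Theorem.** For all integers $k\ge 1$ and $b\ge 1$, Max $b$-Save is polynomial-time solvable on $k$-caterpillars: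 there are an algorithm (a program of a random access machine with addition and subtraction, each step at unit cost) and a polynomial $T$ such that, for every $k$-caterpillar $G$ on $n$ vertices (given by its adjacency matrix), every vertex $s$ and every set $S$ of vertices of $G$, the algorithm halts after at most $T(n)$ steps and outputs a valid strategy that saves the maximum possible number of vertices of $S$. -/

import Mathlib

/-! Fire spread, protection strategies and the optimization problem Max b-Save. -/

section Firefighter

variable {V : Type*}

/-- The vertices protected at some time step `t' ≤ t` by the strategy `Φ`, a set of pairs
(vertex, time). Protection is permanent. -/
def protectedBy (Φ : Finset (V × ℕ)) (t : ℕ) : Set V :=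
  {v | ∃ t' ≤ t, (v, t') ∈ Φ}

/-- The vertices that are on fire at time `t`. Only `s` burns at time `0`; for every `t > 0`, a
vertex adjacent to a vertex burning at time `t` burns at time `t + 1` unless it is protected at
time `t` or before. In particular only `s` burns at time `1`, when the first firefighters are
placed. -/
def burnedAt (G : SimpleGraph V) (s : V) (Φ : Finset (V × ℕ)) : ℕ → Set V
  | 0 => {s}
  | t + 1 => burnedAt G s Φ t ∪
      {v | 0 < t ∧ v ∉ protectedBy Φ t ∧ ∃ u ∈ burnedAt G s Φ t, G.Adj u v}

/-- A vertex is saved at time `t` if it is protected, or if every path from a burned vertex to it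
contains a protected vertex. -/
def SavedAt (G : SimpleGraph V) (s : V) (Φ : Finset (V × ℕ)) (t : ℕ) (v : V) : Prop :=
  v ∈ protectedBy Φ t ∨
    ∀ u ∈ burnedAt G s Φ t, ∀ p : G.Path u v, ∃ w ∈ p.1.support, w ∈ protectedBy Φ t

/-- A vertex is saved by the strategy if it is saved at some time (it then remains saved). -/
def Saved (G : SimpleGraph V) (s : V) (Φ : Finset (V × ℕ)) (v : V) : Prop :=
  ∃ t, SavedAt G s Φ t v

/-- Protection strategies `Φ ⊆ V × {1, …, |V|}` that are valid with respect to the budget `b`: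
no vertex is protected at a time at which it is burned, and at most `b` vertices are protected at
each time step. -/
def ValidStrategy [Fintype V] (G : SimpleGraph V) (s : V) (b : ℕ) (Φ : Finset (V × ℕ)) : Prop :=
  (∀ q ∈ Φ, 1 ≤ q.2 ∧ q.2 ≤ Fintype.card V) ∧
  (∀ v t, (v, t) ∈ Φ → v ∉ burnedAt G s Φ t) ∧
  ∀ t, (Φ.filter fun q => q.2 = t).card ≤ b

/-- The number of vertices of `S` that the strategy saves. -/
noncomputable def savedCount (G : SimpleGraph V) (s : V) (S : Finset V)
    (Φ : Finset (V × ℕ)) : ℕ :=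
  Set.ncard {v | v ∈ S ∧ Saved G s Φ v}

/-- The solutions of Max `b`-Save for the instance `(G, s, S)`: valid strategies that save as many
vertices of `S` as possible. -/
def IsMaxSaveSolution [Fintype V] (b : ℕ) (G : SimpleGraph V) (s : V) (S : Finset V)
    (Φ : Finset (V × ℕ)) : Prop :=
  ValidStrategy G s b Φ ∧
    ∀ Ψ, ValidStrategy G s b Ψ → savedCount G s S Ψ ≤ savedCount G s S Φ

end Firefighter

/-! k-caterpillars. -/

/-- The graph formed by a spine, which is a path on the vertices `inl 0, …, inl (p - 1)`, and by
`L` legs. Leg `l` is a path of length `len l` that starts at the spine vertex `foot l` and whose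
other vertices are `inr ⟨l, 0⟩, …, inr ⟨l, len l - 1⟩`, in this order. -/
def spineLegGraph (p L : ℕ) (foot : Fin L → Fin p) (len : Fin L → ℕ) :
    SimpleGraph (Fin p ⊕ (l : Fin L) × Fin (len l)) :=
  SimpleGraph.fromRel fun x y =>
    match x, y with
    | .inl i, .inl j => (i : ℕ) + 1 = j
    | .inl i, .inr c => foot c.1 = i ∧ (c.2 : ℕ) = 0
    | .inr c, .inr d => c.1 = d.1 ∧ (c.2 : ℕ) + 1 = d.2
    | .inr _, .inl _ => False

/-- A `k`-caterpillar: a caterpillar each of whose pending edges (the edges leaving the spine) has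
been replaced by a path of length at least `1` and at most `k`. -/
def IsKCaterpillar {V : Type*} (k : ℕ) (G : SimpleGraph V) : Prop :=
  ∃ (p L : ℕ) (foot : Fin L → Fin p) (len : Fin L → ℕ),
    0 < p ∧ (∀ l, 1 ≤ len l ∧ len l ≤ k) ∧ Nonempty (G ≃g spineLegGraph p L foot len)

/-! A random access machine, given as structured programs with a step count. -/

/-- A state of the machine: the contents of its variables (registers) and of its arrays. A program
mentions only finitely many variables and arrays. -/
structure RamState where
  var : ℕ → ℕ
  arr : ℕ → ℕ → ℕ

/-- Assign the value `c` to variable `x`. -/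
def RamState.setVar (σ : RamState) (x c : ℕ) : RamState :=
  { σ with var := Function.update σ.var x c }

/-- Assign the value `c` to entry `i` of array `a`. -/
def RamState.setArr (σ : RamState) (a i c : ℕ) : RamState :=
  { σ with arr := Function.update σ.arr a (Function.update (σ.arr a) i c) }

/-- Programs. The names of variables and arrays and the constants are fixed in the program;
addition and (truncated) subtraction are the only arithmetic operations, so that the unit-cost
measure below is polynomially equivalent to Turing machine time. -/
inductive RamProg where
  /-- Do nothing. -/
  | skip
  /-- `x := c` -/
  | const (x c : ℕ)
  /-- `x := y` -/
  | copy (x y : ℕ)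
  /-- `x := y + z` -/
  | add (x y z : ℕ)
  /-- `x := y - z` -/
  | sub (x y z : ℕ)
  /-- `x := a[i]`, where the index is the value of variable `i` -/
  | load (x a i : ℕ)
  /-- `a[i] := x`, where the index is the value of variable `i` -/
  | store (a i x : ℕ)
  /-- First `P`, then `Q`. -/
  | seq (P Q : RamProg)
  /-- If `x ≠ 0` then `P` else `Q`. -/
  | ite (x : ℕ) (P Q : RamProg)
  /-- While `x ≠ 0` do `P`. -/
  | loop (x : ℕ) (P : RamProg)

/-- `Runs P σ t τ`: the program `P`, started in the state `σ`, halts after exactly `t` steps, in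
the state `τ`. Every elementary instruction and every test of a variable takes one step. -/
inductive Runs : RamProg → RamState → ℕ → RamState → Prop where
  | skip (σ) : Runs .skip σ 1 σ
  | const (σ x c) : Runs (.const x c) σ 1 (σ.setVar x c)
  | copy (σ x y) : Runs (.copy x y) σ 1 (σ.setVar x (σ.var y))
  | add (σ x y z) : Runs (.add x y z) σ 1 (σ.setVar x (σ.var y + σ.var z))
  | sub (σ x y z) : Runs (.sub x y z) σ 1 (σ.setVar x (σ.var y - σ.var z))
  | load (σ x a i) : Runs (.load x a i) σ 1 (σ.setVar x (σ.arr a (σ.var i)))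
  | store (σ a i x) : Runs (.store a i x) σ 1 (σ.setArr a (σ.var i) (σ.var x))
  | seq {P Q σ τ υ t t'} : Runs P σ t τ → Runs Q τ t' υ → Runs (.seq P Q) σ (t + t') υ
  | ite_true {x P Q σ τ t} : σ.var x ≠ 0 → Runs P σ t τ → Runs (.ite x P Q) σ (t + 1) τ
  | ite_false {x P Q σ τ t} : σ.var x = 0 → Runs Q σ t τ → Runs (.ite x P Q) σ (t + 1) τ
  | loop_stop {x P σ} : σ.var x = 0 → Runs (.loop x P) σ 1 σ
  | loop_step {x P σ τ υ t t'} : σ.var x ≠ 0 → Runs P σ t τ → Runs (.loop x P) τ t' υ →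
      Runs (.loop x P) σ (t + t' + 1) υ

open Classical in
/-- The initial state that encodes an instance `(G, s, S)` with vertices `0, …, n - 1`: variable
`0` holds `n`, variable `1` holds `s`, array `0` is the indicator vector of `S`, and array `1` is
the adjacency matrix of `G`, row by row. Everything else is `0`. -/
noncomputable def encodeInstance {n : ℕ} (G : SimpleGraph (Fin n)) (s : Fin n)
    (S : Finset (Fin n)) : RamState where
  var x := if x = 0 then n else if x = 1 then s else 0
  arr a i :=
    if a = 0 then if ∃ v ∈ S, i = (v : ℕ) then 1 else 0
    else if a = 1 then if ∃ u v, G.Adj u v ∧ i = (u : ℕ) * n + v then 1 else 0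
    else 0

/-- The strategy that a final state encodes, as a list of pairs (vertex, time): variable `2` holds
the length of the list, arrays `2` and `3` hold the vertices and the times. -/
def EncodesStrategy {n : ℕ} (σ : RamState) (Φ : Finset (Fin n × ℕ)) : Prop :=
  Φ.image (fun q => ((q.1 : ℕ), q.2)) =
    (Finset.range (σ.var 2)).image fun i => (σ.arr 2 i, σ.arr 3 i)

/-- Max `b`-Save is polynomial-time solvable on the graphs of the class `C`: one program computes
a solution for every instance whose graph is in `C`, in a number of steps that is at most a
polynomial in the number `n` of vertices. (The input is an `n × n` adjacency matrix and `n`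
further bits, besides `n` and `s`, so that a bound polynomial in `n` is the same as a bound
polynomial in the length of the input.) -/
def MaxSavePolyTimeSolvableOn (b : ℕ) (C : (n : ℕ) → SimpleGraph (Fin n) → Prop) : Prop :=
  ∃ (P : RamProg) (T : Polynomial ℕ), ∀ (n : ℕ) (G : SimpleGraph (Fin n)) (s : Fin n)
    (S : Finset (Fin n)), C n G →
      ∃ (t : ℕ) (σ : RamState) (Φ : Finset (Fin n × ℕ)),
        t ≤ T.eval n ∧ Runs P (encodeInstance G s S) t σ ∧
        EncodesStrategy σ Φ ∧ IsMaxSaveSolution b G s S Φ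

/-!
The graph is a tree, which is rooted at the source `s`. A vertex at distance `d > 0` from `s` that
is not cut off burns at time `d + 1`, so protecting `x` at a time at most `d` saves the whole
subtree below `x`, while a vertex protected later than that was already cut off. Hence a valid
strategy saves the vertices below some set `X` of vertices `x ≠ s` with deadlines `d x`
(`exists_protected_of_saved`), and such a set `X` can be protected in time, `b` vertices at a time,
if and only if it satisfies the Hall condition that at most `b * e` vertices of `X` have depth at
most `e`: one direction is `hall_of_validStrategy`, and for the other one protects `X` by increasing
depth (`exists_maxSaveSolution`). What remains is to find a set that satisfies the Hall condition
and has the largest number of vertices of `S` below it; it may be assumed to be an antichain.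

Call a vertex thin if its descendants form a path with at most `k` vertices. In a `k`-caterpillar
the vertices that are not thin lie on two paths that start in `s`, one for each direction of the
spine (`IsKCaterpillar.exists_paths`). So an antichain contains at most two of them, which are
guessed, and at most one vertex of each maximal thin branch. A dynamic program goes through the
branches by increasing depth of their topmost vertices. When it deals with a branch at depth `e`,
the vertices chosen so far in thin branches have depth less than `e + k`; therefore the value, the
two guesses and the `k` numbers of these vertices up to the depths `e, …, e + k - 1` determine all
that matters for the future (`FireData.Equiv`). These are `k + 3` numbers of size at most `n`, and
for each possible list of numbers the program stores one set. By the exchange argument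
`Equiv.hall_extend`, the last table contains an optimal set (`best_spec`).

For the running time, expressions built from addition, subtraction, array access, case distinction
and sums over all numbers below `N` are compiled to programs that need a number of steps polynomial
in `N` (`Expr.compile_spec`), and so are iterations that fill a table with values of expressions
(`tableProg_spec`). With `N = (n + 2) ^ (k + 4)`, all functions of the dynamic program turn out to
be expressible in this way (`Definable`), because the quantifiers, counts, minima, products and
quotients in them have ranges below `N`. The tables are indexed by the codes of lists of numbers in
base `n + 2`.
-/

/-! ### Partial correctness with time bounds -/

/-- `Triple pre P C post`: started in a state that satisfies `pre`, the program `P` halts after at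
most `C` steps in a state that satisfies `post`. -/
def Triple (pre : RamState → Prop) (P : RamProg) (C : ℕ) (post : RamState → Prop) : Prop :=
  ∀ σ, pre σ → ∃ t τ, t ≤ C ∧ Runs P σ t τ ∧ post τ

theorem Triple.seq {p q r : RamState → Prop} {P Q : RamProg} {C C' : ℕ}
    (hP : Triple p P C q) (hQ : Triple q Q C' r) : Triple p (.seq P Q) (C + C') r := by
  intro σ hσ
  obtain ⟨t, τ, ht, hr, hτ⟩ := hP σ hσ
  obtain ⟨t', υ, ht', hr', hυ⟩ := hQ τ hτ
  exact ⟨t + t', υ, by omega, .seq hr hr', hυ⟩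

theorem Triple.conseq {p p' q q' : RamState → Prop} {P : RamProg} {C C' : ℕ}
    (h : Triple p P C q) (hp : ∀ σ, p' σ → p σ) (hC : C ≤ C') (hq : ∀ σ, q σ → q' σ) :
    Triple p' P C' q' := by
  intro σ hσ
  obtain ⟨t, τ, ht, hr, hτ⟩ := h σ (hp σ hσ)
  exact ⟨t, τ, ht.trans hC, hr, hq τ hτ⟩

theorem Triple.const {q : RamState → Prop} (x c : ℕ) :
    Triple (fun σ => q (σ.setVar x c)) (.const x c) 1 q :=
  fun σ h => ⟨1, _, le_rfl, .const σ x c, h⟩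

theorem Triple.copy {q : RamState → Prop} (x y : ℕ) :
    Triple (fun σ => q (σ.setVar x (σ.var y))) (.copy x y) 1 q :=
  fun σ h => ⟨1, _, le_rfl, .copy σ x y, h⟩

theorem Triple.add {q : RamState → Prop} (x y z : ℕ) :
    Triple (fun σ => q (σ.setVar x (σ.var y + σ.var z))) (.add x y z) 1 q :=
  fun σ h => ⟨1, _, le_rfl, .add σ x y z, h⟩

theorem Triple.sub {q : RamState → Prop} (x y z : ℕ) :
    Triple (fun σ => q (σ.setVar x (σ.var y - σ.var z))) (.sub x y z) 1 q :=
  fun σ h => ⟨1, _, le_rfl, .sub σ x y z, h⟩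

theorem Triple.load {q : RamState → Prop} (x a i : ℕ) :
    Triple (fun σ => q (σ.setVar x (σ.arr a (σ.var i)))) (.load x a i) 1 q :=
  fun σ h => ⟨1, _, le_rfl, .load σ x a i, h⟩

@[simp] theorem RamState.setVar_arr (σ : RamState) (x c : ℕ) : (σ.setVar x c).arr = σ.arr := rfl

@[simp] theorem RamState.setArr_var (σ : RamState) (a i c : ℕ) :
    (σ.setArr a i c).var = σ.var := rfl

theorem RamState.setVar_var (σ : RamState) (x c y : ℕ) :
    (σ.setVar x c).var y = if y = x then c else σ.var y := by
  simp [RamState.setVar, Function.update_apply]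

theorem RamState.setArr_arr (σ : RamState) (a i c a' j : ℕ) :
    (σ.setArr a i c).arr a' j = if a' = a ∧ j = i then c else σ.arr a' j := by
  by_cases h : a' = a
  · subst h; simp [RamState.setArr, Function.update_apply]
  · simp [RamState.setArr, h]

/-- A loop whose test variable counts down from `m` to `0`. -/
theorem Triple.countdown {x : ℕ} {P : RamProg} {m C : ℕ} (Inv : ℕ → RamState → Prop)
    (h : ∀ i < m, Triple (fun σ => Inv i σ ∧ σ.var x = m - i) P C
      (fun σ => Inv (i + 1) σ ∧ σ.var x = m - (i + 1))) :
    Triple (fun σ => Inv 0 σ ∧ σ.var x = m) (.loop x P) (m * (C + 1) + 1) (Inv m) := by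
  suffices H : ∀ j i, i + j = m → Triple (fun σ => Inv i σ ∧ σ.var x = j) (.loop x P)
      (j * (C + 1) + 1) (Inv m) from H m 0 (by omega)
  intro j
  induction j with
  | zero =>
    rintro i hi σ ⟨hσ, hx⟩
    obtain rfl : i = m := by omega
    exact ⟨1, σ, by omega, Runs.loop_stop hx, hσ⟩
  | succ j ih =>
    rintro i hi σ ⟨hσ, hx⟩
    obtain ⟨t, τ, ht, hr, hτ, hτx⟩ := h i (by omega) σ ⟨hσ, by omega⟩
    obtain ⟨t', υ, ht', hr', hυ⟩ := ih (i + 1) (by omega) τ ⟨hτ, by omega⟩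
    refine ⟨t + t' + 1, υ, ?_, .loop_step (by omega) hr hr', hυ⟩
    rw [Nat.succ_mul]; omega

/-- `for cnt < (variable 3) do P`, where `rem` counts down and `tmp` holds the constant `1`. -/
def forProg (cnt rem tmp : ℕ) (P : RamProg) : RamProg :=
  .seq (.const cnt 0) (.seq (.copy rem 3) (.loop rem
    (.seq P (.seq (.const tmp 1) (.seq (.add cnt cnt tmp) (.sub rem rem tmp))))))

/-- The rule for `forProg`. The invariant must not depend on the three variables that control the
loop. -/
theorem Triple.for_loop {cnt rem tmp : ℕ} {P : RamProg} {N C : ℕ} (Inv : ℕ → RamState → Prop)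
    (hcr : cnt ≠ rem) (hct : cnt ≠ tmp) (hrt : rem ≠ tmp) (hc3 : cnt ≠ 3)
    (hst : ∀ i σ τ, τ.arr = σ.arr → (∀ r, r ≠ cnt → r ≠ rem → r ≠ tmp → τ.var r = σ.var r) →
      Inv i σ → Inv i τ)
    (h : ∀ i < N, Triple (fun σ => Inv i σ ∧ σ.var cnt = i ∧ σ.var rem = N - i) P C
      (fun σ => Inv (i + 1) σ ∧ σ.var cnt = i ∧ σ.var rem = N - i)) :
    Triple (fun σ => Inv 0 σ ∧ σ.var 3 = N) (forProg cnt rem tmp P) (N * (C + 4) + 3) (Inv N) := by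
  have hloop := Triple.countdown (x := rem) (m := N) (C := C + 3)
    (P := .seq P (.seq (.const tmp 1) (.seq (.add cnt cnt tmp) (.sub rem rem tmp))))
    (fun i σ => Inv i σ ∧ σ.var cnt = i) (fun i hi => by
      have hb := (h i hi).seq (((Triple.const tmp 1).seq ((Triple.add cnt cnt tmp).seq
        (Triple.sub (q := fun σ => (Inv (i + 1) σ ∧ σ.var cnt = i + 1) ∧ σ.var rem = N - (i + 1))
          rem rem tmp))).conseq
        (p' := fun σ => Inv (i + 1) σ ∧ σ.var cnt = i ∧ σ.var rem = N - i) ?_ le_rfl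
        (fun _ h => h))
      · exact hb.conseq (fun σ hσ => ⟨hσ.1.1, hσ.1.2, hσ.2⟩) (by omega) (fun _ h => h)
      · rintro σ ⟨h1, h2, h3⟩
        refine ⟨⟨hst _ σ _ rfl ?_ h1, ?_⟩, ?_⟩
        · intro r hr1 hr2 hr3
          simp [RamState.setVar_var, hr1, hr2, hr3]
        · simp [RamState.setVar_var, hcr, hct, h2]
        · simp [RamState.setVar_var, hcr.symm, hct, hct.symm, hrt, h3]; omega)
  have := (Triple.const cnt 0).seq ((Triple.copy rem 3).seq hloop)
  refine this.conseq ?_ (by ring_nf; omega) (fun σ hσ => hσ.1)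
  rintro σ ⟨h1, h2⟩
  refine ⟨⟨hst _ σ _ rfl ?_ h1, ?_⟩, ?_⟩
  · intro r hr1 hr2 hr3
    simp [RamState.setVar_var, hr1, hr2]
  · simp [RamState.setVar_var, hcr]
  · simp [RamState.setVar_var, h2, hc3.symm]

/-! ### Expressions with bounded sums -/

/-- What an expression can see of a machine state: the range `N` of the loops, the input numbers
`n` and `s`, and the arrays. -/
structure Store where
  N : ℕ
  n : ℕ
  s : ℕ
  arr : ℕ → ℕ → ℕ

/-- The store with the contents of array `a` replaced by `f`. -/
def Store.setArr (M : Store) (a : ℕ) (f : ℕ → ℕ) : Store :=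
  { M with arr := Function.update M.arr a f }

/-- The state `σ` holds the store `M`. Array `4` is reserved as a buffer. -/
def Represents (M : Store) (σ : RamState) : Prop :=
  σ.var 3 = M.N ∧ σ.var 0 = M.n ∧ σ.var 1 = M.s ∧ ∀ a, a ≠ 4 → σ.arr a = M.arr a

theorem Represents.congr {M : Store} {σ τ : RamState} (h : Represents M σ)
    (ha : ∀ a, a ≠ 4 → τ.arr a = σ.arr a) (hv : ∀ r < 4, τ.var r = σ.var r) : Represents M τ :=
  ⟨(hv 3 (by omega)).trans h.1, (hv 0 (by omega)).trans h.2.1, (hv 1 (by omega)).trans h.2.2.1,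
    fun a h4 => (ha a h4).trans (h.2.2.2 a h4)⟩

/-- Arithmetic expressions over a store and variables; `sum x e` is the sum of the values of `e`
for `x < N`, and `ite c a b` is `a` if `c ≠ 0` and `b` otherwise. -/
inductive Expr where
  | const (c : ℕ)
  | N
  | n
  | s
  | var (x : ℕ)
  | add (e f : Expr)
  | sub (e f : Expr)
  | read (a : ℕ) (e : Expr)
  | ite (c e f : Expr)
  | sum (x : ℕ) (e : Expr)

/-- The value of an expression in a store, for the values `ρ` of the variables. The buffer array
reads as zero. -/
def Expr.eval (M : Store) : (ℕ → ℕ) → Expr → ℕ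
  | _, .const c => c
  | _, .N => M.N
  | _, .n => M.n
  | _, .s => M.s
  | ρ, .var x => ρ x
  | ρ, .add e f => e.eval M ρ + f.eval M ρ
  | ρ, .sub e f => e.eval M ρ - f.eval M ρ
  | ρ, .read a e => if a = 4 then 0 else M.arr a (e.eval M ρ)
  | ρ, .ite c e f => if c.eval M ρ ≠ 0 then e.eval M ρ else f.eval M ρ
  | ρ, .sum x e => ∑ i ∈ Finset.range M.N, e.eval M (Function.update ρ x i)

/-- A program that evaluates an expression into register `F`. The value of the variable `x` is in
register `η x`; only registers `≥ F` are written. -/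
def Expr.compile : Expr → (ℕ → ℕ) → ℕ → RamProg
  | .const c, _, F => .const F c
  | .N, _, F => .copy F 3
  | .n, _, F => .copy F 0
  | .s, _, F => .copy F 1
  | .var x, η, F => .copy F (η x)
  | .add e f, η, F => .seq (e.compile η F) (.seq (f.compile η (F + 1)) (.add F F (F + 1)))
  | .sub e f, η, F => .seq (e.compile η F) (.seq (f.compile η (F + 1)) (.sub F F (F + 1)))
  | .read a e, η, F => .seq (e.compile η F) (if a = 4 then .const F 0 else .load F a F)
  | .ite c e f, η, F => .seq (c.compile η F) (.ite F (e.compile η F) (f.compile η F))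
  | .sum x e, η, F => .seq (.const F 0) (forProg (F + 1) (F + 2) (F + 3)
      (.seq (e.compile (Function.update η x (F + 1)) (F + 3)) (.add F F (F + 3))))

/-- A bound on the running time of `Expr.compile`, as a polynomial in `N`. -/
noncomputable def Expr.cost : Expr → Polynomial ℕ
  | .const _ | .N | .n | .s | .var _ => 1
  | .add e f => e.cost + (f.cost + 1)
  | .sub e f => e.cost + (f.cost + 1)
  | .read _ e => e.cost + 1
  | .ite c e f => c.cost + (e.cost + f.cost + 1)
  | .sum _ e => 1 + (Polynomial.X * (e.cost + 5) + 3)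

/-- The compiled program evaluates the expression within the time bound, and it changes neither the
arrays nor the registers below `F`. -/
theorem Expr.compile_spec (M : Store) (e : Expr) : ∀ (η : ℕ → ℕ) (F : ℕ) (σ₀ : RamState), 4 ≤ F →
    (∀ x, η x < F) → Represents M σ₀ →
    Triple (fun σ => σ.arr = σ₀.arr ∧ ∀ r < F, σ.var r = σ₀.var r) (e.compile η F)
      (e.cost.eval M.N)
      (fun σ => (σ.arr = σ₀.arr ∧ ∀ r < F, σ.var r = σ₀.var r) ∧
        σ.var F = e.eval M (fun x => σ₀.var (η x))) := by
  have leaf : ∀ (F r : ℕ) (σ₀ : RamState), r < F →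
      Triple (fun σ => σ.arr = σ₀.arr ∧ ∀ r < F, σ.var r = σ₀.var r) (.copy F r) 1
      (fun σ => (σ.arr = σ₀.arr ∧ ∀ r < F, σ.var r = σ₀.var r) ∧ σ.var F = σ₀.var r) := by
    intro F r σ₀ hr
    refine (Triple.copy F r).conseq ?_ le_rfl (fun _ h => h)
    rintro σ ⟨h1, h2⟩
    refine ⟨⟨h1, fun r' hr' => ?_⟩, ?_⟩
    · simp [RamState.setVar_var, hr'.ne, h2 r' hr']
    · simp [RamState.setVar_var, h2 r hr]
  have bin : ∀ (e f : Expr) (η : ℕ → ℕ) (F : ℕ) (σ₀ : RamState), (∀ x, η x < F) →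
      Triple (fun σ => σ.arr = σ₀.arr ∧ ∀ r < F, σ.var r = σ₀.var r) (e.compile η F)
      (e.cost.eval M.N)
      (fun σ => (σ.arr = σ₀.arr ∧ ∀ r < F, σ.var r = σ₀.var r) ∧
        σ.var F = e.eval M (fun x => σ₀.var (η x))) →
      (∀ σ₁ : RamState, σ₁.arr = σ₀.arr → (∀ r < F, σ₁.var r = σ₀.var r) →
        Triple (fun σ => σ.arr = σ₁.arr ∧ ∀ r < F + 1, σ.var r = σ₁.var r) (f.compile η (F + 1))
        (f.cost.eval M.N)
        (fun σ => (σ.arr = σ₁.arr ∧ ∀ r < F + 1, σ.var r = σ₁.var r) ∧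
          σ.var (F + 1) = f.eval M (fun x => σ₁.var (η x)))) →
      Triple (fun σ => σ.arr = σ₀.arr ∧ ∀ r < F, σ.var r = σ₀.var r)
        (.seq (e.compile η F) (f.compile η (F + 1))) (e.cost.eval M.N + f.cost.eval M.N)
        (fun σ => (σ.arr = σ₀.arr ∧ ∀ r < F, σ.var r = σ₀.var r) ∧
          σ.var F = e.eval M (fun x => σ₀.var (η x)) ∧
          σ.var (F + 1) = f.eval M (fun x => σ₀.var (η x))) := by
    intro e f η F σ₀ hη he hf
    refine he.seq ?_
    rintro σ ⟨⟨h1, h2⟩, h3⟩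
    obtain ⟨t, τ, ht, hr, ⟨⟨h4, h5⟩, h6⟩⟩ := hf σ h1 h2 σ ⟨rfl, fun _ _ => rfl⟩
    refine ⟨t, τ, ht, hr, ⟨h4.trans h1, fun r hr => (h5 r (by omega)).trans (h2 r hr)⟩,
      (h5 F (by omega)).trans h3, h6.trans ?_⟩
    congr 1; funext x; exact h2 _ (hη x)
  -- regrouping a sequence of three programs does not change the running time
  have assoc : ∀ {p q : RamState → Prop} {P Q R : RamProg} {C : ℕ},
      Triple p (.seq (.seq P Q) R) C q → Triple p (.seq P (.seq Q R)) C q := by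
    intro p q P Q R C h σ hσ
    obtain ⟨t, τ, ht, hr, hq⟩ := h σ hσ
    cases hr with | seq h1 h2 => cases h1 with | seq h3 h4 =>
      exact ⟨_, τ, by omega, .seq h3 (.seq h4 h2), hq⟩
  induction e with
  | const c =>
    intro η F σ₀ hF hη hM
    refine (Triple.const F c).conseq ?_ (by simp [cost]) (fun _ h => h)
    rintro σ ⟨h1, h2⟩
    refine ⟨⟨h1, fun r hr => ?_⟩, ?_⟩
    · simp [RamState.setVar_var, hr.ne, h2 r hr]
    · simp [RamState.setVar_var, eval]
  | N =>
    intro η F σ₀ hF hη hM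
    exact (leaf F 3 σ₀ (by omega)).conseq (fun _ h => h) (by simp [cost])
      (fun σ h => ⟨h.1, h.2.trans hM.1⟩)
  | n =>
    intro η F σ₀ hF hη hM
    exact (leaf F 0 σ₀ (by omega)).conseq (fun _ h => h) (by simp [cost])
      (fun σ h => ⟨h.1, h.2.trans hM.2.1⟩)
  | s =>
    intro η F σ₀ hF hη hM
    exact (leaf F 1 σ₀ (by omega)).conseq (fun _ h => h) (by simp [cost])
      (fun σ h => ⟨h.1, h.2.trans hM.2.2.1⟩)
  | var x =>
    intro η F σ₀ hF hη hM
    exact (leaf F (η x) σ₀ (hη x)).conseq (fun _ h => h) (by simp [cost])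
      (fun σ h => ⟨h.1, h.2⟩)
  | add e f ihe ihf =>
    intro η F σ₀ hF hη hM
    have := bin e f η F σ₀ hη (ihe η F σ₀ hF hη hM) (fun σ₁ ha hv =>
      ihf η (F + 1) σ₁ (by omega) (fun x => (hη x).trans (by omega))
        (hM.congr (fun a _ => by rw [ha]) (fun r hr => hv r (by omega))))
    refine assoc ((this.seq ((Triple.add F F (F + 1)).conseq ?_ le_rfl (fun _ h => h))).conseq
      (fun _ h => h) (by simp [cost, add_assoc]) (fun _ h => h))
    rintro σ ⟨⟨h1, h2⟩, h3, h4⟩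
    refine ⟨⟨h1, fun r hr => ?_⟩, ?_⟩
    · simp [RamState.setVar_var, hr.ne, h2 r hr]
    · simp [RamState.setVar_var, eval, h3, h4]
  | sub e f ihe ihf =>
    intro η F σ₀ hF hη hM
    have := bin e f η F σ₀ hη (ihe η F σ₀ hF hη hM) (fun σ₁ ha hv =>
      ihf η (F + 1) σ₁ (by omega) (fun x => (hη x).trans (by omega))
        (hM.congr (fun a _ => by rw [ha]) (fun r hr => hv r (by omega))))
    refine assoc ((this.seq ((Triple.sub F F (F + 1)).conseq ?_ le_rfl (fun _ h => h))).conseq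
      (fun _ h => h) (by simp [cost, add_assoc]) (fun _ h => h))
    rintro σ ⟨⟨h1, h2⟩, h3, h4⟩
    refine ⟨⟨h1, fun r hr => ?_⟩, ?_⟩
    · simp [RamState.setVar_var, hr.ne, h2 r hr]
    · simp [RamState.setVar_var, eval, h3, h4]
  | read a e ih =>
    intro η F σ₀ hF hη hM
    by_cases ha : a = 4
    · simp only [compile, ha, if_true]
      refine ((ih η F σ₀ hF hη hM).seq ((Triple.const F 0).conseq ?_ le_rfl (fun _ h => h))).conseq
        (fun _ h => h) (by simp [cost]) (fun _ h => h)
      rintro σ ⟨⟨h1, h2⟩, h3⟩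
      refine ⟨⟨h1, fun r hr => ?_⟩, ?_⟩
      · simp [RamState.setVar_var, hr.ne, h2 r hr]
      · simp [RamState.setVar_var, eval]
    · simp only [compile, ha, if_false]
      refine ((ih η F σ₀ hF hη hM).seq ((Triple.load F a F).conseq ?_ le_rfl
        (fun _ h => h))).conseq (fun _ h => h) (by simp [cost]) (fun _ h => h)
      rintro σ ⟨⟨h1, h2⟩, h3⟩
      refine ⟨⟨h1, fun r hr => ?_⟩, ?_⟩
      · simp [RamState.setVar_var, hr.ne, h2 r hr]
      · simp [RamState.setVar_var, eval, ha, h3, h1, hM.2.2.2 a ha]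
  | ite c e f ihc ihe ihf =>
    intro η F σ₀ hF hη hM
    have hc := ihc η F σ₀ hF hη hM
    refine (hc.seq (C' := e.cost.eval M.N + f.cost.eval M.N + 1) ?_).conseq
      (fun _ h => h) (by simp [cost]) (fun _ h => h)
    rintro σ ⟨h1, h3⟩
    by_cases h0 : σ.var F = 0
    · obtain ⟨t, τ, ht, hr, hτ⟩ := ihf η F σ₀ hF hη hM σ h1
      refine ⟨t + 1, τ, by omega, .ite_false h0 hr, hτ.1, ?_⟩
      simp [eval, ← h3, h0, hτ.2]
    · obtain ⟨t, τ, ht, hr, hτ⟩ := ihe η F σ₀ hF hη hM σ h1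
      refine ⟨t + 1, τ, by omega, .ite_true h0 hr, hτ.1, ?_⟩
      simp [eval, ← h3, h0, hτ.2]
  | sum x e ih =>
    intro η F σ₀ hF hη hM
    let Inv : ℕ → RamState → Prop := fun i σ => (σ.arr = σ₀.arr ∧ ∀ r < F, σ.var r = σ₀.var r) ∧
      σ.var F = ∑ j ∈ Finset.range i,
        e.eval M (Function.update (fun x => σ₀.var (η x)) x j)
    have hloop := Triple.for_loop (cnt := F + 1) (rem := F + 2) (tmp := F + 3) (N := M.N)
      (C := e.cost.eval M.N + 1)
      (P := .seq (e.compile (Function.update η x (F + 1)) (F + 3)) (.add F F (F + 3))) Inv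
      (by omega) (by omega) (by omega) (by omega) ?_ ?_
    · refine ((Triple.const F 0).seq hloop).conseq ?_ ?_ (fun σ h => h)
      · rintro σ ⟨h1, h2⟩
        refine ⟨⟨⟨h1, fun r hr => ?_⟩, ?_⟩, ?_⟩
        · simp [RamState.setVar_var, hr.ne, h2 r hr]
        · simp [RamState.setVar_var]
        · have h3 : 3 ≠ F := by omega
          simp [RamState.setVar_var, h3, h2 3 (by omega), hM.1]
      · simp [cost]; ring_nf; omega
    · rintro i σ τ ha hv ⟨⟨h1, h2⟩, h3⟩
      refine ⟨⟨ha.trans h1, fun r hr => ?_⟩, ?_⟩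
      · rw [hv r (by omega) (by omega) (by omega), h2 r hr]
      · rw [hv F (by omega) (by omega) (by omega), h3]
    · rintro i hi σ ⟨⟨⟨h1, h2⟩, h3⟩, h4, h5⟩
      obtain ⟨t, τ, ht, hr, ⟨h6, h7⟩, h8⟩ := ih (Function.update η x (F + 1)) (F + 3) σ (by omega)
        (fun y => by
          rw [Function.update_apply]
          split_ifs
          · omega
          · exact (hη y).trans (by omega))
        (hM.congr (fun a _ => by rw [h1]) (fun r hr => h2 r (by omega))) σ ⟨rfl, fun _ _ => rfl⟩
      refine ⟨t + 1, _, by omega, .seq hr (.add τ F F (F + 3)), ⟨⟨h6.trans h1, ?_⟩, ?_⟩, ?_, ?_⟩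
      · intro r hr
        simp [RamState.setVar_var, hr.ne, h7 r (by omega), h2 r hr]
      · have : (fun y => σ.var (Function.update η x (F + 1) y)) =
            Function.update (fun x => σ₀.var (η x)) x i := by
          funext y
          by_cases hy : y = x
          · subst hy; simp [h4]
          · simp [hy, h2 _ (hη y)]
        rw [Finset.sum_range_succ, RamState.setVar_var, if_pos rfl, h8, this,
          h7 F (by omega), h3]
      · simp [RamState.setVar_var, h7 (F + 1) (by omega), h4]
      · simp [RamState.setVar_var, h7 (F + 2) (by omega), h5]

/-! ### Programs that fill tables -/

/-- Run `P` for all `r, c < N` in lexicographic order, with `r`, `c` and `r * N + c` in the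
registers `6`, `8` and `10`. -/
def gridProg (P : RamProg) : RamProg :=
  .seq (.const 10 0) (forProg 6 7 11 (forProg 8 9 11
    (.seq P (.seq (.const 11 1) (.add 10 10 11)))))

/-- The rule for `gridProg`: if each call of `P` advances the invariant by one and leaves the
registers `6, …, 10` as they are, the invariant holds for `N * N` at the end. -/
theorem Triple.grid_loop {P : RamProg} {N C : ℕ} (Inv : ℕ → RamState → Prop)
    (hst : ∀ i σ τ, τ.arr = σ.arr → (∀ r < 6, τ.var r = σ.var r) → Inv i σ → Inv i τ)
    (hN : ∀ i σ, Inv i σ → σ.var 3 = N)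
    (h : ∀ r < N, ∀ c < N, ∀ σ, Inv (r * N + c) σ → σ.var 6 = r → σ.var 8 = c →
      σ.var 10 = r * N + c → ∃ t τ, t ≤ C ∧ Runs P σ t τ ∧ Inv (r * N + c + 1) τ ∧
        ∀ i, 6 ≤ i → i ≤ 10 → τ.var i = σ.var i) :
    Triple (Inv 0) (gridProg P) (N * (N * (C + 6) + 7) + 4) (Inv (N * N)) := by
  have inner : ∀ r < N, Triple
      (fun σ => (Inv (r * N + 0) σ ∧ σ.var 10 = r * N + 0 ∧ σ.var 6 = r ∧ σ.var 7 = N - r) ∧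
        σ.var 3 = N)
      (forProg 8 9 11 (.seq P (.seq (.const 11 1) (.add 10 10 11)))) (N * (C + 2 + 4) + 3)
      (fun σ => Inv (r * N + N) σ ∧ σ.var 10 = r * N + N ∧ σ.var 6 = r ∧ σ.var 7 = N - r) := by
    intro r hr
    refine Triple.for_loop (N := N)
      (fun c σ => Inv (r * N + c) σ ∧ σ.var 10 = r * N + c ∧ σ.var 6 = r ∧ σ.var 7 = N - r)
      (by omega) (by omega) (by omega) (by omega) ?_ ?_
    · rintro i σ τ ha hv ⟨h1, h2, h3, h4⟩
      refine ⟨hst _ σ τ ha (fun r hr => hv r (by omega) (by omega) (by omega)) h1, ?_, ?_, ?_⟩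
      · rw [hv 10 (by omega) (by omega) (by omega), h2]
      · rw [hv 6 (by omega) (by omega) (by omega), h3]
      · rw [hv 7 (by omega) (by omega) (by omega), h4]
    · rintro c hc σ ⟨⟨h1, h2, h3, h4⟩, h5, h6⟩
      obtain ⟨t, τ, ht, hrun, hI, hv⟩ := h r hr c hc σ h1 h3 h5 h2
      refine ⟨t + (1 + 1), _, by omega, .seq hrun (.seq (.const _ _ _) (.add _ _ _ _)), ?_⟩
      refine ⟨⟨?_, ?_, ?_, ?_⟩, ?_, ?_⟩
      · refine hst _ τ _ rfl (fun r hr => ?_) hI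
        have h10 : r ≠ 10 := by omega
        have h11 : r ≠ 11 := by omega
        simp [RamState.setVar_var, h10, h11]
      · simp [RamState.setVar_var, hv 10, h2, add_assoc]
      · simp [RamState.setVar_var, hv 6, h3]
      · simp [RamState.setVar_var, hv 7, h4]
      · simp [RamState.setVar_var, hv 8, h5]
      · simp [RamState.setVar_var, hv 9, h6]
  have outer : Triple (fun σ => (Inv (0 * N) σ ∧ σ.var 10 = 0 * N) ∧ σ.var 3 = N) _ _ _ :=
    Triple.for_loop (cnt := 6) (rem := 7) (tmp := 11) (N := N)
      (P := forProg 8 9 11 (.seq P (.seq (.const 11 1) (.add 10 10 11))))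
      (fun r σ => Inv (r * N) σ ∧ σ.var 10 = r * N)
      (by omega) (by omega) (by omega) (by omega)
      (by
        rintro i σ τ ha hv ⟨h1, h2⟩
        refine ⟨hst _ σ τ ha (fun r hr => hv r (by omega) (by omega) (by omega)) h1, ?_⟩
        rw [hv 10 (by omega) (by omega) (by omega), h2])
      (fun r hr => (inner r hr).conseq
        (by rintro σ ⟨⟨h1, h2⟩, h3, h4⟩; exact ⟨⟨h1, h2, h3, h4⟩, hN _ _ h1⟩) le_rfl
        (by rintro σ ⟨h1, h2, h3, h4⟩; rw [Nat.succ_mul]; exact ⟨⟨h1, h2⟩, h3, h4⟩))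
  refine ((Triple.const 10 0).seq outer).conseq ?_ (by ring_nf; omega) (fun σ h => h.1)
  intro σ hσ
  have : Inv 0 (σ.setVar 10 0) := hst _ σ _ rfl (fun r hr => by
    have h10 : r ≠ 10 := by omega
    simp [RamState.setVar_var, h10]) hσ
  refine ⟨⟨by rwa [zero_mul], ?_⟩, hN _ _ this⟩
  simp [RamState.setVar_var]

/-- Write `g r c` into entry `r * N + c` of array `a`, for all `r, c < N`. -/
def Store.fill (M : Store) (a : ℕ) (g : ℕ → ℕ → ℕ) : Store :=
  M.setArr a fun i => if i < M.N * M.N then g (i / M.N) (i % M.N) else M.arr a i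

/-- Fill array `a` repeatedly; the entries written in step `t` may depend on `t` and on the
contents of the array before that step. -/
def Store.iterFill (a : ℕ) (f : Store → ℕ → ℕ → ℕ → ℕ) (M : Store) : ℕ → Store
  | 0 => M
  | t + 1 => (iterFill a f M t).fill a (f (iterFill a f M t) t)

/-- The registers that hold the variables `0`, `1` and `2` of the expression in a table program. -/
def tableReg (x : ℕ) : ℕ := if x = 0 then 4 else if x = 1 then 6 else if x = 2 then 8 else 0

/-- Simultaneously evaluate `e` for all `r, c < N`, and store the values in array `a`. The values
are collected in the buffer and copied when all of them are known. -/
def fillProg (a : ℕ) (e : Expr) : RamProg :=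
  .seq (gridProg (.seq (e.compile tableReg 12) (.store 4 10 12)))
    (gridProg (.seq (.load 12 4 10) (.store a 10 12)))

/-- The program for `Store.iterFill`. -/
def tableProg (a : ℕ) (e : Expr) : RamProg := forProg 4 5 11 (fillProg a e)

/-- A bound on the running time of `fillProg`, as a polynomial in `N`. -/
noncomputable def fillCost (e : Expr) : Polynomial ℕ :=
  (Polynomial.X * (Polynomial.X * (e.cost + 7) + 7) + 4) +
    (Polynomial.X * (Polynomial.X * 8 + 7) + 4)

/-- Although `e` may read the array `a` that is overwritten, all entries are computed from the old
contents, because the new ones are collected in the buffer. -/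
theorem fillProg_spec {a : ℕ} (ha : a ≠ 4) (e : Expr) (M : Store) (g : ℕ → ℕ → ℕ) (t u : ℕ)
    (hg : ∀ ρ : ℕ → ℕ, ρ 0 = t → ρ 1 < M.N → ρ 2 < M.N → e.eval M ρ = g (ρ 1) (ρ 2)) :
    Triple (fun σ => Represents M σ ∧ σ.var 4 = t ∧ σ.var 5 = u) (fillProg a e)
      ((fillCost e).eval M.N)
      (fun σ => Represents (M.fill a g) σ ∧ σ.var 4 = t ∧ σ.var 5 = u) := by
  have hdiv : ∀ r c, c < M.N → (r * M.N + c) / M.N = r ∧ (r * M.N + c) % M.N = c := by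
    intro r c hc
    constructor
    · rw [mul_comm, Nat.mul_add_div (by omega), Nat.div_eq_of_lt hc, add_zero]
    · exact Nat.mul_add_mod_of_lt hc
  have first := Triple.grid_loop (N := M.N) (C := e.cost.eval M.N + 1)
    (P := .seq (e.compile tableReg 12) (.store 4 10 12))
    (fun j σ => (Represents M σ ∧ σ.var 4 = t ∧ σ.var 5 = u) ∧
      ∀ i < j, σ.arr 4 i = g (i / M.N) (i % M.N)) ?_ ?_ ?_
  rotate_left
  · rintro i σ τ h1 h2 ⟨⟨h3, h4, h5⟩, h6⟩
    exact ⟨⟨h3.congr (fun a _ => by rw [h1]) (fun r hr => h2 r (by omega)),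
      by rw [h2 4 (by omega), h4], by rw [h2 5 (by omega), h5]⟩, by rw [h1]; exact h6⟩
  · rintro i σ ⟨⟨h1, -⟩, -⟩
    exact h1.1
  · rintro r hr c hc σ ⟨⟨h1, h2, h3⟩, h4⟩ h5 h6 h7
    obtain ⟨t', τ, ht', hrun, ⟨h8, h9⟩, h10⟩ := Expr.compile_spec M e tableReg 12 σ (by omega)
      (fun x => by unfold tableReg; split_ifs <;> omega) h1 σ ⟨rfl, fun _ _ => rfl⟩
    refine ⟨t' + 1, _, by omega, .seq hrun (.store _ _ _ _), ⟨⟨?_, ?_, ?_⟩, ?_⟩, ?_⟩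
    · refine h1.congr (fun b hb => ?_) (fun r hr => by simp [h9 r (by omega)])
      funext i
      simp [RamState.setArr_arr, hb, h8]
    · simp [h9 4, h2]
    · simp [h9 5, h3]
    · intro i hi
      rw [RamState.setArr_arr, h9 10 (by omega), h7, h8]
      split_ifs with hc'
      · rw [hc'.2, (hdiv r c hc).1, (hdiv r c hc).2, h10, hg]
        · simp [tableReg, h5, h6]
        · simp [tableReg, h2]
        · simp [tableReg, h5, hr]
        · simp [tableReg, h6, hc]
      · exact h4 i (by omega)
    · intro i h6 h10
      simp [h9 i (by omega)]
  have second := Triple.grid_loop (N := M.N) (C := 2)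
    (P := .seq (.load 12 4 10) (.store a 10 12))
    (fun j σ => ((σ.var 3 = M.N ∧ σ.var 0 = M.n ∧ σ.var 1 = M.s) ∧ σ.var 4 = t ∧ σ.var 5 = u) ∧
      (∀ b, b ≠ 4 → b ≠ a → σ.arr b = M.arr b) ∧
      (∀ i < M.N * M.N, σ.arr 4 i = g (i / M.N) (i % M.N)) ∧
      (∀ i, σ.arr a i = if i < j ∧ i < M.N * M.N then g (i / M.N) (i % M.N) else M.arr a i))
      ?_ ?_ ?_
  rotate_left
  · rintro i σ τ h1 h2 ⟨⟨⟨h3, h4, h5⟩, h6, h7⟩, h8⟩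
    rw [h1, h2 3 (by omega), h2 0 (by omega), h2 1 (by omega), h2 4 (by omega), h2 5 (by omega)]
    exact ⟨⟨⟨h3, h4, h5⟩, h6, h7⟩, h8⟩
  · rintro i σ ⟨⟨h1, -⟩, -⟩
    exact h1.1
  · rintro r hr c hc σ ⟨h1, h2, h3, h4⟩ h5 h6 h7
    have hlt : r * M.N + c < M.N * M.N := by nlinarith
    refine ⟨1 + 1, _, by omega, .seq (.load _ _ _ _) (.store _ _ _ _),
      ⟨?_, ?_, ?_, ?_⟩, ?_⟩
    · simpa [RamState.setVar_var] using h1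
    · intro b hb4 hba
      rw [← h2 b hb4 hba]
      funext i
      simp [RamState.setArr_arr, hba]
    · intro i hi
      simp [RamState.setArr_arr, ha.symm, h3 i hi]
    · intro i
      rw [RamState.setArr_arr]
      simp only [RamState.setVar_var, RamState.setVar_arr, true_and, h7, if_true,
        show (10 : ℕ) ≠ 12 by omega, if_false]
      split_ifs with h8 h9 h9
      · rw [h3 _ hlt, h8]
      · omega
      · rw [h4 i, if_pos (by omega)]
      · rw [h4 i, if_neg (by omega)]
    · intro i h6 h10
      have : i ≠ 12 := by omega
      simp [RamState.setVar_var, this]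
  refine ((first.conseq (q' := _) ?_ le_rfl ?_).seq second).conseq (fun _ h => h)
    (by simp [fillCost]; ring_nf; omega) ?_
  · rintro σ h
    exact ⟨h, by simp⟩
  · rintro σ ⟨⟨h1, h2, h3⟩, h4⟩
    exact ⟨⟨⟨h1.1, h1.2.1, h1.2.2.1⟩, h2, h3⟩, fun b hb _ => h1.2.2.2 b hb, h4,
      fun i => by simp [h1.2.2.2 a ha]⟩
  · rintro σ ⟨⟨h1, h2, h3⟩, h4, h5, h6⟩
    refine ⟨⟨h1.1, h1.2.1, h1.2.2, fun b hb => ?_⟩, h2, h3⟩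
    by_cases hba : b = a
    · subst hba
      funext i
      simp [Store.fill, Store.setArr, h6]
    · simp [Store.fill, Store.setArr, hba, h4 b hb hba]

theorem Store.fill_arr_of_ne (M : Store) {a b : ℕ} (g) (h : b ≠ a) :
    (M.fill a g).arr b = M.arr b := by
  simp [Store.fill, Store.setArr, h]

theorem Store.fill_arr (M : Store) (a : ℕ) (g : ℕ → ℕ → ℕ) {r c : ℕ} (hr : r < M.N)
    (hc : c < M.N) : (M.fill a g).arr a (r * M.N + c) = g r c := by
  have h : r * M.N + c < M.N * M.N := by nlinarith
  simp only [Store.fill, Store.setArr, Function.update_self, h, if_true]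
  rw [Nat.mul_add_mod_of_lt hc, mul_comm, Nat.mul_add_div (by omega), Nat.div_eq_of_lt hc,
    add_zero]

@[simp] theorem Store.iterFill_N (a f M t) : (Store.iterFill a f M t).N = M.N := by
  induction t with
  | zero => rfl
  | succ t ih => exact ih

@[simp] theorem Store.iterFill_n (a f M t) : (Store.iterFill a f M t).n = M.n := by
  induction t with
  | zero => rfl
  | succ t ih => exact ih

@[simp] theorem Store.iterFill_s (a f M t) : (Store.iterFill a f M t).s = M.s := by
  induction t with
  | zero => rfl
  | succ t ih => exact ih

theorem Store.iterFill_arr_of_ne {a b : ℕ} (f M t) (h : b ≠ a) :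
    (Store.iterFill a f M t).arr b = M.arr b := by
  induction t with
  | zero => rfl
  | succ t ih => rw [Store.iterFill, Store.fill_arr_of_ne _ _ h, ih]

theorem Store.iterFill_succ_arr (a : ℕ) (f) (M : Store) (t : ℕ) {r c : ℕ} (hr : r < M.N)
    (hc : c < M.N) : (Store.iterFill a f M (t + 1)).arr a (r * M.N + c) =
      f (Store.iterFill a f M t) t r c := by
  have := Store.fill_arr (Store.iterFill a f M t) a (f (Store.iterFill a f M t) t) (r := r)
    (c := c) (by simpa) (by simpa)
  simpa [Store.iterFill] using this

theorem tableProg_spec {a : ℕ} (ha : a ≠ 4) (e : Expr) (M : Store) (f : Store → ℕ → ℕ → ℕ → ℕ)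
    (hf : ∀ M' : Store, M'.N = M.N → M'.n = M.n → M'.s = M.s → ∀ ρ : ℕ → ℕ, ρ 0 < M.N →
      ρ 1 < M.N → ρ 2 < M.N → e.eval M' ρ = f M' (ρ 0) (ρ 1) (ρ 2)) :
    Triple (Represents M) (tableProg a e) ((Polynomial.X * (fillCost e + 4) + 3).eval M.N)
      (Represents (Store.iterFill a f M M.N)) := by
  refine (Triple.for_loop (cnt := 4) (rem := 5) (tmp := 11) (N := M.N)
    (C := (fillCost e).eval M.N) (P := fillProg a e)
    (fun t σ => Represents (Store.iterFill a f M t) σ) (by omega) (by omega) (by omega) (by omega)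
    ?_ ?_).conseq (fun σ h => ⟨h, h.1⟩) (by simp) (fun σ h => h)
  · intro i σ τ h1 h2 h3
    exact h3.congr (fun a _ => by rw [h1]) (fun r hr => h2 r (by omega) (by omega) (by omega))
  · intro i hi
    have := fillProg_spec ha e (Store.iterFill a f M i) (f (Store.iterFill a f M i) i) i (M.N - i)
      (fun ρ h0 h1 h2 => by
        simp only [Store.iterFill_N] at h1 h2
        rw [hf _ (by simp) (by simp) (by simp) ρ (by omega) h1 h2, h0])
    simpa [Store.iterFill] using this

/-! ### Computing the range of the loops -/

/-- Multiply variable `3` by `n + 2`. -/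
def mulStep : RamProg :=
  .seq (.copy 4 0) (.seq (.const 5 2) (.seq (.add 4 4 5) (.seq (.const 6 0)
    (.seq (.loop 4 (.seq (.add 6 6 3) (.seq (.const 5 1) (.sub 4 4 5)))) (.copy 3 6)))))

/-- Set variable `3` to `(n + 2) ^ K`. -/
def powProg : ℕ → RamProg
  | 0 => .const 3 1
  | K + 1 => .seq (powProg K) mulStep

theorem powProg_spec (K : ℕ) (σ₀ : RamState) :
    Triple (fun σ => σ = σ₀) (powProg K) (1 + K * (4 * σ₀.var 0 + 14))
      (fun σ => σ.arr = σ₀.arr ∧ σ.var 0 = σ₀.var 0 ∧ σ.var 1 = σ₀.var 1 ∧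
        σ.var 3 = (σ₀.var 0 + 2) ^ K) := by
  induction K with
  | zero =>
    refine (Triple.const 3 1).conseq ?_ (by omega) (fun _ h => h)
    rintro _ rfl
    simp [RamState.setVar_var]
  | succ K ih =>
    refine (ih.seq (C' := 4 * σ₀.var 0 + 14) (r := fun σ => σ.arr = σ₀.arr ∧
      σ.var 0 = σ₀.var 0 ∧ σ.var 1 = σ₀.var 1 ∧ σ.var 3 = (σ₀.var 0 + 2) ^ (K + 1)) ?_).conseq
      (fun _ h => h) (by ring_nf; omega) (fun _ h => h)
    have hl := Triple.countdown (x := 4) (m := σ₀.var 0 + 2) (C := 3)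
      (P := .seq (.add 6 6 3) (.seq (.const 5 1) (.sub 4 4 5)))
      (fun i σ => (σ.arr = σ₀.arr ∧ σ.var 0 = σ₀.var 0 ∧ σ.var 1 = σ₀.var 1 ∧
        σ.var 3 = (σ₀.var 0 + 2) ^ K) ∧ σ.var 6 = i * (σ₀.var 0 + 2) ^ K) (by
        rintro i hi σ ⟨⟨⟨h1, h2, h3, h4⟩, h5⟩, h6⟩
        refine ⟨1 + (1 + 1), _, by omega, .seq (.add _ _ _ _) (.seq (.const _ _ _)
          (.sub _ _ _ _)), ?_⟩
        simp [RamState.setVar_var, h1, h2, h3, h4, h5, h6, Nat.succ_mul]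
        omega)
    refine ((Triple.copy 4 0).seq ((Triple.const 5 2).seq ((Triple.add 4 4 5).seq
      ((Triple.const 6 0).seq (hl.seq ((Triple.copy 3 6).conseq ?_ le_rfl
        (fun _ h => h))))))).conseq ?_ (by ring_nf; omega) (fun _ h => h)
    · rintro σ ⟨⟨h1, h2, h3, h4⟩, h5⟩
      simp [RamState.setVar_var, h1, h2, h3, h5, pow_succ, mul_comm]
    · rintro σ ⟨h1, h2, h3, h4⟩
      simp [RamState.setVar_var, h1, h2, h3, h4]

/-! ### Functions that are definable by expressions -/

/-- A context: a type whose elements consist of a store and of the values `reg a i` of the variables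
`i < len`, which are all smaller than the range `N` of the loops when the element is well formed.
The elements of `(Store × ℕ) × ℕ`, for instance, have the variables `0` and `1`, and a bound
variable of an expression becomes a further factor `ℕ`. -/
class Context (α : Type) where
  store : α → Store
  len : ℕ
  reg : α → ℕ → ℕ
  wf : α → Prop
  wf_store : ∀ a, wf a → 0 < (store a).n ∧ (store a).n + 3 ≤ (store a).N

instance : Context Store where
  store M := M
  len := 0
  reg _ _ := 0
  wf M := 0 < M.n ∧ M.n + 3 ≤ M.N
  wf_store _ h := h

instance {α : Type} [Context α] : Context (α × ℕ) where
  store p := Context.store p.1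
  len := Context.len α + 1
  reg p i := if i = Context.len α then p.2 else Context.reg p.1 i
  wf p := Context.wf p.1 ∧ p.2 < (Context.store p.1).N
  wf_store p h := Context.wf_store p.1 h.1

open Context

/-- On well formed elements, `f` is the value of an expression. -/
def Definable {α : Type} [Context α] (f : α → ℕ) : Prop :=
  ∃ e : Expr, ∀ a, wf a → ∀ ρ : ℕ → ℕ, (∀ i < len α, ρ i = reg a i) → e.eval (store a) ρ = f a

/-- On well formed elements, `p` is decided by an expression. -/
def DefinablePred {α : Type} [Context α] (p : α → Prop) : Prop :=
  ∃ f : α → ℕ, Definable f ∧ ∀ a, wf a → (f a ≠ 0 ↔ p a)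

namespace Definable

variable {α : Type} [Context α] {f g : α → ℕ}

theorem congr (hf : Definable f) (h : ∀ a, wf a → f a = g a) : Definable g := by
  obtain ⟨e, he⟩ := hf
  exact ⟨e, fun a ha ρ hρ => (he a ha ρ hρ).trans (h a ha)⟩

theorem const (c : ℕ) : Definable (fun _ : α => c) := ⟨.const c, fun _ _ _ _ => rfl⟩

theorem N : Definable (fun a : α => (store a).N) := ⟨.N, fun _ _ _ _ => rfl⟩

theorem n : Definable (fun a : α => (store a).n) := ⟨.n, fun _ _ _ _ => rfl⟩

theorem s : Definable (fun a : α => (store a).s) := ⟨.s, fun _ _ _ _ => rfl⟩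

theorem var : Definable (fun p : α × ℕ => p.2) :=
  ⟨.var (len α), fun p _ ρ hρ => by
    rw [Expr.eval, hρ (len α) (Nat.lt_succ_self _)]; simp [reg]⟩

theorem wk (hf : Definable f) : Definable (fun p : α × ℕ => f p.1) := by
  obtain ⟨e, he⟩ := hf
  refine ⟨e, fun p hp ρ hρ => he p.1 hp.1 ρ fun i hi => ?_⟩
  rw [hρ i (Nat.lt_succ_of_lt hi)]
  simp [reg, hi.ne]

theorem add (hf : Definable f) (hg : Definable g) : Definable (fun a => f a + g a) := by
  obtain ⟨e, he⟩ := hf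
  obtain ⟨e', he'⟩ := hg
  exact ⟨.add e e', fun a ha ρ hρ => by rw [Expr.eval, he a ha ρ hρ, he' a ha ρ hρ]⟩

theorem sub (hf : Definable f) (hg : Definable g) : Definable (fun a => f a - g a) := by
  obtain ⟨e, he⟩ := hf
  obtain ⟨e', he'⟩ := hg
  exact ⟨.sub e e', fun a ha ρ hρ => by rw [Expr.eval, he a ha ρ hρ, he' a ha ρ hρ]⟩

theorem read {i : ℕ} (hi : i ≠ 4) (hf : Definable f) :
    Definable (fun a => (store a).arr i (f a)) := by
  obtain ⟨e, he⟩ := hf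
  exact ⟨.read i e, fun a ha ρ hρ => by rw [Expr.eval, if_neg hi, he a ha ρ hρ]⟩

theorem sum_pair {f : α × ℕ → ℕ} (hf : Definable f) :
    Definable (fun a => ∑ i ∈ Finset.range (store a).N, f (a, i)) := by
  obtain ⟨e, he⟩ := hf
  refine ⟨.sum (len α) e, fun a ha ρ hρ => Finset.sum_congr rfl fun i hi => ?_⟩
  refine he (a, i) ⟨ha, Finset.mem_range.1 hi⟩ _ fun j hj => ?_
  by_cases h : j = len α
  · simp [reg, h]
  · have : j < len α := by have : j < len α + 1 := hj; omega
    simp [reg, h, hρ j this]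

theorem ite {p : α → Prop} [∀ a, Decidable (p a)] (hp : DefinablePred p) (hf : Definable f)
    (hg : Definable g) : Definable (fun a => if p a then f a else g a) := by
  obtain ⟨c, ⟨e₀, he₀⟩, hc⟩ := hp
  obtain ⟨e, he⟩ := hf
  obtain ⟨e', he'⟩ := hg
  refine ⟨.ite e₀ e e', fun a ha ρ hρ => ?_⟩
  rw [Expr.eval, he a ha ρ hρ, he' a ha ρ hρ, he₀ a ha ρ hρ]
  simp only [hc a ha]

/-- The variant of `ite` for an arbitrary decision procedure in the goal. -/
theorem ite_of {p : α → Prop} {inst : ∀ a, Decidable (p a)} (hp : DefinablePred p)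
    (hf : Definable f) (hg : Definable g) : Definable (fun a => if p a then f a else g a) :=
  ite hp hf hg

end Definable

namespace DefinablePred

variable {α : Type} [Context α] {f g : α → ℕ} {p q : α → Prop}

theorem congr (hp : DefinablePred p) (h : ∀ a, wf a → (p a ↔ q a)) : DefinablePred q := by
  obtain ⟨f, hf, hp⟩ := hp
  exact ⟨f, hf, fun a ha => (hp a ha).trans (h a ha)⟩

theorem ne_zero (hf : Definable f) : DefinablePred (fun a => f a ≠ 0) :=
  ⟨f, hf, fun _ _ => Iff.rfl⟩

theorem lt (hf : Definable f) (hg : Definable g) : DefinablePred (fun a => f a < g a) :=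
  ⟨_, hg.sub hf, fun a _ => by omega⟩

theorem le (hf : Definable f) (hg : Definable g) : DefinablePred (fun a => f a ≤ g a) :=
  (lt hf (hg.add (.const 1))).congr fun _ _ => by omega

theorem not (hp : DefinablePred p) : DefinablePred (fun a => ¬ p a) := by
  obtain ⟨f, hf, hp⟩ := hp
  exact ⟨_, (Definable.const 1).sub hf, fun a ha => by
    have := hp a ha; show _ ↔ ¬ p a; rw [← this]; omega⟩

theorem or (hp : DefinablePred p) (hq : DefinablePred q) : DefinablePred (fun a => p a ∨ q a) := by
  obtain ⟨f, hf, hp⟩ := hp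
  obtain ⟨g, hg, hq⟩ := hq
  exact ⟨_, hf.add hg, fun a ha => by
    show _ ↔ p a ∨ q a; rw [← hp a ha, ← hq a ha]; omega⟩

theorem and (hp : DefinablePred p) (hq : DefinablePred q) :
    DefinablePred (fun a => p a ∧ q a) :=
  (hp.not.or hq.not).not.congr fun _ _ => by tauto

theorem imp (hp : DefinablePred p) (hq : DefinablePred q) :
    DefinablePred (fun a => p a → q a) :=
  (hp.not.or hq).congr fun _ _ => by tauto

theorem eq (hf : Definable f) (hg : Definable g) : DefinablePred (fun a => f a = g a) :=
  ((le hf hg).and (le hg hf)).congr fun _ _ => by omega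

theorem wk (hp : DefinablePred p) : DefinablePred (fun x : α × ℕ => p x.1) := by
  obtain ⟨f, hf, hp⟩ := hp
  exact ⟨_, hf.wk, fun a ha => hp a.1 ha.1⟩

theorem exN {p : α → ℕ → Prop} (hp : DefinablePred fun x : α × ℕ => p x.1 x.2) :
    DefinablePred (fun a => ∃ i < (store a).N, p a i) := by
  obtain ⟨f, hf, hp⟩ := hp
  refine ⟨_, hf.sum_pair, fun a ha => ?_⟩
  rw [Ne, Finset.sum_eq_zero_iff]
  push Not
  constructor
  · rintro ⟨i, hi, h⟩
    exact ⟨i, Finset.mem_range.1 hi, (hp (a, i) ⟨ha, Finset.mem_range.1 hi⟩).1 h⟩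
  · rintro ⟨i, hi, h⟩
    exact ⟨i, Finset.mem_range.2 hi, (hp (a, i) ⟨ha, hi⟩).2 h⟩

theorem allN {p : α → ℕ → Prop} (hp : DefinablePred fun x : α × ℕ => p x.1 x.2) :
    DefinablePred (fun a => ∀ i < (store a).N, p a i) :=
  (exN (p := fun a i => ¬ p a i) hp.not).not.congr fun _ _ => by push Not; rfl

theorem exn {p : α → ℕ → Prop} (hp : DefinablePred fun x : α × ℕ => p x.1 x.2) :
    DefinablePred (fun a => ∃ i < (store a).n, p a i) :=
  (exN (p := fun a i => i < (store a).n ∧ p a i) ((lt .var Definable.n.wk).and hp)).congr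
    fun a ha => by
    have := wf_store a ha
    exact ⟨fun ⟨i, _, h⟩ => ⟨i, h⟩, fun ⟨i, h1, h2⟩ => ⟨i, by omega, h1, h2⟩⟩

theorem alln {p : α → ℕ → Prop} (hp : DefinablePred fun x : α × ℕ => p x.1 x.2) :
    DefinablePred (fun a => ∀ i < (store a).n, p a i) :=
  (exn (p := fun a i => ¬ p a i) hp.not).not.congr fun _ _ => by push Not; rfl

end DefinablePred

namespace Definable

variable {α : Type} [Context α] {f g : α → ℕ}

/-- Exchange of the last variable for a new one, below the old one. -/
theorem swap {f : α × ℕ → ℕ} (hf : Definable f) :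
    Definable (fun q : (α × ℕ) × ℕ => f (q.1.1, q.2)) := by
  obtain ⟨e, he⟩ := hf
  -- the old variable is shadowed by a bound one that runs until it equals the new variable
  refine ⟨.sum (len α) (.ite (.add (.sub (.var (len α)) (.var (len α + 1)))
    (.sub (.var (len α + 1)) (.var (len α)))) (.const 0) e), ?_⟩
  rintro ⟨⟨a, x⟩, y⟩ ⟨⟨ha, hx⟩, hy⟩ ρ hρ
  change x < (store a).N at hx
  change y < (store a).N at hy
  change ∑ i ∈ Finset.range (store a).N, _ = _
  have hy' : ρ (len α + 1) = y := by
    rw [hρ (len α + 1) (Nat.lt_succ_self _)]; simp [reg, len]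
  rw [Finset.sum_eq_single y]
  · simp only [Expr.eval, Function.update_self, Function.update_of_ne (Nat.succ_ne_self _), hy',
      Nat.sub_self, ne_eq, not_true, if_false, add_zero]
    refine he (a, y) ⟨ha, hy⟩ _ fun j hj => ?_
    by_cases h : j = len α
    · simp [reg, h]
    · have h' : j < len α := by have : j < len α + 1 := hj; omega
      have : ρ j = _ := hρ j (by change j < len α + 1 + 1; omega)
      have h2 : j ≠ len α + 1 := by omega
      simp [reg, h, this, len, h2]
  · intro i _ hi
    have : i - y + (y - i) ≠ 0 := by omega
    simp only [Expr.eval, Function.update_self, Function.update_of_ne (Nat.succ_ne_self _), hy',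
      if_pos this]
  · intro h
    exact absurd (Finset.mem_range.2 hy) h

theorem subst {f : α → ℕ → ℕ} (hf : Definable fun x : α × ℕ => f x.1 x.2) (hg : Definable g)
    (h : ∀ a, wf a → g a < (store a).N) : Definable (fun a => f a (g a)) := by
  refine (Definable.ite (DefinablePred.eq .var hg.wk) hf (.const 0)).sum_pair.congr fun a ha => ?_
  show ∑ i ∈ _, (if i = g a then f a i else 0) = _
  rw [Finset.sum_ite_eq', if_pos (Finset.mem_range.2 (h a ha))]

theorem sumn {f : α → ℕ → ℕ} (hf : Definable fun x : α × ℕ => f x.1 x.2) :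
    Definable (fun a => ∑ i ∈ Finset.range (store a).n, f a i) := by
  refine (Definable.ite (DefinablePred.lt .var n.wk) hf (.const 0)).sum_pair.congr fun a ha => ?_
  have := wf_store a ha
  rw [← Finset.sum_filter]
  refine Finset.sum_congr ?_ fun _ _ => rfl
  ext i
  simp; omega

theorem countn {p : α → ℕ → Prop} {_ : ∀ a, DecidablePred (p a)}
    (hp : DefinablePred fun x : α × ℕ => p x.1 x.2) :
    Definable (fun a => ((Finset.range (store a).n).filter (p a)).card) := by
  refine (sumn (f := fun a i => if p a i then 1 else 0)
    (Definable.ite hp (.const 1) (.const 0))).congr fun a ha => ?_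
  rw [Finset.card_filter]

theorem mul (hf : Definable f) (hg : Definable g) (h : ∀ a, wf a → f a ≤ (store a).N) :
    Definable (fun a => f a * g a) := by
  refine (Definable.ite (DefinablePred.lt .var hf.wk) hg.wk (.const 0)).sum_pair.congr
    fun a ha => ?_
  have := h a ha
  show ∑ i ∈ _, (if i < f a then g a else 0) = _
  rw [← Finset.sum_filter, Finset.sum_const, smul_eq_mul]
  congr 1
  rw [show (Finset.range (store a).N).filter (fun i => i < f a) = Finset.range (f a) by
    ext i; simp; omega, Finset.card_range]

theorem div (hf : Definable f) (hg : Definable g) (h : ∀ a, wf a → f a ≤ (store a).N)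
    (h' : ∀ a, wf a → 0 < g a) : Definable (fun a => f a / g a) := by
  refine (Definable.ite (DefinablePred.le ((var.add (.const 1)).mul hg.wk ?_) hf.wk)
    (.const 1) (.const 0)).sum_pair.congr fun a ha => ?_
  · rintro ⟨a, i⟩ ⟨-, hi⟩
    exact hi
  · rw [← Finset.card_filter]
    rw [show (Finset.range (store a).N).filter (fun i => (i + 1) * g a ≤ f a) =
      Finset.range (f a / g a) by
        ext i
        have h1 := h a ha
        have h2 := Nat.div_le_self (f a) (g a)
        have h3 := Nat.le_div_iff_mul_le (h' a ha) (x := i + 1) (y := f a)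
        simp only [Finset.mem_filter, Finset.mem_range, ← h3]
        omega, Finset.card_range]

theorem mod (hf : Definable f) (hg : Definable g) (h : ∀ a, wf a → f a ≤ (store a).N)
    (h' : ∀ a, wf a → 0 < g a) : Definable (fun a => f a % g a) :=
  (hf.sub ((hf.div hg h h').mul hg fun a ha => (Nat.div_le_self _ _).trans (h a ha))).congr
    fun a _ => by rw [mul_comm]; exact (Nat.mod_eq_sub_mul_div).symm

end Definable

theorem DefinablePred.swap {α : Type} [Context α] {p : α × ℕ → Prop} (hp : DefinablePred p) :
    DefinablePred (fun q : (α × ℕ) × ℕ => p (q.1.1, q.2)) := by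
  obtain ⟨f, hf, hp⟩ := hp
  exact ⟨_, hf.swap, fun q hq => hp (q.1.1, q.2) ⟨hq.1.1, hq.2⟩⟩

theorem Definable.least {α : Type} [Context α] {p : α → ℕ → Prop}
    (hp : DefinablePred fun x : α × ℕ => p x.1 x.2) :
    Definable (fun a => sInf {i | i < (store a).N ∧ p a i}) := by
  classical
  have hlt : DefinablePred fun x : α × ℕ => ∀ j < (store x.1).N, j < x.2 → ¬ p x.1 j :=
    DefinablePred.allN ((DefinablePred.lt .var Definable.var.wk).imp hp.swap.not)
  refine (Definable.ite (hp.and hlt) .var (.const 0)).sum_pair.congr fun a ha => ?_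
  by_cases h : ∃ i < (store a).N, p a i
  · have hne : {i | i < (store a).N ∧ p a i}.Nonempty := h
    obtain ⟨h1, h2⟩ := Nat.sInf_mem hne
    rw [Finset.sum_eq_single (sInf {i | i < (store a).N ∧ p a i})]
    · refine if_pos ⟨h2, fun i hi hlt hpi => ?_⟩
      exact Nat.notMem_of_lt_sInf hlt ⟨hi, hpi⟩
    · intro i hi hne'
      refine if_neg fun ⟨h3, h4⟩ => hne' ?_
      refine le_antisymm ?_ (Nat.sInf_le ⟨Finset.mem_range.1 hi, h3⟩)
      by_contra hlt
      exact h4 _ h1 (by simpa using hlt) h2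
    · intro h3
      exact absurd (Finset.mem_range.2 h1) h3
  · push Not at h
    rw [show {i | i < (store a).N ∧ p a i} = ∅ by
      ext i; simpa using h i, Nat.sInf_empty]
    refine Finset.sum_eq_zero fun i hi => if_neg fun h' => h i (Finset.mem_range.1 hi) h'.1

/-- A store transformation is computable if a program performs it in a number of steps that is
polynomial in the range `N` of the loops. -/
def StoreComputable (F : Store → Store) : Prop :=
  ∃ (P : RamProg) (C : Polynomial ℕ), ∀ M : Store, wf M →
    Triple (Represents M) P (C.eval M.N) (Represents (F M)) ∧ wf (F M) ∧ (F M).N = M.N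

theorem StoreComputable.comp {F G : Store → Store} (hG : StoreComputable G)
    (hF : StoreComputable F) : StoreComputable (fun M => G (F M)) := by
  obtain ⟨P, C, hP⟩ := hF
  obtain ⟨Q, C', hQ⟩ := hG
  refine ⟨.seq P Q, C + C', fun M hM => ?_⟩
  obtain ⟨h1, h2, h3⟩ := hP M hM
  obtain ⟨h4, h5, h6⟩ := hQ (F M) h2
  refine ⟨?_, h5, h6.trans h3⟩
  rw [Polynomial.eval_add]
  rw [h3] at h4
  exact h1.seq h4

/-- Tables whose entries are definable are computable. -/
theorem Definable.computable_iterFill {a : ℕ} (ha : a ≠ 4) {f : Store → ℕ → ℕ → ℕ → ℕ}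
    (hf : Definable (fun p : ((Store × ℕ) × ℕ) × ℕ => f p.1.1.1 p.1.1.2 p.1.2 p.2)) :
    StoreComputable (fun M => Store.iterFill a f M M.N) := by
  obtain ⟨e, he⟩ := hf
  refine ⟨tableProg a e, _, fun M hM => ⟨tableProg_spec ha e M f ?_, ?_, by simp⟩⟩
  · intro M' hN hn hs ρ h0 h1 h2
    refine he (((M', ρ 0), ρ 1), ρ 2) ⟨⟨⟨?_, ?_⟩, ?_⟩, ?_⟩ ρ ?_
    · change 0 < M'.n ∧ M'.n + 3 ≤ M'.N
      rw [hN, hn]; exact hM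
    · exact lt_of_lt_of_eq h0 hN.symm
    · exact lt_of_lt_of_eq h1 hN.symm
    · exact lt_of_lt_of_eq h2 hN.symm
    · intro i hi
      change i < 0 + 1 + 1 + 1 at hi
      interval_cases i <;> simp [reg, len]
  · change 0 < (Store.iterFill a f M M.N).n ∧ _ ≤ (Store.iterFill a f M M.N).N
    rw [Store.iterFill_n, Store.iterFill_N]
    exact hM

/-! ### The rooted tree and its thin branches -/

section DynamicProgram

open Classical

/-- An instance on the vertices `0, …, n - 1`, given by the distances `g` between vertices, with the
source `s`, the budget `b` and the set `inS` of the vertices that count. The number `k` bounds the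
length of the legs, and `N` bounds all quantities that occur. -/
structure FireData where
  n : ℕ
  s : ℕ
  k : ℕ
  b : ℕ
  N : ℕ
  g : ℕ → ℕ → ℕ
  inS : ℕ → Prop

namespace FireData

variable (I : FireData)

/-- The depth of a vertex: its distance from the source. -/
def d (x : ℕ) : ℕ := I.g I.s x

/-- `x` is an ancestor of `y` in the tree rooted at the source. -/
def anc (x y : ℕ) : Prop := x < I.n ∧ y < I.n ∧ I.d x + I.g x y = I.d y

/-- A vertex is thin if its descendants form a path with at most `k` vertices. -/
def thin (x : ℕ) : Prop :=
  x < I.n ∧ ∀ y < I.n, I.anc x y → I.d y < I.d x + I.k ∧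
    ∀ z < I.n, I.anc x z → I.anc y z ∨ I.anc z y

/-- The topmost vertex of a thin branch. -/
def head (x : ℕ) : Prop := I.thin x ∧ ∀ y < I.n, I.thin y → I.anc y x → y = x

/-- The Hall condition for the deadlines `d x`: the vertices of `P` can be protected in time,
`b` at a time. -/
def hall (P : ℕ → Prop) : Prop :=
  ∀ e < I.N, ((Finset.range I.n).filter fun x => P x ∧ I.d x ≤ e).card ≤ I.b * e

/-- The number of vertices that count and lie below a vertex of `P`. -/
noncomputable def value (P : ℕ → Prop) : ℕ :=
  ((Finset.range I.n).filter fun w => I.inS w ∧ ∃ x < I.n, P x ∧ I.anc x w).card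

/-- The properties of the distances that the algorithm relies on. The last two say that the
ancestors of a vertex form a chain, and that no three vertices that are not thin are pairwise
incomparable. -/
structure IsTreeLike : Prop where
  s_lt : I.s < I.n
  self : ∀ x < I.n, I.g x x = 0
  eq_of_zero : ∀ x < I.n, ∀ y < I.n, I.g x y = 0 → x = y
  triangle : ∀ x < I.n, ∀ y < I.n, ∀ z < I.n, I.g x z ≤ I.g x y + I.g y z
  d_lt : ∀ x < I.n, I.d x < I.n
  chain : ∀ a b x, I.anc a x → I.anc b x → I.anc a b ∨ I.anc b a
  width : ∀ x < I.n, ∀ y < I.n, ∀ z < I.n, ¬ I.thin x → ¬ I.thin y → ¬ I.thin z →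
    (I.anc x y ∨ I.anc y x) ∨ (I.anc x z ∨ I.anc z x) ∨ (I.anc y z ∨ I.anc z y)

variable {I}

theorem anc.d_le {x y : ℕ} (h : I.anc x y) : I.d x ≤ I.d y := by
  have := h.2.2; omega

namespace IsTreeLike

theorem anc_refl (hI : I.IsTreeLike) {x : ℕ} (hx : x < I.n) : I.anc x x :=
  ⟨hx, hx, by rw [hI.self x hx, add_zero]⟩

theorem eq_of_anc (hI : I.IsTreeLike) {x y : ℕ} (h : I.anc x y) (hd : I.d y ≤ I.d x) : x = y :=
  hI.eq_of_zero x h.1 y h.2.1 (by have := h.2.2; omega)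

theorem anc_trans (hI : I.IsTreeLike) {x y z : ℕ} (h : I.anc x y) (h' : I.anc y z) :
    I.anc x z := by
  refine ⟨h.1, h'.2.1, le_antisymm ?_ (hI.triangle I.s hI.s_lt x h.1 z h'.2.1)⟩
  have h1 := hI.triangle x h.1 y h.2.1 z h'.2.1
  have h2 := h.2.2
  have h3 := h'.2.2
  omega

theorem thin_of_anc (hI : I.IsTreeLike) {x y : ℕ} (hx : I.thin x) (h : I.anc x y) : I.thin y := by
  refine ⟨h.2.1, fun z hz hyz => ?_⟩
  have h1 := hx.2 z hz (hI.anc_trans h hyz)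
  have := h.d_le
  exact ⟨by omega, fun w hw hyw => h1.2 w hw (hI.anc_trans h hyw)⟩

theorem head_unique (hI : I.IsTreeLike) {h h' x : ℕ} (hh : I.head h) (hh' : I.head h')
    (hx : I.anc h x) (hx' : I.anc h' x) : h = h' := by
  rcases hI.chain h h' x hx hx' with H | H
  · exact hh'.2 h hx.1 hh.1 H
  · exact (hh.2 h' hx'.1 hh'.1 H).symm

theorem exists_head (hI : I.IsTreeLike) {x : ℕ} (hx : I.thin x) : ∃ h, I.head h ∧ I.anc h x := by
  have hne : ∃ m, ∃ y, I.thin y ∧ I.anc y x ∧ I.d y = m := ⟨_, x, hx, hI.anc_refl hx.1, rfl⟩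
  obtain ⟨y, hy, hyx, hm⟩ := Nat.find_spec hne
  refine ⟨y, ⟨hy, fun z hz hzt hzy => hI.eq_of_anc hzy ?_⟩, hyx⟩
  rw [hm]
  exact Nat.find_min' hne ⟨z, hzt, hI.anc_trans hzy hyx, rfl⟩

/-- Passing to the minimal elements of a set does not change its value. -/
theorem exists_antichain (hI : I.IsTreeLike) (X : ℕ → Prop) :
    ∃ Y : ℕ → Prop, (∀ x, Y x → X x) ∧ (∀ x y, Y x → Y y → I.anc x y → x = y) ∧
      I.value X ≤ I.value Y := by
  refine ⟨fun x => X x ∧ ∀ y, X y → I.anc y x → y = x, fun x h => h.1,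
    fun x y h h' => h'.2 x h.1, ?_⟩
  refine Finset.card_le_card fun w hw => ?_
  simp only [Finset.mem_filter] at hw ⊢
  obtain ⟨hwn, hwS, x, hx, hXx, hxw⟩ := hw
  refine ⟨hwn, hwS, ?_⟩
  have hne : ∃ m, ∃ y, X y ∧ I.anc y x ∧ I.d y = m := ⟨_, x, hXx, hI.anc_refl hx, rfl⟩
  obtain ⟨y, hy, hyx, hm⟩ := Nat.find_spec hne
  refine ⟨y, hyx.1, ⟨hy, fun z hz hzy => hI.eq_of_anc hzy ?_⟩, hI.anc_trans hyx hxw⟩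
  rw [hm]
  exact Nat.find_min' hne ⟨z, hz, hI.anc_trans hzy hyx, rfl⟩

end IsTreeLike

/-! ### Partial solutions and their codes -/

variable (I)

/-- The base of the positional codes. -/
def base : ℕ := I.n + 2

/-- The vertices that may be guessed at the start; the source stands for no vertex. -/
def guessable (u : ℕ) : Prop := u < I.n ∧ (u = I.s ∨ ¬ I.thin u)

/-- The set of protected vertices that a row of the table stands for. The columns `x < n` mark the
thin vertices of the set, column `n` is nonzero in a row that is in use, and the columns
`n + 1` and `n + 2` hold the guessed vertices. -/
def mem (ρ : ℕ → ℕ) (x : ℕ) : Prop :=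
  x < I.n ∧ x ≠ I.s ∧ (ρ x ≠ 0 ∨ x = ρ (I.n + 1) ∨ x = ρ (I.n + 2))

/-- The number of marked vertices of depth at most `e`. -/
noncomputable def count (ρ : ℕ → ℕ) (e : ℕ) : ℕ :=
  ((Finset.range I.n).filter fun x => ρ x ≠ 0 ∧ I.d x ≤ e).card

/-- The number with the digits `f e, f (e + 1), …, f (e + m - 1)`. -/
def digits (f : ℕ → ℕ) : ℕ → ℕ → ℕ
  | _, 0 => 0
  | e, m + 1 => f e + I.base * digits f (e + 1) m

/-- The code of a row after `t` rounds: its value, the guessed vertices, and the numbers of marked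
vertices up to the `k` depths that later rounds can still influence. -/
noncomputable def code (t : ℕ) (ρ : ℕ → ℕ) : ℕ :=
  I.value (I.mem ρ) + I.base * (ρ (I.n + 1) + I.base * (ρ (I.n + 2) +
    I.base * I.digits (I.count ρ) (t / I.n) I.k))

/-- Round `i` deals with the branch whose head `h` satisfies `d h * n + h = i`, if there is one. The
vertex `o` is an option in this round if it belongs to that branch. -/
def option (i o : ℕ) : Prop :=
  o ≠ I.s ∧ I.head (i % I.n) ∧ I.d (i % I.n) = i / I.n ∧ I.anc (i % I.n) o

/-- Mark `o` if it is an option in round `i`. -/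
noncomputable def extend (i : ℕ) (ρ : ℕ → ℕ) (o : ℕ) : ℕ → ℕ :=
  fun c => if I.option i o ∧ c = o then 1 else ρ c

/-- The row with the guessed vertices `u` and `v` and no marks. -/
def initRow (u v : ℕ) : ℕ → ℕ :=
  fun c => if c = I.n then 1 else if c = I.n + 1 then u else if c = I.n + 2 then v else 0

/-- The candidate number `q` for a row of table `t + 1`: for `t = 0` a pair of guessed vertices, and
otherwise an extension of a row of table `t` in round `t - 1`. -/
noncomputable def cand (L : ℕ → ℕ → ℕ) (t q : ℕ) : ℕ → ℕ :=
  fun c => if t = 0 then I.initRow (q / I.base) (q % I.base) c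
    else I.extend (t - 1) (L (q / I.base)) (q % I.base) c

/-- Candidate `q` may be stored in row `κ` of table `t + 1`. -/
def candOK (L : ℕ → ℕ → ℕ) (t κ q : ℕ) : Prop :=
  ((t = 0 ∧ I.guessable (q / I.base) ∧ I.guessable (q % I.base)) ∨
    (t ≠ 0 ∧ L (q / I.base) I.n ≠ 0)) ∧
  I.hall (I.mem (I.cand L t q)) ∧ I.code t (I.cand L t q) = κ

/-- The entry in row `κ` and column `c` of table `t + 1`, where `L` is table `t`. -/
noncomputable def step (L : ℕ → ℕ → ℕ) (t κ c : ℕ) : ℕ :=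
  if ∃ q < I.N, I.candOK L t κ q then I.cand L t (sInf {q | q < I.N ∧ I.candOK L t κ q}) c else 0

/-- Row `κ` of the table `L` is in use and has the largest value. -/
def isBest (L : ℕ → ℕ → ℕ) (κ : ℕ) : Prop :=
  L κ I.n ≠ 0 ∧ ∀ κ' < I.N, L κ' I.n ≠ 0 → I.value (I.mem (L κ')) ≤ I.value (I.mem (L κ))

/-- The row of the table `L` that is returned. -/
noncomputable def best (L : ℕ → ℕ → ℕ) : ℕ := sInf {κ | κ < I.N ∧ I.isBest L κ}

variable {I}

theorem hall.mono {P Q : ℕ → Prop} (h : I.hall Q) (hPQ : ∀ x, P x → Q x) : I.hall P := by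
  intro e he
  refine (Finset.card_le_card fun x hx => ?_).trans (h e he)
  simp only [Finset.mem_filter] at hx ⊢
  exact ⟨hx.1, hPQ x hx.2.1, hx.2.2⟩

theorem mem_congr {ρ ρ' : ℕ → ℕ} (h : ∀ c < I.n + 3, ρ c = ρ' c) : I.mem ρ = I.mem ρ' := by
  funext x
  simp only [mem, h (I.n + 1) (by omega), h (I.n + 2) (by omega), eq_iff_iff]
  refine and_congr_right fun hx => ?_
  rw [h x (by omega)]

theorem count_congr {ρ ρ' : ℕ → ℕ} (h : ∀ c < I.n, ρ c = ρ' c) : I.count ρ = I.count ρ' := by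
  funext e
  refine congrArg _ (Finset.filter_congr fun x hx => ?_)
  rw [h x (Finset.mem_range.1 hx)]

theorem code_congr {ρ ρ' : ℕ → ℕ} (t : ℕ) (h : ∀ c < I.n + 3, ρ c = ρ' c) :
    I.code t ρ = I.code t ρ' := by
  rw [code, code, mem_congr h, h _ (by omega), h _ (by omega),
    count_congr fun c hc => h c (by omega)]

theorem extend_congr {ρ ρ' : ℕ → ℕ} (i o : ℕ) (h : ∀ c < I.n + 3, ρ c = ρ' c) :
    ∀ c < I.n + 3, I.extend i ρ o c = I.extend i ρ' o c := by
  intro c hc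
  simp only [extend, h c hc]

theorem digits_lt {f : ℕ → ℕ} (hf : ∀ e, f e < I.base) (e m : ℕ) :
    I.digits f e m < I.base ^ m := by
  induction m generalizing e with
  | zero => simp [digits]
  | succ m ih =>
    have h1 := hf e
    have h2 : I.base * (I.digits f (e + 1) m + 1) ≤ I.base * I.base ^ m :=
      Nat.mul_le_mul_left _ (ih (e + 1))
    rw [digits, pow_succ']
    rw [mul_add] at h2
    omega

theorem eq_of_add_base_mul {a a' c c' : ℕ} (ha : a < I.base) (ha' : a' < I.base)
    (h : a + I.base * c = a' + I.base * c') : a = a' ∧ c = c' := by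
  have h0 : 0 < I.base := by unfold base; omega
  have h1 := congrArg (· % I.base) h
  simp only [Nat.add_mul_mod_self_left, Nat.mod_eq_of_lt ha, Nat.mod_eq_of_lt ha'] at h1
  subst h1
  exact ⟨rfl, Nat.eq_of_mul_eq_mul_left h0 (by omega)⟩

theorem digits_inj {f f' : ℕ → ℕ} (hf : ∀ e, f e < I.base) (hf' : ∀ e, f' e < I.base) {e m : ℕ}
    (h : I.digits f e m = I.digits f' e m) : ∀ j < m, f (e + j) = f' (e + j) := by
  induction m generalizing e with
  | zero => intro j hj; omega
  | succ m ih =>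
    obtain ⟨h1, h2⟩ := eq_of_add_base_mul (hf e) (hf' e) h
    rintro (_ | j) hj
    · exact h1
    · have := ih h2 j (by omega)
      rwa [add_right_comm, add_assoc] at this

theorem digits_congr {f f' : ℕ → ℕ} {e : ℕ} (h : ∀ i ≥ e, f i = f' i) (m : ℕ) :
    I.digits f e m = I.digits f' e m := by
  induction m generalizing e with
  | zero => rfl
  | succ m ih => rw [digits, digits, h e le_rfl, ih fun i hi => h i (by omega)]

theorem count_lt (ρ : ℕ → ℕ) (e : ℕ) : I.count ρ e < I.base := by
  have h := Finset.card_filter_le (Finset.range I.n) fun x => ρ x ≠ 0 ∧ I.d x ≤ e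
  rw [Finset.card_range] at h
  unfold count base
  omega

theorem value_lt (P : ℕ → Prop) : I.value P < I.base := by
  have h := Finset.card_filter_le (Finset.range I.n)
    fun w => I.inS w ∧ ∃ x < I.n, P x ∧ I.anc x w
  rw [Finset.card_range] at h
  unfold value base
  omega

theorem code_lt {ρ : ℕ → ℕ} (hu : ρ (I.n + 1) < I.n) (hv : ρ (I.n + 2) < I.n) (t : ℕ) :
    I.code t ρ < I.base ^ (I.k + 3) := by
  have key : ∀ a c m, a < I.base → c < I.base ^ m → a + I.base * c < I.base ^ (m + 1) := by
    intro a c m ha hc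
    have h2 : I.base * (c + 1) ≤ I.base * I.base ^ m := Nat.mul_le_mul_left _ hc
    rw [pow_succ']
    rw [mul_add] at h2
    omega
  have hb : I.n < I.base := by unfold base; omega
  exact key _ _ _ (value_lt _) (key _ _ _ (hu.trans hb) (key _ _ _ (hv.trans hb)
    (digits_lt (count_lt ρ) _ _)))

/-- The rows that the tables contain after `t` rounds. -/
structure Good (I : FireData) (t : ℕ) (ρ : ℕ → ℕ) : Prop where
  fst : I.guessable (ρ (I.n + 1))
  snd : I.guessable (ρ (I.n + 2))
  mark : ∀ x < I.n, ρ x ≠ 0 → x ≠ I.s ∧ I.thin x ∧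
    ∃ h, I.head h ∧ I.anc h x ∧ I.d h * I.n + h < t

/-- Two rows that have the same continuations after `t` rounds. -/
structure Equiv (I : FireData) (t : ℕ) (ρ ρ' : ℕ → ℕ) : Prop where
  fst : ρ (I.n + 1) = ρ' (I.n + 1)
  snd : ρ (I.n + 2) = ρ' (I.n + 2)
  count : ∀ e ≥ t / I.n, I.count ρ e = I.count ρ' e
  value : I.value (I.mem ρ) = I.value (I.mem ρ')

theorem Good.mono {t t' : ℕ} {ρ : ℕ → ℕ} (h : I.Good t ρ) (ht : t ≤ t') : I.Good t' ρ :=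
  ⟨h.fst, h.snd, fun x hx hρ => by
    obtain ⟨h1, h2, y, h3, h4, h5⟩ := h.mark x hx hρ
    exact ⟨h1, h2, y, h3, h4, by omega⟩⟩

theorem Equiv.code_eq {t : ℕ} {ρ ρ' : ℕ → ℕ} (h : I.Equiv t ρ ρ') : I.code t ρ = I.code t ρ' := by
  rw [code, code, h.fst, h.snd, h.value, digits_congr h.count]

/-- All marked vertices have depth less than `t / n + k`. -/
theorem Good.count_eq (hI : I.IsTreeLike) (hk : 1 ≤ I.k) {t : ℕ} {ρ : ℕ → ℕ} (h : I.Good t ρ)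
    {e : ℕ} (he : t / I.n + (I.k - 1) ≤ e) :
    I.count ρ e = I.count ρ (t / I.n + (I.k - 1)) := by
  rw [FireData.count, FireData.count]
  refine congrArg _ (Finset.filter_congr fun x hx => and_congr_right fun hρ => ?_)
  obtain ⟨-, -, y, hy, hyx, ht⟩ := h.mark x (Finset.mem_range.1 hx) hρ
  have h1 := (hy.1.2 x (Finset.mem_range.1 hx) hyx).1
  have h2 : I.d y ≤ t / I.n := by
    rw [Nat.le_div_iff_mul_le (by have := hI.s_lt; omega)]; omega
  omega

/-- Rows with the same code have the same continuations, because the code lists the only counts that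
may differ. -/
theorem Good.equiv_of_code_eq (hI : I.IsTreeLike) (hk : 1 ≤ I.k) {t : ℕ} {ρ ρ' : ℕ → ℕ}
    (h : I.Good t ρ) (h' : I.Good t ρ') (hc : I.code t ρ = I.code t ρ') : I.Equiv t ρ ρ' := by
  have hb : I.n < I.base := by unfold base; omega
  obtain ⟨h1, h2⟩ := eq_of_add_base_mul (value_lt _) (value_lt _) hc
  obtain ⟨h3, h4⟩ := eq_of_add_base_mul (h.fst.1.trans hb) (h'.fst.1.trans hb) h2
  obtain ⟨h5, h6⟩ := eq_of_add_base_mul (h.snd.1.trans hb) (h'.snd.1.trans hb) h4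
  have h7 := digits_inj (count_lt ρ) (count_lt ρ') h6
  refine ⟨h3, h5, fun e he => ?_, h1⟩
  by_cases hle : e ≤ t / I.n + (I.k - 1)
  · have := h7 (e - t / I.n) (by omega)
    rwa [Nat.add_sub_cancel' he] at this
  · rw [h.count_eq hI hk (by omega), h'.count_eq hI hk (by omega), h7 _ (by omega)]

theorem option_index {i o : ℕ} (h : I.option i o) :
    I.d (i % I.n) * I.n + i % I.n = i := by
  rw [h.2.2.1]; exact Nat.div_add_mod' i I.n

/-- In the round of a branch, no vertex of this branch has been marked yet. -/
theorem Good.unmarked (hI : I.IsTreeLike) {i o : ℕ} {ρ : ℕ → ℕ} (h : I.Good i ρ)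
    (ho : I.option i o) {x : ℕ} (hx : I.anc (i % I.n) x) : ρ x = 0 := by
  by_contra hρ
  obtain ⟨-, -, y, hy, hyx, hlt⟩ := h.mark x hx.2.1 hρ
  have := hI.head_unique hy ho.2.1 hyx hx
  rw [this, option_index ho] at hlt
  omega

theorem Good.extend (hI : I.IsTreeLike) {i : ℕ} {ρ : ℕ → ℕ} (h : I.Good i ρ) (o : ℕ) :
    I.Good (i + 1) (I.extend i ρ o) := by
  by_cases ho : I.option i o
  · have hon := ho.2.2.2.2.1
    have h1 : I.n + 1 ≠ o := by omega
    have h2 : I.n + 2 ≠ o := by omega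
    refine ⟨by simpa [FireData.extend, h1] using h.fst, by simpa [FireData.extend, h2] using h.snd,
      fun x hx hρ => ?_⟩
    by_cases hxo : x = o
    · subst hxo
      exact ⟨ho.1, hI.thin_of_anc ho.2.1.1 ho.2.2.2, _, ho.2.1, ho.2.2.2, by
        rw [option_index ho]; omega⟩
    · exact (h.mono (Nat.le_succ i)).mark x hx (by simpa [FireData.extend, hxo] using hρ)
  · have : I.extend i ρ o = ρ := by funext c; simp [FireData.extend, ho]
    rw [this]
    exact h.mono (Nat.le_succ i)

/-- The marked and the guessed vertices are different. -/
theorem Good.card_mem {t : ℕ} {ρ : ℕ → ℕ} (h : I.Good t ρ) (e : ℕ) :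
    ((Finset.range I.n).filter fun x => I.mem ρ x ∧ I.d x ≤ e).card = I.count ρ e +
      ((Finset.range I.n).filter fun x =>
        (x ≠ I.s ∧ (x = ρ (I.n + 1) ∨ x = ρ (I.n + 2))) ∧ I.d x ≤ e).card := by
  rw [FireData.count, ← Finset.card_union_of_disjoint]
  · congr 1
    ext x
    simp only [Finset.mem_filter, Finset.mem_union, Finset.mem_range]
    simp only [mem]
    constructor
    · tauto
    · rintro (⟨h1, h2, h3⟩ | h1)
      · exact ⟨h1, ⟨h1, (h.mark x h1 h2).1, .inl h2⟩, h3⟩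
      · tauto
  · rw [Finset.disjoint_left]
    intro x hx hx'
    simp only [Finset.mem_filter, Finset.mem_range] at hx hx'
    obtain ⟨h1, h2, -⟩ := h.mark x hx.1 hx.2.1
    rcases hx'.2.1.2 with rfl | rfl
    · exact h.fst.2.elim h1 fun h3 => h3 h2
    · exact h.snd.2.elim h1 fun h3 => h3 h2

/-- Protecting a vertex of a new thin branch saves those vertices below it that are not below a
guessed vertex. -/
theorem Good.value_extend (hI : I.IsTreeLike) {i o : ℕ} {ρ : ℕ → ℕ} (h : I.Good i ρ)
    (ho : I.option i o) : I.value (I.mem (I.extend i ρ o)) = I.value (I.mem ρ) +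
      ((Finset.range I.n).filter fun w => I.inS w ∧ I.anc o w ∧
        ¬ ∃ x < I.n, (x ≠ I.s ∧ (x = ρ (I.n + 1) ∨ x = ρ (I.n + 2))) ∧ I.anc x w).card := by
  have hon := ho.2.2.2.2.1
  have h1 : I.n + 1 ≠ o := by omega
  have h2 : I.n + 2 ≠ o := by omega
  have hmem : ∀ x, I.mem (I.extend i ρ o) x ↔ I.mem ρ x ∨ x = o := by
    intro x
    simp only [mem, FireData.extend, ho, h1, h2, true_and, if_false]
    by_cases hxo : x = o
    · subst hxo; simp [hon, ho.1]
    · simp [hxo]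
  rw [FireData.value, FireData.value, ← Finset.card_union_of_disjoint]
  · congr 1
    ext w
    simp only [Finset.mem_filter, Finset.mem_union, Finset.mem_range, hmem]
    constructor
    · rintro ⟨hw, hS, x, hx, hx' | rfl, hxw⟩
      · exact .inl ⟨hw, hS, x, hx, hx', hxw⟩
      · by_cases hg : ∃ y < I.n, (y ≠ I.s ∧ (y = ρ (I.n + 1) ∨ y = ρ (I.n + 2))) ∧ I.anc y w
        · obtain ⟨y, hy, hy', hyw⟩ := hg
          exact .inl ⟨hw, hS, y, hy, ⟨hy, hy'.1, .inr hy'.2⟩, hyw⟩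
        · exact .inr ⟨hw, hS, hxw, hg⟩
    · rintro (⟨hw, hS, x, hx, hx', hxw⟩ | ⟨hw, hS, how, -⟩)
      · exact ⟨hw, hS, x, hx, .inl hx', hxw⟩
      · exact ⟨hw, hS, o, hon, .inr rfl, how⟩
  · rw [Finset.disjoint_left]
    intro w hw hw'
    simp only [Finset.mem_filter, Finset.mem_range] at hw hw'
    obtain ⟨hwn, -, x, hx, ⟨-, hxs, hρ⟩, hxw⟩ := hw
    obtain ⟨-, -, how, hno⟩ := hw'
    rcases hρ with hρ | hρ
    · obtain ⟨-, hthin, y, hy, hyx, hlt⟩ := h.mark x hx hρ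
      rcases hI.chain _ _ _ (hI.anc_trans ho.2.2.2 how) hxw with h3 | h3
      · exact hρ (h.unmarked hI ho h3)
      · have := ho.2.1.2 x hx hthin h3
        exact hρ (h.unmarked hI ho (this ▸ hI.anc_refl hx))
    · exact hno ⟨x, hx, ⟨hxs, hρ⟩, hxw⟩

theorem Good.count_extend (hI : I.IsTreeLike) {i o : ℕ} {ρ : ℕ → ℕ} (h : I.Good i ρ)
    (ho : I.option i o) (e : ℕ) :
    I.count (I.extend i ρ o) e = I.count ρ e + if I.d o ≤ e then 1 else 0 := by
  have hon := ho.2.2.2.2.1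
  have h0 := h.unmarked hI ho ho.2.2.2
  split_ifs with hde
  · rw [FireData.count, FireData.count, ← Finset.card_insert_of_notMem (a := o)]
    · congr 1
      ext x
      simp only [Finset.mem_filter, Finset.mem_insert, Finset.mem_range, FireData.extend, ho,
        true_and]
      by_cases hxo : x = o
      · subst hxo; simp [hon, hde]
      · simp [hxo]
    · simp [h0]
  · rw [FireData.count, FireData.count, add_zero]
    congr 1
    ext x
    simp only [Finset.mem_filter, Finset.mem_range, FireData.extend, ho, true_and]
    by_cases hxo : x = o
    · subst hxo; simp [hde]
    · simp [hxo]

/-- The increase of the value depends only on the vertex and on the guessed vertices, and that of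
the counts only on the vertex. -/
theorem Equiv.extend (hI : I.IsTreeLike) {i o : ℕ} {ρ ρ' : ℕ → ℕ} (h : I.Good i ρ)
    (h' : I.Good i ρ') (he : I.Equiv i ρ ρ') :
    I.Equiv (i + 1) (I.extend i ρ o) (I.extend i ρ' o) := by
  have hdiv : i / I.n ≤ (i + 1) / I.n := Nat.div_le_div_right (Nat.le_succ i)
  by_cases ho : I.option i o
  · have hon := ho.2.2.2.2.1
    have h1 : I.n + 1 ≠ o := by omega
    have h2 : I.n + 2 ≠ o := by omega
    refine ⟨by simpa [FireData.extend, h1] using he.fst,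
      by simpa [FireData.extend, h2] using he.snd, fun e hie => ?_, ?_⟩
    · rw [h.count_extend hI ho, h'.count_extend hI ho, he.count e (hdiv.trans hie)]
    · rw [h.value_extend hI ho, h'.value_extend hI ho, he.value, he.fst, he.snd]
  · have : ∀ ρ, I.extend i ρ o = ρ := by intro ρ; funext c; simp [FireData.extend, ho]
    rw [this, this]
    exact ⟨he.fst, he.snd, fun e hie => he.count e (hdiv.trans hie), he.value⟩

/-- If a row satisfies the Hall condition and an equivalent row can be extended, then so can the
row: below depth `i / n` nothing changes, and from there on the counts agree. -/
theorem Equiv.hall_extend (hI : I.IsTreeLike) {i o : ℕ} {ρ ρ' : ℕ → ℕ} (h : I.Good i ρ)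
    (h' : I.Good i ρ') (he : I.Equiv i ρ ρ') (hρ : I.hall (I.mem ρ))
    (hρ' : I.hall (I.mem (I.extend i ρ' o))) : I.hall (I.mem (I.extend i ρ o)) := by
  by_cases ho : I.option i o
  · intro e heN
    have hE := he.extend hI (o := o) h h'
    by_cases hie : i / I.n ≤ e
    · have := hρ' e heN
      rw [(h'.extend hI o).card_mem] at this
      rw [(h.extend hI o).card_mem, hE.fst, hE.snd, h.count_extend hI ho, he.count e hie,
        ← h'.count_extend hI ho]
      exact this
    · have hon := ho.2.2.2.2.1
      have h1 : I.n + 1 ≠ o := by omega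
      have h2 : I.n + 2 ≠ o := by omega
      -- a vertex of the new branch has depth at least `i / n`
      have hd := ho.2.2.2.d_le
      rw [ho.2.2.1] at hd
      have := hρ e heN
      rw [h.card_mem] at this
      rw [(h.extend hI o).card_mem, h.count_extend hI ho, if_neg (by omega)]
      simpa [FireData.extend, h1, h2] using this
  · have : I.extend i ρ o = ρ := by funext c; simp [FireData.extend, ho]
    rwa [this]

/-! ### Correctness of the dynamic program -/

theorem base_pow_le {I : FireData} (hN : I.base ^ (I.k + 4) ≤ I.N) {m : ℕ} (hm : m ≤ I.k + 4) :
    I.base ^ m ≤ I.N :=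
  (Nat.pow_le_pow_right (by unfold base; omega) hm).trans hN

/-- The row that describes the part of the solution `Y` that is decided in the first `t` rounds. -/
noncomputable def target (I : FireData) (Y : ℕ → Prop) (u v t : ℕ) : ℕ → ℕ :=
  fun c => if c = I.n then 1 else if c = I.n + 1 then u else if c = I.n + 2 then v else
    if Y c ∧ I.thin c ∧ ∃ h, I.head h ∧ I.anc h c ∧ I.d h * I.n + h < t then 1 else 0

/-- Every row of a table that is in use is a good row that satisfies the Hall condition and has the
right code. -/
theorem good_of_used (hI : I.IsTreeLike) (hN : I.base ^ (I.k + 4) ≤ I.N)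
    {L : ℕ → ℕ → ℕ → ℕ}
    (hL : ∀ t < I.N, ∀ κ < I.N, ∀ c < I.N, L (t + 1) κ c = I.step (L t) t κ c) (t : ℕ)
    (ht : t < I.N) (κ : ℕ) (hκ : κ < I.N) (hused : L (t + 1) κ I.n ≠ 0) :
    ∃ ρ, (∀ c < I.n + 3, L (t + 1) κ c = ρ c) ∧ I.Good t ρ ∧ I.hall (I.mem ρ) ∧
      I.code t ρ = κ := by
  have hb : 0 < I.base := by unfold base; omega
  have hn3 : I.n + 3 ≤ I.N := by
    have h1 : I.base ^ 2 ≤ I.N := base_pow_le hN (by omega)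
    unfold base at h1
    nlinarith
  induction t generalizing κ with
  | zero =>
    rw [hL 0 ht κ hκ _ (by omega), step] at hused
    split_ifs at hused with hex
    · obtain ⟨hq, hOK⟩ := Nat.sInf_mem (s := {q | q < I.N ∧ I.candOK (L 0) 0 κ q}) hex
      refine ⟨_, fun c hc => by rw [hL 0 ht κ hκ c (by omega), step, if_pos hex], ?_, hOK.2.1,
        hOK.2.2⟩
      rcases hOK.1 with ⟨-, h1, h2⟩ | h
      · refine ⟨by simpa [cand, initRow] using h1, by simpa [cand, initRow] using h2,
          fun x hx h => ?_⟩
        simp [cand, initRow, show x ≠ I.n by omega, show x ≠ I.n + 1 by omega,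
          show x ≠ I.n + 2 by omega] at h
      · exact absurd rfl h.1
    · exact absurd rfl hused
  | succ t ih =>
    rw [hL _ ht κ hκ _ (by omega), step] at hused
    split_ifs at hused with hex
    · obtain ⟨hq, hOK⟩ := Nat.sInf_mem (s := {q | q < I.N ∧ I.candOK (L (t + 1)) (t + 1) κ q}) hex
      set q := sInf {q | q < I.N ∧ I.candOK (L (t + 1)) (t + 1) κ q}
      rcases hOK.1 with h | ⟨-, h1⟩
      · exact absurd h.1 (Nat.succ_ne_zero t)
      have hq' : q / I.base < I.N := (Nat.div_le_self _ _).trans_lt hq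
      obtain ⟨ρ, h2, h3, -, -⟩ := ih (by omega) _ hq' h1
      have h4 : ∀ c < I.n + 3, I.cand (L (t + 1)) (t + 1) q c = I.extend t ρ (q % I.base) c := by
        intro c hc
        rw [cand, if_neg (Nat.succ_ne_zero t)]
        exact extend_congr _ _ h2 c hc
      refine ⟨I.extend t ρ (q % I.base), fun c hc => ?_, h3.extend hI _, ?_, ?_⟩
      · rw [hL _ ht κ hκ c (by omega), step, if_pos hex]
        exact h4 c hc
      · rw [← mem_congr h4]; exact hOK.2.1
      · rw [← code_congr _ h4]; exact hOK.2.2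
    · exact absurd rfl hused

section Target

variable {Y : ℕ → Prop} {u v : ℕ}

theorem good_target (hY : ∀ x, Y x → x ≠ I.s) (hu : I.guessable u) (hv : I.guessable v) (t : ℕ) :
    I.Good t (I.target Y u v t) := by
  refine ⟨by simpa [target] using hu, by simpa [target] using hv, fun x hx hρ => ?_⟩
  simp only [target, show x ≠ I.n by omega, show x ≠ I.n + 1 by omega,
    show x ≠ I.n + 2 by omega, if_false, ne_eq, ite_eq_right_iff, one_ne_zero, imp_false,
    not_not] at hρ
  exact ⟨hY x hρ.1, hρ.2⟩

theorem mem_target {t x : ℕ} : I.mem (I.target Y u v t) x ↔ x < I.n ∧ x ≠ I.s ∧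
    ((Y x ∧ I.thin x ∧ ∃ h, I.head h ∧ I.anc h x ∧ I.d h * I.n + h < t) ∨ x = u ∨ x = v) := by
  simp only [mem]
  refine and_congr_right fun hx => and_congr_right fun _ => ?_
  simp [target, show x ≠ I.n by omega, show x ≠ I.n + 1 by omega, show x ≠ I.n + 2 by omega]

theorem target_zero : I.target Y u v 0 = I.initRow u v := by
  funext c
  simp [target, initRow]

/-- Each round adds to the target row at most one vertex, because an antichain contains at most one
vertex of a thin branch. -/
theorem exists_extend_target (hI : I.IsTreeLike) (hY : ∀ x, Y x → x < I.n ∧ x ≠ I.s)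
    (hanti : ∀ x y, Y x → Y y → I.anc x y → x = y) (t : ℕ) :
    ∃ o < I.base, I.target Y u v (t + 1) = I.extend t (I.target Y u v t) o := by
  have hn := hI.s_lt
  by_cases H : ∃ o, Y o ∧ I.option t o
  · obtain ⟨o, hYo, ho⟩ := H
    have hon := ho.2.2.2.2.1
    refine ⟨o, by unfold base; omega, ?_⟩
    funext c
    simp only [target, extend, ho, true_and]
    by_cases hco : c = o
    · subst hco
      have hidx := option_index ho
      simp only [show c ≠ I.n by omega, show c ≠ I.n + 1 by omega, show c ≠ I.n + 2 by omega,
        if_false, if_true]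
      rw [if_pos ⟨hYo, hI.thin_of_anc ho.2.1.1 ho.2.2.2, _, ho.2.1, ho.2.2.2, by omega⟩]
    · simp only [hco, if_false]
      have : (Y c ∧ I.thin c ∧ ∃ h, I.head h ∧ I.anc h c ∧ I.d h * I.n + h < t + 1) ↔
          (Y c ∧ I.thin c ∧ ∃ h, I.head h ∧ I.anc h c ∧ I.d h * I.n + h < t) := by
        refine and_congr_right fun hYc => and_congr_right fun _ => exists_congr fun h =>
          and_congr_right fun hh => and_congr_right fun hhc => ⟨fun hlt => ?_, by omega⟩
        by_contra hge
        have hidx := option_index ho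
        -- otherwise `c` lies on the same branch as `o`
        have hht : I.d h * I.n + h = t := by omega
        have hhn := hhc.1
        have hmod : t % I.n = h := by
          rw [← hht, Nat.mul_add_mod_of_lt hhn]
        rw [← hmod] at hhc
        rcases (ho.2.1.1.2 o hon ho.2.2.2).2 c hhc.2.1 hhc with h1 | h1
        · exact hco (hanti _ _ hYo hYc h1).symm
        · exact hco (hanti _ _ hYc hYo h1)
      simp only [this]
  · refine ⟨I.n, by unfold base; omega, ?_⟩
    have hno : ¬ I.option t I.n := fun h => lt_irrefl _ h.2.2.2.2.1
    funext c
    simp only [target, extend, hno, false_and, if_false]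
    have : (Y c ∧ I.thin c ∧ ∃ h, I.head h ∧ I.anc h c ∧ I.d h * I.n + h < t + 1) ↔
        (Y c ∧ I.thin c ∧ ∃ h, I.head h ∧ I.anc h c ∧ I.d h * I.n + h < t) := by
      refine and_congr_right fun hYc => and_congr_right fun _ => exists_congr fun h =>
        and_congr_right fun hh => and_congr_right fun hhc => ⟨fun hlt => ?_, by omega⟩
      by_contra hge
      have hht : I.d h * I.n + h = t := by omega
      have hmod : t % I.n = h := by rw [← hht, Nat.mul_add_mod_of_lt hhc.1]
      have hdiv : t / I.n = I.d h := by
        rw [← hht, mul_comm, Nat.mul_add_div (by omega), Nat.div_eq_of_lt hhc.1, add_zero]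
      exact H ⟨c, hYc, (hY c hYc).2, by rwa [hmod], by rw [hmod, hdiv], by rwa [hmod]⟩
    simp only [this]

/-- In each table, the row whose number is the code of the target row is in use. -/
theorem used_of_target (hI : I.IsTreeLike) (hk : 1 ≤ I.k) (hN : I.base ^ (I.k + 4) ≤ I.N)
    {L : ℕ → ℕ → ℕ → ℕ}
    (hL : ∀ t < I.N, ∀ κ < I.N, ∀ c < I.N, L (t + 1) κ c = I.step (L t) t κ c)
    (hY : ∀ x, Y x → x < I.n ∧ x ≠ I.s) (hanti : ∀ x y, Y x → Y y → I.anc x y → x = y)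
    (hu : I.guessable u) (hv : I.guessable v)
    (hall : ∀ t, I.hall (I.mem (I.target Y u v t))) (t : ℕ) (ht : t < I.N) :
    I.code t (I.target Y u v t) < I.N ∧
      L (t + 1) (I.code t (I.target Y u v t)) I.n ≠ 0 := by
  have hb : 0 < I.base := by unfold base; omega
  have hgood := good_target (I := I) (fun x hx => (hY x hx).2) hu hv
  have hcode : ∀ t, I.code t (I.target Y u v t) < I.base ^ (I.k + 3) := fun t =>
    code_lt (hgood t).fst.1 (hgood t).snd.1 t
  have hcodeN : ∀ t, I.code t (I.target Y u v t) < I.N := fun t =>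
    (hcode t).trans_le (base_pow_le hN (by omega))
  have hnN : I.n < I.N := by
    have h1 : I.base ^ 1 ≤ I.N := base_pow_le hN (by omega)
    rw [pow_one] at h1
    unfold base at h1
    omega
  have hdm : ∀ a o, o < I.base → (a * I.base + o) / I.base = a ∧ (a * I.base + o) % I.base = o := by
    intro a o ho
    exact ⟨by rw [mul_comm, Nat.mul_add_div hb, Nat.div_eq_of_lt ho, add_zero],
      Nat.mul_add_mod_of_lt ho⟩
  refine ⟨hcodeN t, ?_⟩
  induction t with
  | zero =>
    have hub : v < I.base := by have := hv.1; unfold base; omega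
    obtain ⟨h1, h2⟩ := hdm u v hub
    have hcand : I.cand (L 0) 0 (u * I.base + v) = I.target Y u v 0 := by
      rw [target_zero]
      funext c
      simp only [cand, h1, h2, if_true]
    have hex : ∃ q < I.N, I.candOK (L 0) 0 (I.code 0 (I.target Y u v 0)) q := by
      refine ⟨u * I.base + v, ?_, .inl ⟨rfl, by rwa [h1], by rwa [h2]⟩, ?_, ?_⟩
      · have h3 : I.base ^ 2 ≤ I.N := base_pow_le hN (by omega)
        have h4 : u + 1 ≤ I.base := by have := hu.1; unfold base; omega
        nlinarith
      · rw [hcand]; exact hall 0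
      · rw [hcand]
    rw [hL 0 ht _ (hcodeN 0) _ hnN, step, if_pos hex]
    simp [cand, initRow]
  | succ t ih =>
    have hused := ih (by omega)
    obtain ⟨ρ, h1, h2, h3, h4⟩ := good_of_used hI hN hL t (by omega) _ (hcodeN t) hused
    obtain ⟨o, hob, ho⟩ := exists_extend_target (u := u) (v := v) hI hY hanti t
    have hE := h2.equiv_of_code_eq hI hk (hgood t) h4
    have hE' := hE.extend hI (o := o) h2 (hgood t)
    obtain ⟨hd, hm⟩ := hdm (I.code t (I.target Y u v t)) o hob
    set q := I.code t (I.target Y u v t) * I.base + o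
    have hcand : ∀ c < I.n + 3, I.cand (L (t + 1)) (t + 1) q c = I.extend t ρ o c := by
      intro c hc
      rw [cand, if_neg (Nat.succ_ne_zero t), hd, hm]
      exact extend_congr _ _ h1 c hc
    have hex : ∃ q < I.N, I.candOK (L (t + 1)) (t + 1)
        (I.code (t + 1) (I.target Y u v (t + 1))) q := by
      refine ⟨q, ?_, .inr ⟨Nat.succ_ne_zero t, by rwa [hd]⟩, ?_, ?_⟩
      · have h5 : (I.code t (I.target Y u v t) + 1) * I.base ≤ I.base ^ (I.k + 3) * I.base :=
          Nat.mul_le_mul_right _ (hcode t)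
        rw [← pow_succ, Nat.succ_mul] at h5
        have h6 : q < I.base ^ (I.k + 3 + 1) := by
          change I.code t (I.target Y u v t) * I.base + o < _
          omega
        exact h6.trans_le hN
      · rw [mem_congr hcand]
        exact hE.hall_extend hI h2 (hgood t) h3 (by rw [← ho]; exact hall (t + 1))
      · rw [code_congr _ hcand, hE'.code_eq, ho]
    rw [hL _ ht _ (hcodeN _) _ hnN, step, if_pos hex]
    -- the flag of a candidate is the flag of the row that it extends
    obtain ⟨hq, hOK⟩ := Nat.sInf_mem (s := {q | q < I.N ∧ I.candOK (L (t + 1)) (t + 1)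
      (I.code (t + 1) (I.target Y u v (t + 1))) q}) hex
    rcases hOK.1 with h | ⟨-, h⟩
    · exact absurd h.1 (Nat.succ_ne_zero t)
    · rw [cand, if_neg (Nat.succ_ne_zero t), extend]
      split_ifs
      · exact one_ne_zero
      · exact h

end Target

/-- An antichain contains at most two vertices that are not thin. -/
theorem exists_guess (hI : I.IsTreeLike) {Y : ℕ → Prop} (hY : ∀ x, Y x → x < I.n)
    (hanti : ∀ x y, Y x → Y y → I.anc x y → x = y) :
    ∃ u v, I.guessable u ∧ I.guessable v ∧ (∀ x, Y x → ¬ I.thin x → x = u ∨ x = v) ∧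
      (u = I.s ∨ Y u) ∧ (v = I.s ∨ Y v) := by
  have hs : I.guessable I.s := ⟨hI.s_lt, .inl rfl⟩
  by_cases h1 : ∃ a, Y a ∧ ¬ I.thin a
  · obtain ⟨a, ha, hat⟩ := h1
    by_cases h2 : ∃ b, Y b ∧ ¬ I.thin b ∧ b ≠ a
    · obtain ⟨b, hb, hbt, hab⟩ := h2
      refine ⟨a, b, ⟨hY a ha, .inr hat⟩, ⟨hY b hb, .inr hbt⟩, fun x hx hxt => ?_, .inr ha, .inr hb⟩
      rcases hI.width a (hY a ha) b (hY b hb) x (hY x hx) hat hbt hxt with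
        (h | h) | (h | h) | (h | h)
      · exact absurd (hanti _ _ ha hb h).symm hab
      · exact absurd (hanti _ _ hb ha h) hab
      · exact .inl (hanti _ _ ha hx h).symm
      · exact .inl (hanti _ _ hx ha h)
      · exact .inr (hanti _ _ hb hx h).symm
      · exact .inr (hanti _ _ hx hb h)
    · push Not at h2
      exact ⟨a, I.s, ⟨hY a ha, .inr hat⟩, hs, fun x hx hxt => .inl (h2 x hx hxt), .inr ha, .inl rfl⟩
  · push Not at h1
    exact ⟨I.s, I.s, hs, hs, fun x hx hxt => absurd (h1 x hx) hxt, .inl rfl, .inl rfl⟩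

/-- The set in the best row of the last table satisfies the Hall condition, and its value is the
largest possible. -/
theorem best_spec (hI : I.IsTreeLike) (hk : 1 ≤ I.k) (hN : I.base ^ (I.k + 4) ≤ I.N)
    {L : ℕ → ℕ → ℕ → ℕ}
    (hL : ∀ t < I.N, ∀ κ < I.N, ∀ c < I.N, L (t + 1) κ c = I.step (L t) t κ c) :
    I.hall (I.mem (L I.N (I.best (L I.N)))) ∧
    ∀ X : ℕ → Prop, (∀ x, X x → x < I.n ∧ x ≠ I.s) → I.hall X →
      I.value X ≤ I.value (I.mem (L I.N (I.best (L I.N)))) := by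
  have hn := hI.s_lt
  have hnN : I.n * I.n + 1 ≤ I.N := by
    have h3 : I.base ^ 2 ≤ I.N := base_pow_le hN (by omega)
    unfold base at h3
    nlinarith
  obtain ⟨T, hT⟩ : ∃ T, I.N = T + 1 := ⟨I.N - 1, by omega⟩
  have main : ∀ X : ℕ → Prop, (∀ x, X x → x < I.n ∧ x ≠ I.s) → I.hall X →
      ∃ κ < I.N, L I.N κ I.n ≠ 0 ∧ I.value X ≤ I.value (I.mem (L I.N κ)) := by
    intro X hX hXh
    obtain ⟨Y, hYX, hanti, hval⟩ := hI.exists_antichain X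
    obtain ⟨u, v, hu, hv, hnt, hYu, hYv⟩ := exists_guess hI (fun x hx => (hX x (hYX x hx)).1) hanti
    have hY : ∀ x, Y x → x < I.n ∧ x ≠ I.s := fun x hx => hX x (hYX x hx)
    have hall : ∀ t, I.hall (I.mem (I.target Y u v t)) := by
      intro t
      refine hXh.mono fun x hx => hYX x ?_
      obtain ⟨-, hxs, h | rfl | rfl⟩ := mem_target.1 hx
      · exact h.1
      · exact hYu.resolve_left hxs
      · exact hYv.resolve_left hxs
    obtain ⟨h1, h2⟩ := used_of_target hI hk hN hL hY hanti hu hv hall T (by omega)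
    obtain ⟨ρ, h3, h4, -, h5⟩ := good_of_used hI hN hL T (by omega) _ h1 h2
    have hE := h4.equiv_of_code_eq hI hk
      (good_target (I := I) (fun x hx => (hY x hx).2) hu hv T) h5
    refine ⟨_, h1, by rw [hT]; exact h2, hval.trans (le_of_eq ?_)⟩
    rw [hT, mem_congr h3, hE.value]
    congr 1
    funext x
    refine propext ⟨fun hx => mem_target.2 ⟨(hY x hx).1, (hY x hx).2, ?_⟩, fun hx => ?_⟩
    · by_cases hxt : I.thin x
      · obtain ⟨h, hh, hhx⟩ := hI.exists_head hxt
        refine .inl ⟨hx, hxt, h, hh, hhx, ?_⟩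
        -- all rounds are over
        have h6 := hI.d_lt h hhx.1
        have h7 := hhx.1
        nlinarith
      · exact .inr (hnt x hx hxt)
    · obtain ⟨-, hxs, h | rfl | rfl⟩ := mem_target.1 hx
      · exact h.1
      · exact hYu.resolve_left hxs
      · exact hYv.resolve_left hxs
  have hex : ∃ κ, κ < I.N ∧ I.isBest (L I.N) κ := by
    obtain ⟨κ₀, h1, h2, -⟩ := main (fun _ => False) (fun _ h => h.elim) (by
      intro e he
      simp)
    obtain ⟨κ, hκ, hmax⟩ := Finset.exists_max_image
      ((Finset.range I.N).filter fun κ => L I.N κ I.n ≠ 0) (fun κ => I.value (I.mem (L I.N κ)))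
      ⟨κ₀, by simp [h1, h2]⟩
    simp only [Finset.mem_filter, Finset.mem_range] at hκ hmax
    exact ⟨κ, hκ.1, hκ.2, fun κ' h3 h4 => hmax κ' ⟨h3, h4⟩⟩
  obtain ⟨h1, h2, h3⟩ := Nat.sInf_mem (s := {κ | κ < I.N ∧ I.isBest (L I.N) κ}) hex
  refine ⟨?_, fun X hX hXh => ?_⟩
  · have h2' := h2
    rw [hT] at h2'
    obtain ⟨ρ, h4, -, h5, -⟩ := good_of_used hI hN hL T (by omega) _ h1 (by rw [← hT]; exact h2)
    rw [show L I.N = L (T + 1) by rw [hT]]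
    unfold best
    rw [show L I.N = L (T + 1) by rw [hT]] at *
    rw [mem_congr h4]
    exact h5
  · obtain ⟨κ, h4, h5, h6⟩ := main X hX hXh
    exact h6.trans (h3 κ h4 h5)

end FireData

end DynamicProgram

/-! ### Fire in a rooted tree -/

section Fire

variable {V : Type*}

/-- The vertex `x` lies on a shortest path from `s` to `v`; in a tree rooted at `s`, it is an
ancestor of `v`. -/
def OnGeodesic (G : SimpleGraph V) (s x v : V) : Prop := G.dist s x + G.dist x v = G.dist s v

/-- Every vertex has at most one neighbour that is not farther from `s`, as in a tree. -/
def UniqueParent (G : SimpleGraph V) (s : V) : Prop :=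
  ∀ w u u', G.Adj w u → G.Adj w u' → G.dist s u ≤ G.dist s w → G.dist s u' ≤ G.dist s w → u = u'

variable {G : SimpleGraph V} {s : V}

/-- A vertex `v ≠ x` has a neighbour that is one step closer to `x`. -/
theorem exists_adj_dist_add_one (hG : G.Connected) {x v : V} (h : x ≠ v) :
    ∃ u, G.Adj v u ∧ G.dist x u + 1 = G.dist x v := by
  obtain ⟨p, hp⟩ := hG.exists_walk_length_eq_dist v x
  cases p with
  | nil => exact absurd rfl h
  | cons hadj q =>
    rename_i u
    refine ⟨u, hadj, ?_⟩
    rw [SimpleGraph.Walk.length_cons, SimpleGraph.dist_comm] at hp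
    have h1 := SimpleGraph.dist_le q
    rw [SimpleGraph.dist_comm] at h1
    have h2 := hG.dist_triangle (u := x) (v := u) (w := v)
    rw [SimpleGraph.dist_eq_one_iff_adj.2 hadj.symm] at h2
    omega

theorem OnGeodesic.trans (hG : G.Connected) {x y z : V} (h : OnGeodesic G s x y)
    (h' : OnGeodesic G s y z) : OnGeodesic G s x z := by
  unfold OnGeodesic at *
  have h1 := hG.dist_triangle (u := x) (v := y) (w := z)
  have h2 := hG.dist_triangle (u := s) (v := x) (w := z)
  omega

theorem onGeodesic_self (v : V) : OnGeodesic G s v v := by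
  simp [OnGeodesic]

/-- A proper ancestor of `v` is an ancestor of the parent of `v`. -/
theorem UniqueParent.onGeodesic_parent (hG : G.Connected) (hs : UniqueParent G s) {x v u : V}
    (h : OnGeodesic G s x v) (hxv : x ≠ v) (hadj : G.Adj v u) (hu : G.dist s u ≤ G.dist s v) :
    OnGeodesic G s x u := by
  obtain ⟨w, hw, hwd⟩ := exists_adj_dist_add_one hG hxv
  have h1 := hG.dist_triangle (u := s) (v := x) (w := w)
  have h2 := hG.dist_triangle (u := s) (v := w) (w := v)
  rw [SimpleGraph.dist_eq_one_iff_adj.2 hw.symm] at h2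
  unfold OnGeodesic at *
  obtain rfl := hs v u w hadj hw hu (by omega)
  omega

/-- The ancestors of a vertex form a chain. -/
theorem UniqueParent.onGeodesic_total (hG : G.Connected) (hs : UniqueParent G s) {a b v : V}
    (ha : OnGeodesic G s a v) (hb : OnGeodesic G s b v) :
    OnGeodesic G s a b ∨ OnGeodesic G s b a := by
  induction hm : G.dist s v generalizing v with
  | zero =>
    unfold OnGeodesic at *
    have h1 := hG.dist_triangle (u := a) (v := v) (w := b)
    rw [SimpleGraph.dist_comm (u := v)] at h1
    left; omega
  | succ m ih =>
    by_cases h1 : a = v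
    · subst h1; exact .inr hb
    by_cases h2 : b = v
    · subst h2; exact .inl ha
    obtain ⟨u, hu, hd⟩ := exists_adj_dist_add_one hG (x := s) (v := v) (by
      rintro rfl; simp at hm)
    exact ih (hs.onGeodesic_parent hG ha h1 hu (by omega))
      (hs.onGeodesic_parent hG hb h2 hu (by omega)) (by omega)

/-- An edge that enters the set of the descendants of `x` ends in `x`. -/
theorem UniqueParent.eq_of_adj (hG : G.Connected) (hs : UniqueParent G s) {x u w : V}
    (hw : OnGeodesic G s x w) (hu : ¬ OnGeodesic G s x u) (hadj : G.Adj u w) : x = w := by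
  by_contra hne
  refine hu ?_
  by_cases hd : G.dist s u ≤ G.dist s w
  · exact hs.onGeodesic_parent hG hw hne hadj.symm hd
  · have h1 := hG.dist_triangle (u := s) (v := x) (w := u)
    have h2 := hG.dist_triangle (u := x) (v := w) (w := u)
    have h3 := hG.dist_triangle (u := s) (v := w) (w := u)
    rw [SimpleGraph.dist_eq_one_iff_adj.2 hadj.symm] at h2 h3
    unfold OnGeodesic at *
    omega

/-- A walk that enters the set of the descendants of `x` passes through `x`. -/
theorem UniqueParent.mem_support (hG : G.Connected) (hs : UniqueParent G s) {x u v : V}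
    (p : G.Walk u v) (hu : ¬ OnGeodesic G s x u) (hv : OnGeodesic G s x v) : x ∈ p.support := by
  induction p with
  | nil => exact absurd hv hu
  | cons hadj q ih =>
    rename_i w _
    rw [SimpleGraph.Walk.support_cons]
    by_cases hw : OnGeodesic G s x w
    · rw [hs.eq_of_adj hG hw hu hadj]
      exact List.mem_cons_of_mem _ q.start_mem_support
    · exact List.mem_cons_of_mem _ (ih hw hv)

theorem burnedAt_mono (Φ : Finset (V × ℕ)) {t t' : ℕ} (h : t ≤ t') :
    burnedAt G s Φ t ⊆ burnedAt G s Φ t' := by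
  induction h with
  | refl => exact subset_rfl
  | step _ ih => exact ih.trans Set.subset_union_left

/-- The fire needs at least `d + 1` time steps to reach a vertex at distance `d > 0`. -/
theorem dist_lt_of_burned (hG : G.Connected) (Φ : Finset (V × ℕ)) {t : ℕ} {v : V}
    (h : v ∈ burnedAt G s Φ t) : G.dist s v < t ∨ v = s := by
  induction t generalizing v with
  | zero => exact .inr h
  | succ t ih =>
    rcases h with h | ⟨ht, -, u, hu, hadj⟩
    · rcases ih h with h | h
      · left; omega
      · exact .inr h
    · left
      have h1 := hG.dist_triangle (u := s) (v := u) (w := v)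
      rw [SimpleGraph.dist_eq_one_iff_adj.2 hadj] at h1
      rcases ih hu with h | rfl
      · omega
      · rw [SimpleGraph.dist_self] at h1; omega

/-- The fire advances along geodesics that have no vertex protected in time. -/
theorem burned_of_unprotected (hG : G.Connected) (Φ : Finset (V × ℕ)) {v : V}
    (h : ∀ x t, (x, t) ∈ Φ → OnGeodesic G s x v → G.dist s x < t) :
    v ∈ burnedAt G s Φ (G.dist s v + 1) := by
  induction hm : G.dist s v generalizing v with
  | zero =>
    obtain rfl := hG.dist_eq_zero_iff.1 hm
    exact .inl rfl
  | succ m ih =>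
    obtain ⟨u, hadj, hd⟩ := exists_adj_dist_add_one hG (x := s) (v := v) (by
      rintro rfl; simp at hm)
    have huv : OnGeodesic G s u v := by
      rw [OnGeodesic, SimpleGraph.dist_eq_one_iff_adj.2 hadj.symm, hd]
    refine .inr ⟨Nat.succ_pos m, ?_, u,
      ih (fun x t hx hxu => h x t hx (hxu.trans hG huv)) (by omega), hadj.symm⟩
    rintro ⟨t, ht, hvt⟩
    have := h v t hvt (onGeodesic_self v)
    omega

/-- A vertex that a valid strategy saves has an ancestor that is protected no later than its
distance from the source. -/
theorem exists_protected_of_saved [Fintype V] (hG : G.Connected) {b : ℕ} {Φ : Finset (V × ℕ)}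
    (hΦ : ValidStrategy G s b Φ) {v : V} (hv : Saved G s Φ v) :
    ∃ x t, (x, t) ∈ Φ ∧ t ≤ G.dist s x ∧ OnGeodesic G s x v := by
  by_contra! hno
  have hno' : ∀ x t, (x, t) ∈ Φ → OnGeodesic G s x v → G.dist s x < t := fun x t hx hxv =>
    not_le.1 fun hle => hno x t hx hle hxv
  have hlate : ∀ x t, (x, t) ∈ Φ → ¬ OnGeodesic G s x v := fun x t hx hxv => by
    refine hΦ.2.1 x t hx (burnedAt_mono Φ (hno' x t hx hxv)
      (burned_of_unprotected hG Φ fun y t hy hyx => ?_))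
    exact hno' y t hy (hyx.trans hG hxv)
  obtain ⟨t, ⟨t', -, hv⟩ | h⟩ := hv
  · exact hlate v t' hv (onGeodesic_self v)
  · obtain ⟨p, hp, hlen⟩ := hG.exists_path_of_dist s v
    obtain ⟨w, hw, t', -, hwt⟩ := h s (burnedAt_mono Φ (Nat.zero_le t) rfl) ⟨p, hp⟩
    refine hlate w t' hwt (le_antisymm ?_ hG.dist_triangle)
    classical
    have h1 := SimpleGraph.dist_le (p.takeUntil w hw)
    have h2 := SimpleGraph.dist_le (p.dropUntil w hw)
    have h3 := congrArg SimpleGraph.Walk.length (p.take_spec hw)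
    rw [SimpleGraph.Walk.length_append] at h3
    omega

/-- Protecting each vertex `x` of `X` at a time `τ x ≤ dist s x` saves all descendants of `X`. -/
theorem saved_of_onGeodesic (hG : G.Connected) (hs : UniqueParent G s) {Φ : Finset (V × ℕ)}
    (hΦ : ∀ x t, (x, t) ∈ Φ → x ≠ s ∧ t ≤ G.dist s x) {x v : V} {t : ℕ} (hx : (x, t) ∈ Φ)
    (hxv : OnGeodesic G s x v) : Saved G s Φ v := by
  have hclear : ∀ i, ∀ u ∈ burnedAt G s Φ i, ¬ OnGeodesic G s x u := by
    intro i
    induction i with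
    | zero =>
      rintro u rfl hu
      rw [OnGeodesic, SimpleGraph.dist_self] at hu
      exact (hΦ x t hx).1 (hG.dist_eq_zero_iff.1 (show G.dist x u = 0 by omega))
    | succ i ih =>
      rintro w (hw | ⟨hi, hwp, u, hu, hadj⟩) hxw
      · exact ih w hw hxw
      · obtain rfl := hs.eq_of_adj hG hxw (ih u hu) hadj
        refine hwp ⟨t, ?_, hx⟩
        have hb : x ∈ burnedAt G s Φ (i + 1) := .inr ⟨hi, hwp, u, hu, hadj⟩
        have := (dist_lt_of_burned hG Φ hb).resolve_right (hΦ x t hx).1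
        have := (hΦ x t hx).2
        omega
  exact ⟨t, .inr fun u hu p => ⟨x, hs.mem_support hG p.1 (hclear t u hu) hxv, t, le_rfl, hx⟩⟩

end Fire

/-! ### Distances in caterpillars with long legs -/

/-- A function that behaves like the distance from `x` is the distance from `x`. -/
theorem dist_eq_of_local {V : Type*} {G : SimpleGraph V} {x : V} {f : V → ℕ} (h0 : f x = 0)
    (hle : ∀ u w, G.Adj u w → f w ≤ f u + 1)
    (hex : ∀ w, w ≠ x → ∃ u, G.Adj w u ∧ f u + 1 = f w) (w : V) :
    G.Reachable x w ∧ G.dist x w = f w := by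
  have h1 : ∀ m w, f w = m → ∃ p : G.Walk w x, p.length = m := by
    intro m
    induction m with
    | zero =>
      intro w hw
      by_cases hwx : w = x
      · subst hwx; exact ⟨.nil, rfl⟩
      · obtain ⟨u, -, hu⟩ := hex w hwx; omega
    | succ m ih =>
      intro w hw
      obtain ⟨u, hadj, hu⟩ := hex w (by rintro rfl; omega)
      obtain ⟨p, hp⟩ := ih u (by omega)
      exact ⟨.cons hadj p, by simp [hp]⟩
  have h2 : ∀ {u w : V} (p : G.Walk u w), f w ≤ f u + p.length := by
    intro u w p
    induction p with
    | nil => simp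
    | cons hadj q ih =>
      have := hle _ _ hadj
      rw [SimpleGraph.Walk.length_cons]
      omega
  obtain ⟨p, hp⟩ := h1 _ w rfl
  refine ⟨p.reverse.reachable, le_antisymm ?_ ?_⟩
  · rw [SimpleGraph.dist_comm, ← hp]; exact SimpleGraph.dist_le p
  · obtain ⟨q, hq⟩ := p.reverse.reachable.exists_walk_length_eq_dist
    have := h2 q
    omega

section Caterpillar

variable {p L : ℕ} (foot : Fin L → Fin p) (len : Fin L → ℕ)

/-- The distance between two vertices of a caterpillar with long legs, in terms of the positions of
the vertices. -/
def legDist : Fin p ⊕ ((l : Fin L) × Fin (len l)) → Fin p ⊕ ((l : Fin L) × Fin (len l)) → ℕ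
  | .inl i, .inl j => ((i : ℕ) - j) + (j - i)
  | .inl i, .inr c => ((i : ℕ) - foot c.1) + (foot c.1 - i) + c.2 + 1
  | .inr c, .inl i => ((i : ℕ) - foot c.1) + (foot c.1 - i) + c.2 + 1
  | .inr c, .inr d => if c.1 = d.1 then ((c.2 : ℕ) - d.2) + (d.2 - c.2) else
      ((foot c.1 : ℕ) - foot d.1) + (foot d.1 - foot c.1) + c.2 + d.2 + 2

variable {foot len}

theorem spineLegGraph_adj_inl_inl {i j : Fin p} :
    (spineLegGraph p L foot len).Adj (.inl i) (.inl j) ↔ (i : ℕ) + 1 = j ∨ (j : ℕ) + 1 = i := by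
  rw [spineLegGraph, SimpleGraph.fromRel_adj]
  simp only [ne_eq, Sum.inl.injEq, and_iff_right_iff_imp]
  rintro h rfl
  omega

theorem spineLegGraph_adj_inl_inr {i : Fin p} {c : (l : Fin L) × Fin (len l)} :
    (spineLegGraph p L foot len).Adj (.inl i) (.inr c) ↔ foot c.1 = i ∧ (c.2 : ℕ) = 0 := by
  rw [spineLegGraph, SimpleGraph.fromRel_adj]
  simp

theorem spineLegGraph_adj_inr_inr {l l' : Fin L} {i : Fin (len l)} {j : Fin (len l')} :
    (spineLegGraph p L foot len).Adj (.inr ⟨l, i⟩) (.inr ⟨l', j⟩) ↔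
      l = l' ∧ ((i : ℕ) + 1 = j ∨ (j : ℕ) + 1 = i) := by
  rw [spineLegGraph, SimpleGraph.fromRel_adj]
  constructor
  · rintro ⟨-, ⟨h, h'⟩ | ⟨h, h'⟩⟩
    · exact ⟨h, .inl h'⟩
    · exact ⟨h.symm, .inr h'⟩
  · rintro ⟨rfl, h⟩
    refine ⟨?_, h.imp (fun h => ⟨rfl, h⟩) (fun h => ⟨rfl, h⟩)⟩
    rintro h'
    simp only [Sum.inr.injEq, Sigma.mk.injEq, heq_eq_eq, true_and] at h'
    subst h'
    omega

theorem legDist_self (x) : legDist foot len x x = 0 := by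
  rcases x with i | c <;> simp [legDist]

theorem legDist_le_of_adj (x) {u w} (h : (spineLegGraph p L foot len).Adj u w) :
    legDist foot len x w ≤ legDist foot len x u + 1 := by
  rcases u with i | ⟨l, i⟩ <;> rcases w with j | ⟨l', j⟩
  · rw [spineLegGraph_adj_inl_inl] at h
    rcases x with a | ⟨m, a⟩ <;> simp only [legDist] <;> omega
  · rw [spineLegGraph_adj_inl_inr] at h
    obtain ⟨rfl, h⟩ := h
    simp only at h
    rcases x with a | ⟨m, a⟩ <;> simp only [legDist]
    · omega
    · split_ifs with hm
      · subst hm; omega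
      · omega
  · rw [SimpleGraph.adj_comm, spineLegGraph_adj_inl_inr] at h
    obtain ⟨rfl, h⟩ := h
    simp only at h
    rcases x with a | ⟨m, a⟩ <;> simp only [legDist]
    · omega
    · split_ifs with hm
      · subst hm; omega
      · omega
  · rw [spineLegGraph_adj_inr_inr] at h
    obtain ⟨rfl, h⟩ := h
    rcases x with a | ⟨m, a⟩ <;> simp only [legDist]
    · omega
    · split_ifs with hm
      · omega
      · omega

theorem exists_adj_legDist (x w) (h : w ≠ x) :
    ∃ u, (spineLegGraph p L foot len).Adj w u ∧
      legDist foot len x u + 1 = legDist foot len x w := by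
  -- one step from the spine vertex `j` towards the spine vertex `i`
  have spine : ∀ i j : Fin p, j ≠ i → ∃ j' : Fin p,
      (spineLegGraph p L foot len).Adj (.inl j) (.inl j') ∧
      ((i : ℕ) - j') + (j' - i) + 1 = ((i : ℕ) - j) + (j - i) := by
    intro i j hij
    rcases lt_or_gt_of_ne (Fin.val_ne_of_ne hij) with h | h
    · refine ⟨⟨j + 1, by omega⟩, spineLegGraph_adj_inl_inl.2 (.inl rfl), ?_⟩
      simp only; omega
    · refine ⟨⟨j - 1, by omega⟩, spineLegGraph_adj_inl_inl.2 (.inr (by simp only; omega)), ?_⟩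
      simp only; omega
  -- one step from a leg vertex towards the spine
  have down : ∀ (l : Fin L) (j : Fin (len l)), ∃ u,
      (spineLegGraph p L foot len).Adj (.inr ⟨l, j⟩) u ∧
      (∀ i, legDist foot len (.inl i) u + 1 = legDist foot len (.inl i) (.inr ⟨l, j⟩)) ∧
      (∀ m a, (m ≠ l ∨ (∀ h : m = l, (h ▸ a : Fin (len l)) < j)) →
        legDist foot len (.inr ⟨m, a⟩) u + 1 = legDist foot len (.inr ⟨m, a⟩) (.inr ⟨l, j⟩)) := by
    intro l j
    by_cases hj : (j : ℕ) = 0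
    · refine ⟨.inl (foot l), ?_, fun i => ?_, fun m a hm => ?_⟩
      · rw [SimpleGraph.adj_comm, spineLegGraph_adj_inl_inr]; exact ⟨rfl, hj⟩
      · simp only [legDist]; omega
      · rcases eq_or_ne m l with rfl | hml
        · have := (hm.resolve_left (fun h => h rfl)) rfl
          simp only [Fin.lt_def] at this
          omega
        · simp only [legDist, hml, if_false]; omega
    · refine ⟨.inr ⟨l, j - 1, by omega⟩, ?_, fun i => ?_, fun m a hm => ?_⟩
      · rw [spineLegGraph_adj_inr_inr]; exact ⟨rfl, .inr (by simp only; omega)⟩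
      · simp only [legDist]; omega
      · rcases eq_or_ne m l with rfl | hml
        · have := (hm.resolve_left (fun h => h rfl)) rfl
          simp only [Fin.lt_def] at this
          simp only [legDist, if_true]; omega
        · simp only [legDist, hml, if_false]; omega
  rcases x with i | ⟨m, a⟩ <;> rcases w with j | ⟨l, j⟩
  · obtain ⟨j', h1, h2⟩ := spine i j (fun h' => h (by rw [h']))
    exact ⟨.inl j', h1, h2⟩
  · obtain ⟨u, h1, h2, -⟩ := down l j
    exact ⟨u, h1, h2 i⟩
  · by_cases hj : j = foot m
    · subst hj
      refine ⟨.inr ⟨m, 0, Nat.zero_lt_of_lt a.2⟩, spineLegGraph_adj_inl_inr.2 ⟨rfl, rfl⟩, ?_⟩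
      simp [legDist]
    · obtain ⟨j', h1, h2⟩ := spine (foot m) j hj
      refine ⟨.inl j', h1, ?_⟩
      simp only [legDist]; omega
  · rcases eq_or_ne m l with rfl | hml
    · rcases lt_trichotomy a j with hlt | rfl | hgt
      · obtain ⟨u, h1, -, h3⟩ := down m j
        exact ⟨u, h1, h3 m a (.inr fun _ => hlt)⟩
      · exact absurd rfl h
      · refine ⟨.inr ⟨m, j + 1, by omega⟩, spineLegGraph_adj_inr_inr.2 ⟨rfl, .inl rfl⟩, ?_⟩
        simp only [Fin.lt_def] at hgt
        simp only [legDist, if_true]; omega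
    · obtain ⟨u, h1, -, h3⟩ := down l j
      exact ⟨u, h1, h3 m a (.inl hml)⟩

/-- A vertex of a caterpillar with long legs has only one neighbour that is not farther from a given
vertex. -/
theorem legDist_unique_parent {s w u u'} (h : (spineLegGraph p L foot len).Adj w u)
    (h' : (spineLegGraph p L foot len).Adj w u')
    (hd : legDist foot len s u ≤ legDist foot len s w)
    (hd' : legDist foot len s u' ≤ legDist foot len s w) : u = u' := by
  rcases w with i | ⟨l, i⟩
  · -- a neighbour on a leg is not farther from `s` only if `s` lies on that leg
    have leg : ∀ m a, (spineLegGraph p L foot len).Adj (.inl i) (.inr ⟨m, a⟩) →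
        legDist foot len s (.inr ⟨m, a⟩) ≤ legDist foot len s (.inl i) →
        (a : ℕ) = 0 ∧ ∃ b, s = .inr ⟨m, b⟩ := by
      intro m a e hd
      rw [spineLegGraph_adj_inl_inr] at e
      obtain ⟨rfl, e⟩ := e
      refine ⟨e, ?_⟩
      rcases s with j | ⟨m', b⟩
      · simp only [legDist] at hd; omega
      · by_cases hm : m' = m
        · subst hm; exact ⟨b, rfl⟩
        · simp only [legDist, hm, if_false] at hd; omega
    have spine : ∀ j : Fin p, (spineLegGraph p L foot len).Adj (.inl i) (.inl j) →
        legDist foot len s (.inl j) ≤ legDist foot len s (.inl i) → ∃ f : Fin p, f ≠ i ∧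
          (s = .inl f ∨ ∃ c, s = .inr c ∧ foot c.1 = f) ∧
          (((j : ℕ) + 1 = i ∧ f < i) ∨ ((i : ℕ) + 1 = j ∧ i < f)) := by
      intro j h hd
      rw [spineLegGraph_adj_inl_inl] at h
      rcases s with f | c
      · simp only [legDist] at hd
        exact ⟨f, by rintro rfl; omega, .inl rfl, by simp only [Fin.lt_def]; omega⟩
      · simp only [legDist] at hd
        exact ⟨foot c.1, fun h' => by rw [h'] at hd; omega, .inr ⟨c, rfl, rfl⟩,
          by simp only [Fin.lt_def]; omega⟩
    rcases u with j | ⟨m, a⟩ <;> rcases u' with j' | ⟨m', a'⟩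
    · obtain ⟨f, -, h1, h2⟩ := spine j h hd
      obtain ⟨f', -, h1', h2'⟩ := spine j' h' hd'
      have : f = f' := by
        rcases h1 with rfl | ⟨c, rfl, rfl⟩ <;> rcases h1' with h3 | ⟨c', h3, rfl⟩ <;>
          simp at h3 <;> simp [h3]
      subst this
      simp only [Fin.lt_def] at h2 h2'
      congr 1
      exact Fin.ext (by omega)
    · obtain ⟨f, hf, h1, -⟩ := spine j h hd
      obtain ⟨-, b, rfl⟩ := leg m' a' h' hd'
      rcases h1 with h1 | ⟨c, h1, rfl⟩
      · simp at h1
      · simp only [Sum.inr.injEq] at h1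
        subst h1
        exact absurd (spineLegGraph_adj_inl_inr.1 h').1 hf
    · obtain ⟨f, hf, h1, -⟩ := spine j' h' hd'
      obtain ⟨-, b, rfl⟩ := leg m a h hd
      rcases h1 with h1 | ⟨c, h1, rfl⟩
      · simp at h1
      · simp only [Sum.inr.injEq] at h1
        subst h1
        exact absurd (spineLegGraph_adj_inl_inr.1 h).1 hf
    · obtain ⟨h1, b, rfl⟩ := leg m a h hd
      obtain ⟨h2, b', h3⟩ := leg m' a' h' hd'
      obtain rfl : m = m' := by
        simp only [Sum.inr.injEq, Sigma.mk.injEq] at h3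
        exact h3.1
      rw [show a = a' from Fin.ext (h1.trans h2.symm)]
  · -- the neighbours of a leg vertex are one step up and one step down
    have hu : ∀ u, (spineLegGraph p L foot len).Adj (.inr ⟨l, i⟩) u →
        legDist foot len s u ≤ legDist foot len s (.inr ⟨l, i⟩) →
        ((∃ b : Fin (len l), s = .inr ⟨l, b⟩ ∧ i < b) ∧
          ∃ j : Fin (len l), u = .inr ⟨l, j⟩ ∧ (j : ℕ) = i + 1) ∨
        ((¬ ∃ b : Fin (len l), s = .inr ⟨l, b⟩ ∧ i < b) ∧
          (((i : ℕ) = 0 ∧ u = .inl (foot l)) ∨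
            ∃ j : Fin (len l), u = .inr ⟨l, j⟩ ∧ (j : ℕ) + 1 = i)) := by
      intro u h hd
      have hs : (∃ b : Fin (len l), s = .inr ⟨l, b⟩) ∨ ¬ ∃ b : Fin (len l), s = .inr ⟨l, b⟩ :=
        em _
      rcases u with j | ⟨m, j⟩
      · rw [SimpleGraph.adj_comm, spineLegGraph_adj_inl_inr] at h
        obtain ⟨rfl, h⟩ := h
        refine .inr ⟨?_, .inl ⟨h, rfl⟩⟩
        rintro ⟨b, rfl, hb⟩
        simp only [legDist, if_true, Fin.lt_def] at hd hb
        omega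
      · rw [spineLegGraph_adj_inr_inr] at h
        obtain ⟨rfl, h⟩ := h
        rcases h with h | h
        · refine .inl ⟨?_, j, rfl, h.symm⟩
          rcases s with f | ⟨m', b⟩
          · simp only [legDist] at hd; omega
          · by_cases hm : m' = l
            · subst hm
              simp only [legDist, if_true] at hd
              exact ⟨b, rfl, by rw [Fin.lt_def]; omega⟩
            · simp only [legDist, hm, if_false] at hd; omega
        · refine .inr ⟨?_, .inr ⟨j, rfl, h⟩⟩
          rintro ⟨b, rfl, hb⟩
          simp only [legDist, if_true, Fin.lt_def] at hd hb
          omega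
    rcases hu u h hd with ⟨h1, j, rfl, h2⟩ | ⟨h1, ⟨h2, rfl⟩ | ⟨j, rfl, h2⟩⟩ <;>
      rcases hu u' h' hd' with ⟨h1', j', rfl, h2'⟩ | ⟨h1', ⟨h2', rfl⟩ | ⟨j', rfl, h2'⟩⟩ <;>
      first
        | exact absurd h1 h1'
        | exact absurd h1' h1
        | rfl
        | (rw [show j = j' from Fin.ext (by omega)])
        | omega

/-- The vertex `x` lies on the path that starts in `s`, leads to the spine and follows the spine
upwards. -/
def OnUpperPath (s x : Fin p ⊕ ((l : Fin L) × Fin (len l))) : Prop :=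
  (∃ i : Fin p, x = .inl i ∧ ((∃ f, s = .inl f ∧ f ≤ i) ∨ ∃ c, s = .inr c ∧ foot c.1 ≤ i)) ∨
    ∃ l, ∃ a b : Fin (len l), s = .inr ⟨l, a⟩ ∧ x = .inr ⟨l, b⟩ ∧ b ≤ a

/-- The vertex `x` lies on the path that starts in `s`, leads to the spine and follows the spine
downwards. -/
def OnLowerPath (s x : Fin p ⊕ ((l : Fin L) × Fin (len l))) : Prop :=
  (∃ i : Fin p, x = .inl i ∧ ((∃ f, s = .inl f ∧ i ≤ f) ∨ ∃ c, s = .inr c ∧ i ≤ foot c.1)) ∨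
    ∃ l, ∃ a b : Fin (len l), s = .inr ⟨l, a⟩ ∧ x = .inr ⟨l, b⟩ ∧ b ≤ a

theorem OnUpperPath.total {s x y} (hx : OnUpperPath (foot := foot) (len := len) s x)
    (hy : OnUpperPath (foot := foot) (len := len) s y) :
    legDist foot len s x + legDist foot len x y = legDist foot len s y ∨
      legDist foot len s y + legDist foot len y x = legDist foot len s x := by
  rcases hx with ⟨i, rfl, ⟨f, rfl, h⟩ | ⟨c, rfl, h⟩⟩ | ⟨l, a, b, rfl, rfl, h⟩ <;>
    rcases hy with ⟨i', rfl, ⟨f', hs, h'⟩ | ⟨c', hs, h'⟩⟩ | ⟨l', a', b', hs, rfl, h'⟩ <;>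
    simp only [Sum.inl.injEq, Sum.inr.injEq, reduceCtorEq] at hs <;> cases hs <;>
    simp only [legDist, if_true, Fin.le_def] at h h' ⊢ <;> omega

theorem OnLowerPath.total {s x y} (hx : OnLowerPath (foot := foot) (len := len) s x)
    (hy : OnLowerPath (foot := foot) (len := len) s y) :
    legDist foot len s x + legDist foot len x y = legDist foot len s y ∨
      legDist foot len s y + legDist foot len y x = legDist foot len s x := by
  rcases hx with ⟨i, rfl, ⟨f, rfl, h⟩ | ⟨c, rfl, h⟩⟩ | ⟨l, a, b, rfl, rfl, h⟩ <;>
    rcases hy with ⟨i', rfl, ⟨f', hs, h'⟩ | ⟨c', hs, h'⟩⟩ | ⟨l', a', b', hs, rfl, h'⟩ <;>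
    simp only [Sum.inl.injEq, Sum.inr.injEq, reduceCtorEq] at hs <;> cases hs <;>
    simp only [legDist, if_true, Fin.le_def] at h h' ⊢ <;> omega

/-- A vertex on neither of the two paths lies on a leg, and its descendants are the vertices above
it on that leg. -/
theorem exists_leg_of_not_onPath {s x} (hu : ¬ OnUpperPath (foot := foot) (len := len) s x)
    (hl : ¬ OnLowerPath (foot := foot) (len := len) s x) :
    ∃ l, ∃ a : Fin (len l), x = .inr ⟨l, a⟩ ∧
      ∀ y, legDist foot len s x + legDist foot len x y = legDist foot len s y →
        ∃ b : Fin (len l), y = .inr ⟨l, b⟩ ∧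
          legDist foot len s y + a = legDist foot len s x + b := by
  rcases x with i | ⟨l, a⟩
  · exfalso
    rcases s with f | c
    · rcases le_total f i with h | h
      · exact hu (.inl ⟨i, rfl, .inl ⟨f, rfl, h⟩⟩)
      · exact hl (.inl ⟨i, rfl, .inl ⟨f, rfl, h⟩⟩)
    · rcases le_total (foot c.1) i with h | h
      · exact hu (.inl ⟨i, rfl, .inr ⟨c, rfl, h⟩⟩)
      · exact hl (.inl ⟨i, rfl, .inr ⟨c, rfl, h⟩⟩)
  · refine ⟨l, a, rfl, fun y hy => ?_⟩
    rcases s with f | ⟨m, e⟩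
    · rcases y with j | ⟨l', b⟩
      · simp only [legDist] at hy; omega
      · by_cases hl' : l = l'
        · subst hl'
          refine ⟨b, rfl, ?_⟩
          simp only [legDist, if_true] at hy ⊢; omega
        · simp only [legDist, hl', if_false] at hy; omega
    · by_cases hm : m = l
      · subst hm
        have hea : e < a := by
          by_contra hle
          exact hu (.inr ⟨m, e, a, rfl, rfl, not_lt.1 hle⟩)
        rw [Fin.lt_def] at hea
        rcases y with j | ⟨l', b⟩
        · simp only [legDist, if_true] at hy; omega
        · by_cases hl' : m = l'
          · subst hl'
            refine ⟨b, rfl, ?_⟩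
            simp only [legDist, if_true] at hy ⊢; omega
          · simp only [legDist, hl', if_true, if_false] at hy; omega
      · rcases y with j | ⟨l', b⟩
        · simp only [legDist, hm, if_false] at hy; omega
        · by_cases hl' : l = l'
          · subst hl'
            refine ⟨b, rfl, ?_⟩
            simp only [legDist, hm, if_true, if_false] at hy ⊢; omega
          · by_cases hml' : m = l'
            · subst hml'
              simp only [legDist, hm, hl', if_true, if_false] at hy; omega
            · simp only [legDist, hm, hl', hml', if_false] at hy; omega

end Caterpillar

/-! ### Caterpillars as rooted trees -/

section FireDataOfGraph

theorem dist_eq_legDist {V : Type*} {G : SimpleGraph V} {p L : ℕ} {foot : Fin L → Fin p}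
    {len : Fin L → ℕ} (φ : G ≃g spineLegGraph p L foot len) (x w : V) :
    G.Reachable x w ∧ G.dist x w = legDist foot len (φ x) (φ w) := by
  refine dist_eq_of_local (f := fun w => legDist foot len (φ x) (φ w)) (legDist_self _)
    (fun u w h => legDist_le_of_adj _ (φ.map_adj_iff.2 h)) (fun w h => ?_) w
  obtain ⟨u, hu, hd⟩ := exists_adj_legDist (φ x) (φ w) (fun h' => h (φ.injective h'))
  refine ⟨φ.symm u, ?_, by simpa using hd⟩
  rw [← φ.map_adj_iff]
  simpa using hu

variable {k : ℕ} {V : Type*} {G : SimpleGraph V}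

theorem IsKCaterpillar.connected (hG : IsKCaterpillar k G) : G.Connected := by
  obtain ⟨p, L, foot, len, hp, -, ⟨φ⟩⟩ := hG
  exact { preconnected := fun u v => (dist_eq_legDist φ u v).1
          nonempty := ⟨φ.symm (.inl ⟨0, hp⟩)⟩ }

theorem IsKCaterpillar.uniqueParent (hG : IsKCaterpillar k G) (s : V) : UniqueParent G s := by
  obtain ⟨p, L, foot, len, -, -, ⟨φ⟩⟩ := hG
  intro w u u' h h' hd hd'
  rw [(dist_eq_legDist φ _ _).2, (dist_eq_legDist φ _ _).2] at hd hd'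
  exact φ.injective (legDist_unique_parent (φ.map_adj_iff.2 h) (φ.map_adj_iff.2 h') hd hd')

/-- There are two paths from `s` such that the descendants of each vertex on neither of them form a
path with at most `k` vertices. The paths are given as sets `A` and `B` of vertices. -/
theorem IsKCaterpillar.exists_paths (hG : IsKCaterpillar k G) (s : V) :
    ∃ A B : V → Prop, (∀ x y, A x → A y → OnGeodesic G s x y ∨ OnGeodesic G s y x) ∧
      (∀ x y, B x → B y → OnGeodesic G s x y ∨ OnGeodesic G s y x) ∧
      ∀ x, ¬ A x → ¬ B x → ∀ y, OnGeodesic G s x y → G.dist s y < G.dist s x + k ∧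
        ∀ z, OnGeodesic G s x z → OnGeodesic G s y z ∨ OnGeodesic G s z y := by
  obtain ⟨p, L, foot, len, -, hlen, ⟨φ⟩⟩ := hG
  refine ⟨fun x => OnUpperPath (foot := foot) (φ s) (φ x),
    fun x => OnLowerPath (foot := foot) (φ s) (φ x), ?_, ?_, ?_⟩
  · intro x y hx hy
    simp only [OnGeodesic, (dist_eq_legDist φ _ _).2]
    exact hx.total hy
  · intro x y hx hy
    simp only [OnGeodesic, (dist_eq_legDist φ _ _).2]
    exact hx.total hy
  · intro x hA hB y hy
    simp only [OnGeodesic, (dist_eq_legDist φ _ _).2] at hy ⊢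
    obtain ⟨l, a, hx, h⟩ := exists_leg_of_not_onPath hA hB
    obtain ⟨b, hyb, hb⟩ := h _ hy
    refine ⟨by have := b.2; have := (hlen l).2; omega, fun z hz => ?_⟩
    obtain ⟨c, hzc, hc⟩ := h _ hz
    rw [hyb] at hb ⊢
    rw [hzc] at hc ⊢
    simp only [show ∀ b c : Fin (len l), legDist foot len (.inr ⟨l, b⟩) (.inr ⟨l, c⟩) =
      ((b : ℕ) - c) + (c - b) from fun b c => by simp [legDist]]
    omega

/-- The distances in a `k`-caterpillar are tree-like. -/
theorem FireData.isTreeLike_of_isKCaterpillar (I : FireData) (G : SimpleGraph (Fin I.n))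
    (hG : IsKCaterpillar I.k G) (s : Fin I.n) (hs : I.s = s)
    (hg : ∀ u v : Fin I.n, I.g u v = G.dist u v) : I.IsTreeLike := by
  have hc := hG.connected
  have hanc : ∀ x y : Fin I.n, I.anc x y ↔ OnGeodesic G s x y := by
    intro x y
    simp only [FireData.anc, FireData.d, OnGeodesic, hs, hg, Fin.is_lt, true_and]
  obtain ⟨A, B, hA, hB, hAB⟩ := hG.exists_paths s
  have hthin : ∀ x : Fin I.n, ¬ A x → ¬ B x → I.thin x := by
    refine fun x hx hx' => ⟨x.2, fun y hy hxy => ?_⟩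
    have h1 := hAB x hx hx' ⟨y, hy⟩ ((hanc _ _).1 hxy)
    refine ⟨?_, fun z hz hxz => ?_⟩
    · have h2 := h1.1
      rwa [← hg, ← hg, ← hs] at h2
    · exact (h1.2 ⟨z, hz⟩ ((hanc _ _).1 hxz)).imp (hanc ⟨y, hy⟩ ⟨z, hz⟩).2
        (hanc ⟨z, hz⟩ ⟨y, hy⟩).2
  refine ⟨by rw [hs]; exact s.2, fun x hx => ?_, fun x hx y hy h => ?_, fun x hx y hy z hz => ?_,
    fun x hx => ?_, fun a b x ha hb => ?_, fun x hx y hy z hz hxt hyt hzt => ?_⟩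
  · rw [hg ⟨x, hx⟩ ⟨x, hx⟩, SimpleGraph.dist_self]
  · rw [hg ⟨x, hx⟩ ⟨y, hy⟩, hc.dist_eq_zero_iff] at h
    exact congrArg Fin.val h
  · rw [hg ⟨x, hx⟩ ⟨y, hy⟩, hg ⟨y, hy⟩ ⟨z, hz⟩, hg ⟨x, hx⟩ ⟨z, hz⟩]
    exact hc.dist_triangle
  · rw [FireData.d, hs, hg s ⟨x, hx⟩]
    obtain ⟨p, hp, hlen⟩ := hc.exists_path_of_dist s ⟨x, hx⟩
    rw [← hlen]
    simpa using hp.length_lt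
  · exact ((hG.uniqueParent s).onGeodesic_total hc ((hanc ⟨a, ha.1⟩ ⟨x, ha.2.1⟩).1 ha)
      ((hanc ⟨b, hb.1⟩ ⟨x, ha.2.1⟩).1 hb)).imp (hanc ⟨a, ha.1⟩ ⟨b, hb.1⟩).2
      (hanc ⟨b, hb.1⟩ ⟨a, ha.1⟩).2
  · have hAB' : ∀ (x) (hx : x < I.n), ¬ I.thin x → A ⟨x, hx⟩ ∨ B ⟨x, hx⟩ := by
      intro x hx hxt
      by_contra! h
      exact hxt (hthin ⟨x, hx⟩ h.1 h.2)
    have hA' : ∀ (x) (hx : x < I.n) (y) (hy : y < I.n), A ⟨x, hx⟩ → A ⟨y, hy⟩ →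
        I.anc x y ∨ I.anc y x := fun x hx y hy h h' =>
      (hA _ _ h h').imp (hanc ⟨x, hx⟩ ⟨y, hy⟩).2 (hanc ⟨y, hy⟩ ⟨x, hx⟩).2
    have hB' : ∀ (x) (hx : x < I.n) (y) (hy : y < I.n), B ⟨x, hx⟩ → B ⟨y, hy⟩ →
        I.anc x y ∨ I.anc y x := fun x hx y hy h h' =>
      (hB _ _ h h').imp (hanc ⟨x, hx⟩ ⟨y, hy⟩).2 (hanc ⟨y, hy⟩ ⟨x, hx⟩).2
    rcases hAB' x hx hxt with h1 | h1 <;> rcases hAB' y hy hyt with h2 | h2 <;>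
      rcases hAB' z hz hzt with h3 | h3
    · exact .inl (hA' x hx y hy h1 h2)
    · exact .inl (hA' x hx y hy h1 h2)
    · exact .inr (.inl (hA' x hx z hz h1 h3))
    · exact .inr (.inr (hB' y hy z hz h2 h3))
    · exact .inr (.inr (hA' y hy z hz h2 h3))
    · exact .inr (.inl (hB' x hx z hz h1 h3))
    · exact .inl (hB' x hx y hy h1 h2)
    · exact .inl (hB' x hx y hy h1 h2)

end FireDataOfGraph

/-! ### From sets of vertices to protection strategies -/

section Schedule

open Classical

namespace FireData

variable (I : FireData)

/-- The position of `x` in the list of the vertices of `P` by increasing depth. -/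
noncomputable def rank (P : ℕ → Prop) (x : ℕ) : ℕ :=
  ((Finset.range I.n).filter fun y => P y ∧ (I.d y < I.d x ∨ I.d y = I.d x ∧ y < x)).card

/-- The number of vertices of `P`. -/
noncomputable def size (P : ℕ → Prop) : ℕ := ((Finset.range I.n).filter P).card

/-- The vertex of `P` at position `r` in the list of the vertices of `P` by increasing depth. -/
noncomputable def vertexAt (P : ℕ → Prop) (r : ℕ) : ℕ :=
  ∑ x ∈ Finset.range I.n, if P x ∧ I.rank P x = r then x else 0

variable {I} {P : ℕ → Prop}

theorem size_le : I.size P ≤ I.n :=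
  (Finset.card_filter_le _ _).trans (Finset.card_range _).le

theorem rank_lt_rank {x y : ℕ} (hx : x < I.n) (hPx : P x)
    (h : I.d x < I.d y ∨ I.d x = I.d y ∧ x < y) : I.rank P x < I.rank P y := by
  refine Finset.card_lt_card ((Finset.ssubset_iff_of_subset fun z hz => ?_).2 ⟨x, ?_, ?_⟩)
  · simp only [Finset.mem_filter] at hz ⊢
    exact ⟨hz.1, hz.2.1, by omega⟩
  · simp only [Finset.mem_filter, Finset.mem_range]
    exact ⟨hx, hPx, h⟩
  · simp

theorem rank_inj {x y : ℕ} (hx : x < I.n) (hPx : P x) (hy : y < I.n) (hPy : P y)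
    (h : I.rank P x = I.rank P y) : x = y := by
  by_contra hne
  rcases lt_trichotomy (I.d x) (I.d y) with hd | hd | hd
  · exact absurd h (rank_lt_rank hx hPx (.inl hd)).ne
  · rcases lt_or_gt_of_ne hne with h1 | h1
    · exact absurd h (rank_lt_rank hx hPx (.inr ⟨hd, h1⟩)).ne
    · exact absurd h (rank_lt_rank hy hPy (.inr ⟨hd.symm, h1⟩)).ne'
  · exact absurd h (rank_lt_rank hy hPy (.inl hd)).ne'

theorem rank_lt_size {x : ℕ} (hx : x < I.n) (hPx : P x) : I.rank P x < I.size P := by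
  refine Finset.card_lt_card ((Finset.ssubset_iff_of_subset fun z hz => ?_).2 ⟨x, ?_, ?_⟩)
  · simp only [Finset.mem_filter] at hz ⊢
    exact ⟨hz.1, hz.2.1⟩
  · simp [hx, hPx]
  · simp

theorem exists_rank_eq {r : ℕ} (hr : r < I.size P) : ∃ x < I.n, P x ∧ I.rank P x = r := by
  have h := Finset.surj_on_of_inj_on_of_card_le (s := (Finset.range I.n).filter P)
    (t := Finset.range (I.size P)) (fun x _ => I.rank P x)
    (fun x hx => by
      simp only [Finset.mem_filter, Finset.mem_range] at hx ⊢
      exact rank_lt_size hx.1 hx.2)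
    (fun x y hx hy h => by
      simp only [Finset.mem_filter, Finset.mem_range] at hx hy
      exact rank_inj hx.1 hx.2 hy.1 hy.2 h)
    (by rw [Finset.card_range]; exact le_rfl) r (Finset.mem_range.2 hr)
  obtain ⟨x, hx, rfl⟩ := h
  simp only [Finset.mem_filter, Finset.mem_range] at hx
  exact ⟨x, hx.1, hx.2, rfl⟩

theorem vertexAt_rank {x : ℕ} (hx : x < I.n) (hPx : P x) : I.vertexAt P (I.rank P x) = x := by
  rw [vertexAt, Finset.sum_eq_single x]
  · rw [if_pos ⟨hPx, rfl⟩]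
  · intro y hy hne
    exact if_neg fun h => hne (rank_inj (Finset.mem_range.1 hy) h.1 hx hPx h.2)
  · intro h
    exact absurd (Finset.mem_range.2 hx) h

/-- By the Hall condition, protecting the vertices by increasing depth meets all deadlines. -/
theorem rank_div_lt (hP : I.hall P) {x : ℕ} (hx : x < I.n) (hPx : P x) (hd : I.d x < I.N) :
    I.rank P x / I.b < I.d x := by
  refine Nat.div_lt_of_lt_mul (lt_of_lt_of_le ?_ (hP (I.d x) hd))
  refine Finset.card_lt_card ((Finset.ssubset_iff_of_subset fun z hz => ?_).2 ⟨x, ?_, ?_⟩)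
  · simp only [Finset.mem_filter] at hz ⊢
    exact ⟨hz.1, hz.2.1, by omega⟩
  · simp [hx, hPx]
  · simp

theorem value_eq_ncard (G : SimpleGraph (Fin I.n)) (s : Fin I.n) (hs : I.s = s)
    (hg : ∀ u v : Fin I.n, I.g u v = G.dist u v) (P : ℕ → Prop) :
    I.value P = Set.ncard {v : Fin I.n | I.inS v ∧ ∃ x : Fin I.n, P x ∧ OnGeodesic G s x v} := by
  rw [← Set.ncard_image_of_injective _ Fin.val_injective, FireData.value, ← Set.ncard_coe_finset]
  congr 1
  ext w
  simp only [Finset.coe_filter, Finset.mem_range, Set.mem_ofPred_eq, Set.mem_image]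
  constructor
  · rintro ⟨hw, hS, x, hx, hPx, hxw⟩
    refine ⟨⟨w, hw⟩, ⟨hS, ⟨x, hx⟩, hPx, ?_⟩, rfl⟩
    have := hxw.2.2
    rwa [d, d, hs, hg s ⟨x, hx⟩, hg s ⟨w, hw⟩, hg ⟨x, hx⟩ ⟨w, hw⟩] at this
  · rintro ⟨v, ⟨hS, x, hPx, hxv⟩, rfl⟩
    refine ⟨v.2, hS, x, x.2, hPx, x.2, v.2, ?_⟩
    rw [d, d, hs, hg, hg, hg]
    exact hxv

/-- The vertices that a valid strategy protects no later than at their distance from the source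
satisfy the Hall condition. -/
theorem hall_of_validStrategy (G : SimpleGraph (Fin I.n)) (s : Fin I.n) (hs : I.s = s)
    (hg : ∀ u v : Fin I.n, I.g u v = G.dist u v) {Ψ : Finset (Fin I.n × ℕ)}
    (hΨ : ValidStrategy G s I.b Ψ) :
    I.hall fun x => ∃ h : x < I.n, ∃ t, (⟨x, h⟩, t) ∈ Ψ ∧ t ≤ G.dist s ⟨x, h⟩ := by
  intro e _
  have h1 : (Ψ.filter fun q => 1 ≤ q.2 ∧ q.2 ≤ e).card ≤ I.b * (Finset.Icc 1 e).card := by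
    have hmaps : ∀ q ∈ Ψ.filter fun q => 1 ≤ q.2 ∧ q.2 ≤ e, q.2 ∈ Finset.Icc 1 e :=
      fun q hq => Finset.mem_Icc.2 (Finset.mem_filter.1 hq).2
    refine Finset.card_le_mul_card_image_of_maps_to hmaps _ fun t _ => ?_
    refine (Finset.card_le_card fun q hq => ?_).trans (hΨ.2.2 t)
    simp only [Finset.mem_filter] at hq ⊢
    exact ⟨hq.1.1, hq.2⟩
  rw [Nat.card_Icc, Nat.add_sub_cancel] at h1
  refine le_trans ?_ h1
  refine (Finset.card_le_card (t := (Ψ.filter fun q => 1 ≤ q.2 ∧ q.2 ≤ e).image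
    fun q => (q.1 : ℕ)) fun x hx => ?_).trans Finset.card_image_le
  simp only [Finset.mem_filter, Finset.mem_range, Finset.mem_image] at hx ⊢
  obtain ⟨-, ⟨h, t, ht, hle⟩, hd⟩ := hx
  rw [d, hs, hg s ⟨x, h⟩] at hd
  exact ⟨(⟨x, h⟩, t), ⟨ht, (hΨ.1 _ ht).1, hle.trans hd⟩, rfl⟩

/-- An optimal set of vertices, protected by increasing depth, gives an optimal strategy. -/
theorem exists_maxSaveSolution (hI : I.IsTreeLike) (hb : 1 ≤ I.b) (hnN : I.n ≤ I.N)
    (G : SimpleGraph (Fin I.n)) (hG : G.Connected) (s : Fin I.n) (hs : I.s = s)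
    (hpar : UniqueParent G s) (hg : ∀ u v : Fin I.n, I.g u v = G.dist u v)
    (S : Finset (Fin I.n)) (hS : ∀ v : Fin I.n, I.inS v ↔ v ∈ S)
    (hPn : ∀ x, P x → x < I.n ∧ x ≠ I.s) (hP : I.hall P)
    (hmax : ∀ X : ℕ → Prop, (∀ x, X x → x < I.n ∧ x ≠ I.s) → I.hall X → I.value X ≤ I.value P)
    (σ : RamState) (h2 : σ.var 2 = I.size P) (ha2 : ∀ r < I.size P, σ.arr 2 r = I.vertexAt P r)
    (ha3 : ∀ r < I.size P, σ.arr 3 r = r / I.b + 1) :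
    ∃ Φ : Finset (Fin I.n × ℕ), EncodesStrategy σ Φ ∧ IsMaxSaveSolution I.b G s S Φ := by
  have hdist : ∀ x : Fin I.n, I.d x = G.dist s x := fun x => by rw [d, hs, hg]
  have htime : ∀ x : Fin I.n, P x → I.rank P x / I.b + 1 ≤ G.dist s x := fun x hx => by
    rw [← hdist]
    exact rank_div_lt hP x.2 hx ((hI.d_lt x x.2).trans_le hnN)
  have hne : ∀ x : Fin I.n, P x → x ≠ s := by
    rintro x hx rfl
    exact (hPn _ hx).2 hs.symm
  set Φ : Finset (Fin I.n × ℕ) := (Finset.univ.filter fun x : Fin I.n => P x).image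
    fun x => (x, I.rank P x / I.b + 1) with hΦ
  have hmemΦ : ∀ x t, (x, t) ∈ Φ ↔ P x ∧ t = I.rank P x / I.b + 1 := by
    intro x t
    simp only [hΦ, Finset.mem_image, Finset.mem_filter, Finset.mem_univ, true_and, Prod.mk.injEq]
    constructor
    · rintro ⟨y, hy, rfl, rfl⟩; exact ⟨hy, rfl⟩
    · rintro ⟨hx, rfl⟩; exact ⟨x, hx, rfl, rfl⟩
  refine ⟨Φ, ?_, ⟨?_, ?_, ?_⟩, fun Ψ hΨ => ?_⟩
  · ext ⟨x, t⟩
    simp only [Finset.mem_image, Finset.mem_range, Prod.exists, Prod.mk.injEq, h2]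
    constructor
    · rintro ⟨y, t, hy, rfl, rfl⟩
      obtain ⟨hPy, rfl⟩ := (hmemΦ _ _).1 hy
      have hr := rank_lt_size y.2 hPy
      exact ⟨_, hr, by rw [ha2 _ hr, vertexAt_rank y.2 hPy], ha3 _ hr⟩
    · rintro ⟨r, hr, rfl, rfl⟩
      obtain ⟨x, hx, hPx, rfl⟩ := exists_rank_eq hr
      exact ⟨⟨x, hx⟩, _, (hmemΦ _ _).2 ⟨hPx, rfl⟩, by rw [ha2 _ hr, vertexAt_rank hx hPx],
        (ha3 _ hr).symm⟩
  · rintro ⟨x, t⟩ hx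
    obtain ⟨hPx, rfl⟩ := (hmemΦ _ _).1 hx
    refine ⟨Nat.succ_pos _, ?_⟩
    rw [Fintype.card_fin]
    have h1 := htime x hPx
    have h3 := hI.d_lt x x.2
    rw [hdist] at h3
    exact h1.trans h3.le
  · intro x t hx hburn
    obtain ⟨hPx, rfl⟩ := (hmemΦ _ _).1 hx
    have h1 := (dist_lt_of_burned hG Φ hburn).resolve_right (hne x hPx)
    have h3 := htime x hPx
    omega
  · intro t
    have h1 := Finset.card_le_card_of_injOn (s := Φ.filter fun q => q.2 = t)
      (t := Finset.Ico (I.b * (t - 1)) (I.b * (t - 1) + I.b)) (fun q => I.rank P q.1) ?_ ?_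
    · rwa [Nat.card_Ico, Nat.add_sub_cancel_left] at h1
    · rintro ⟨x, t'⟩ hx
      rw [Finset.mem_coe, Finset.mem_filter] at hx
      obtain ⟨hPx, h3⟩ := (hmemΦ x t').1 hx.1
      have h4 : t' = t := hx.2
      have h5 : I.rank P x / I.b = t - 1 := by rw [← h4, h3, Nat.add_sub_cancel]
      rw [Finset.mem_coe, Finset.mem_Ico, ← h5]
      have h6 := Nat.div_add_mod (I.rank P x) I.b
      have h7 := Nat.mod_lt (I.rank P x) hb
      exact ⟨by simp only; omega, by simp only; omega⟩
    · rintro ⟨x, t₁⟩ hx ⟨y, t₂⟩ hy hxy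
      rw [Finset.mem_coe, Finset.mem_filter] at hx hy
      have h3 := rank_inj x.2 ((hmemΦ _ _).1 hx.1).1 y.2 ((hmemΦ _ _).1 hy.1).1 hxy
      have h4 : t₁ = t := hx.2
      have h5 : t₂ = t := hy.2
      rw [Fin.ext h3, h4, h5]
  · set X : ℕ → Prop := fun x => ∃ h : x < I.n, ∃ t, (⟨x, h⟩, t) ∈ Ψ ∧ t ≤ G.dist s ⟨x, h⟩
      with hX
    have h1 := hmax X (by
      rintro x ⟨h, t, ht, hle⟩
      refine ⟨h, ?_⟩
      rintro rfl
      have h3 : (⟨I.s, h⟩ : Fin I.n) = s := Fin.ext hs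
      have h4 := (hΨ.1 _ ht).1
      rw [h3, SimpleGraph.dist_self] at hle
      simp only at h4
      omega) (hall_of_validStrategy G s hs hg hΨ)
    rw [value_eq_ncard G s hs hg, value_eq_ncard G s hs hg] at h1
    refine le_trans (Set.ncard_le_ncard ?_ (Set.toFinite _))
      (h1.trans (Set.ncard_le_ncard ?_ (Set.toFinite _)))
    · rintro v ⟨hv, hsaved⟩
      obtain ⟨x, t, hx, ht, hxv⟩ := exists_protected_of_saved hG hΨ hsaved
      exact ⟨(hS v).2 hv, x, ⟨x.2, t, hx, ht⟩, hxv⟩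
    · rintro v ⟨hv, x, hPx, hxv⟩
      refine ⟨(hS v).1 hv, saved_of_onGeodesic hG hpar (fun y t hy => ?_)
        ((hmemΦ x _).2 ⟨hPx, rfl⟩) hxv⟩
      obtain ⟨hPy, rfl⟩ := (hmemΦ _ _).1 hy
      exact ⟨hne y hPy, htime y hPy⟩

end FireData

end Schedule

/-! ### Definability of the dynamic program -/

open Context

/-- The instance that a store describes, if array `5` holds the distances increased by one. -/
def Store.fire (M : Store) (k b : ℕ) : FireData where
  n := M.n
  s := M.s
  k := k
  b := b
  N := M.N
  g x y := M.arr 5 (x * M.N + y) - 1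
  inS v := M.arr 0 v ≠ 0

/-- The table of the dynamic program, which is stored in array `6`. -/
def Store.table (M : Store) (κ c : ℕ) : ℕ := M.arr 6 (κ * M.N + c)

section Definability

open Classical

variable {α : Type} [Context α] {k b : ℕ} {f g : α → ℕ}

/-- A family of rows, or of other functions on the numbers below `N`, with definable entries. -/
abbrev DefinableRow (ρ : α → ℕ → ℕ) : Prop := Definable fun x : α × ℕ => ρ x.1 x.2

/-- A family of sets of numbers below `N` with definable membership. -/
abbrev DefinableSet (P : α → ℕ → Prop) : Prop := DefinablePred fun x : α × ℕ => P x.1 x.2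

theorem Definable.entry {i : ℕ} (hi : i ≠ 4) (hf : Definable f) (hg : Definable g) :
    Definable fun a => (store a).arr i (f a * (store a).N + g a) :=
  (Definable.read hi ((Definable.N.mul hf fun _ _ => le_rfl).add hg)).congr
    fun a _ => by rw [mul_comm]

theorem Definable.table (hf : Definable f) (hg : Definable g) :
    Definable fun a => (store a).table (f a) (g a) :=
  Definable.entry (by decide) hf hg

namespace FireData

theorem definable_g (hf : Definable f) (hg : Definable g) :
    Definable fun a => ((store a).fire k b).g (f a) (g a) :=
  (Definable.entry (i := 5) (by decide) hf hg).sub (.const 1)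

theorem definable_d (hf : Definable f) : Definable fun a => ((store a).fire k b).d (f a) :=
  definable_g (k := k) (b := b) .s hf

theorem definable_anc (hf : Definable f) (hg : Definable g) :
    DefinablePred fun a => ((store a).fire k b).anc (f a) (g a) :=
  (DefinablePred.lt hf .n).and ((DefinablePred.lt hg .n).and
    (.eq ((definable_d (k := k) (b := b) hf).add (definable_g (k := k) (b := b) hf hg))
      (definable_d (k := k) (b := b) hg)))

theorem definable_thin (hf : Definable f) :
    DefinablePred fun a => ((store a).fire k b).thin (f a) :=
  (DefinablePred.lt hf .n).and (.alln (.imp (definable_anc (k := k) (b := b) hf.wk .var)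
    (.and (.lt (definable_d (k := k) (b := b) .var)
      ((definable_d (k := k) (b := b) hf.wk).add (.const k)))
    (.alln (.imp (definable_anc (k := k) (b := b) hf.wk.wk .var)
      (.or (definable_anc (k := k) (b := b) Definable.var.wk .var)
        (definable_anc (k := k) (b := b) .var Definable.var.wk)))))))

theorem definable_head (hf : Definable f) :
    DefinablePred fun a => ((store a).fire k b).head (f a) :=
  (definable_thin (k := k) (b := b) hf).and (.alln (.imp (definable_thin (k := k) (b := b) .var)
    (.imp (definable_anc (k := k) (b := b) .var hf.wk) (.eq .var hf.wk))))

theorem definable_hall {P : α → ℕ → Prop} (hP : DefinableSet P) :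
    DefinablePred fun a => ((store a).fire k b).hall (P a) := by
  refine .allN (.le (.countn (p := fun (x : α × ℕ) y => P x.1 y ∧
    ((store x.1).fire k b).d y ≤ x.2) (hP.swap.and
    (.le (definable_d (k := k) (b := b) .var) Definable.var.wk))) ?_)
  exact (Definable.var.mul (.const b) fun a h => h.2.le).congr fun a _ => mul_comm _ _

theorem definable_value {P : α → ℕ → Prop} (hP : DefinableSet P) :
    Definable fun a => ((store a).fire k b).value (P a) :=
  .countn (p := fun a w => ((store a).fire k b).inS w ∧
    ∃ x < ((store a).fire k b).n, P a x ∧ ((store a).fire k b).anc x w)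
    ((DefinablePred.ne_zero (.read (by decide) .var)).and
      (.exn (hP.swap.and (definable_anc (k := k) (b := b) .var Definable.var.wk))))

theorem definable_base : Definable fun a : α => ((store a).fire k b).base :=
  Definable.n.add (.const 2)

theorem definable_guessable (hf : Definable f) :
    DefinablePred fun a => ((store a).fire k b).guessable (f a) :=
  (DefinablePred.lt hf .n).and (.or (.eq hf .s) (definable_thin (k := k) (b := b) hf).not)

theorem definable_column {ρ : α → ℕ → ℕ} (hρ : DefinableRow ρ) {i : ℕ} (hi : i ≤ 2) :
    Definable fun a => ρ a ((store a).n + i) :=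
  Definable.subst hρ (Definable.n.add (.const i)) fun a ha => by
    have := wf_store a ha; omega

theorem definable_mem {ρ : α → ℕ → ℕ} (hρ : DefinableRow ρ) :
    DefinableSet fun a => ((store a).fire k b).mem (ρ a) :=
  (DefinablePred.lt .var .n).and ((DefinablePred.eq .var .s).not.and
    ((DefinablePred.ne_zero hρ).or ((DefinablePred.eq .var (definable_column hρ one_le_two).wk).or
      (.eq .var (definable_column hρ le_rfl).wk))))

theorem definable_count {ρ : α → ℕ → ℕ} (hρ : DefinableRow ρ) (hf : Definable f) :
    Definable fun a => ((store a).fire k b).count (ρ a) (f a) :=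
  .countn (p := fun a x => ρ a x ≠ 0 ∧ ((store a).fire k b).d x ≤ f a)
    ((DefinablePred.ne_zero hρ).and (.le (definable_d (k := k) (b := b) .var) hf.wk))

theorem definable_digits {ρ : α → ℕ → ℕ} (hρ : DefinableRow ρ) (m : ℕ) :
    ∀ {f : α → ℕ}, Definable f → Definable fun a =>
      ((store a).fire k b).digits (((store a).fire k b).count (ρ a)) (f a) m := by
  induction m with
  | zero => exact fun _ => .const 0
  | succ m ih =>
    intro f hf
    refine (definable_count (k := k) (b := b) hρ hf).add
      ((definable_base (k := k) (b := b)).mul (ih (hf.add (.const 1))) fun a ha => ?_)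
    have := wf_store a ha
    change (store a).n + 2 ≤ _
    omega

theorem definable_div_n (hf : Definable f) (h : ∀ a, wf a → f a ≤ (store a).N) :
    Definable fun a => f a / (store a).n :=
  hf.div .n h fun _ ha => (wf_store _ ha).1

theorem definable_mod_n (hf : Definable f) (h : ∀ a, wf a → f a ≤ (store a).N) :
    Definable fun a => f a % (store a).n :=
  hf.mod .n h fun _ ha => (wf_store _ ha).1

theorem definable_div_base (hf : Definable f) (h : ∀ a, wf a → f a ≤ (store a).N) :
    Definable fun a => f a / ((store a).fire k b).base :=
  hf.div definable_base h fun _ _ => Nat.succ_pos _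

theorem definable_mod_base (hf : Definable f) (h : ∀ a, wf a → f a ≤ (store a).N) :
    Definable fun a => f a % ((store a).fire k b).base :=
  hf.mod definable_base h fun _ _ => Nat.succ_pos _

theorem definable_code {ρ : α → ℕ → ℕ} (hρ : DefinableRow ρ) (hf : Definable f)
    (h : ∀ a, wf a → f a ≤ (store a).N) :
    Definable fun a => ((store a).fire k b).code (f a) (ρ a) := by
  have hB : ∀ a : α, wf a → ((store a).fire k b).base ≤ (store a).N := fun a ha => by
    have := wf_store a ha
    change (store a).n + 2 ≤ _
    omega
  exact (definable_value (k := k) (b := b) (definable_mem (k := k) (b := b) hρ)).add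
    (definable_base.mul ((definable_column hρ one_le_two).add
      (definable_base.mul ((definable_column hρ le_rfl).add
        (definable_base.mul (definable_digits (k := k) (b := b) hρ k (definable_div_n hf h)) hB))
        hB)) hB)

theorem definable_option (hf : Definable f) (hg : Definable g)
    (h : ∀ a, wf a → f a ≤ (store a).N) :
    DefinablePred fun a => ((store a).fire k b).option (f a) (g a) :=
  (DefinablePred.eq hg .s).not.and ((definable_head (k := k) (b := b) (definable_mod_n hf h)).and
    ((DefinablePred.eq (definable_d (k := k) (b := b) (definable_mod_n hf h))
      (definable_div_n hf h)).and (definable_anc (k := k) (b := b) (definable_mod_n hf h) hg)))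

theorem definable_extend {ρ : α → ℕ → ℕ} (hρ : DefinableRow ρ) (hf : Definable f)
    (hg : Definable g) (h : ∀ a, wf a → f a ≤ (store a).N) :
    DefinableRow fun a => ((store a).fire k b).extend (f a) (ρ a) (g a) :=
  .ite_of ((definable_option (k := k) (b := b) hf hg h).wk.and (.eq .var hg.wk)) (.const 1) hρ

theorem definable_initRow (hf : Definable f) (hg : Definable g) :
    DefinableRow fun a => ((store a).fire k b).initRow (f a) (g a) :=
  .ite_of (.eq .var .n) (.const 1) (.ite_of (.eq .var (Definable.n.add (.const 1))) hf.wk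
    (.ite_of (.eq .var (Definable.n.add (.const 2))) hg.wk (.const 0)))

/-- For the candidates, `f` is the number of the round and `g` the number of the candidate. -/
theorem definable_cand (hf : Definable f) (hg : Definable g) (h : ∀ a, wf a → f a ≤ (store a).N)
    (h' : ∀ a, wf a → g a ≤ (store a).N) :
    DefinableRow fun a => ((store a).fire k b).cand (store a).table (f a) (g a) :=
  .ite_of (DefinablePred.eq hf (.const 0)).wk
    (definable_initRow (k := k) (b := b) (definable_div_base (k := k) (b := b) hg h')
      (definable_mod_base (k := k) (b := b) hg h'))
    (definable_extend (k := k) (b := b)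
      (ρ := fun a => (store a).table (g a / ((store a).fire k b).base))
      (.table (definable_div_base (k := k) (b := b) hg h').wk .var) (hf.sub (.const 1))
      (definable_mod_base (k := k) (b := b) hg h') fun a ha => (Nat.sub_le _ _).trans (h a ha))

theorem definable_candOK {e : α → ℕ} (hf : Definable f) (he : Definable e) (hg : Definable g)
    (h : ∀ a, wf a → f a ≤ (store a).N) (h' : ∀ a, wf a → g a ≤ (store a).N) :
    DefinablePred fun a => ((store a).fire k b).candOK (store a).table (f a) (e a) (g a) := by
  have hcand := definable_cand (k := k) (b := b) hf hg h h'
  have hdiv := definable_div_base (k := k) (b := b) hg h'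
  have hmod := definable_mod_base (k := k) (b := b) hg h'
  exact (((DefinablePred.eq hf (.const 0)).and ((definable_guessable (k := k) (b := b) hdiv).and
      (definable_guessable (k := k) (b := b) hmod))).or
    ((DefinablePred.eq hf (.const 0)).not.and (.ne_zero (.table hdiv .n)))).and
    ((definable_hall (k := k) (b := b) (definable_mem (k := k) (b := b) hcand)).and
      (.eq (definable_code (k := k) (b := b) hcand hf h) he))

/-- If no number below `N` has the property, the infimum is the junk value `0`. -/
theorem sInf_lt_le (N : ℕ) (p : ℕ → Prop) : sInf {i | i < N ∧ p i} ≤ N := by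
  rcases Set.eq_empty_or_nonempty {i | i < N ∧ p i} with h | h
  · rw [h, Nat.sInf_empty]; exact Nat.zero_le N
  · exact (Nat.sInf_mem h).1.le

theorem definable_step {c e : α → ℕ} (hf : Definable f) (he : Definable e) (hc : Definable c)
    (h : ∀ a, wf a → f a ≤ (store a).N) (h' : ∀ a, wf a → c a < (store a).N) :
    Definable fun a => ((store a).fire k b).step (store a).table (f a) (e a) (c a) := by
  have hOK : DefinableSet fun a => ((store a).fire k b).candOK (store a).table (f a) (e a) :=
    definable_candOK (k := k) (b := b) hf.wk he.wk .var (fun a ha => h a.1 ha.1)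
      fun a ha => ha.2.le
  have hleast := Definable.least
    (p := fun a => ((store a).fire k b).candOK (store a).table (f a) (e a)) hOK
  exact .ite_of (.exN hOK) (.subst (definable_cand (k := k) (b := b) hf hleast h
    fun a _ => sInf_lt_le _ _) hc h') (.const 0)

theorem definable_isBest (hf : Definable f) :
    DefinablePred fun a => ((store a).fire k b).isBest (store a).table (f a) := by
  have hval : ∀ {β : Type} [Context β] {f : β → ℕ}, Definable f → Definable fun a =>
      ((store a).fire k b).value (((store a).fire k b).mem ((store a).table (f a))) :=
    fun hf => definable_value (k := k) (b := b)
      (definable_mem (k := k) (b := b) (.table hf.wk .var))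
  exact (DefinablePred.ne_zero (.table hf .n)).and
    (.allN (.imp (.ne_zero (.table .var .n)) (.le (hval .var) (hval hf.wk))))

theorem definable_best : Definable fun a : α => ((store a).fire k b).best (store a).table :=
  .least (p := fun a => ((store a).fire k b).isBest (store a).table)
    (definable_isBest (k := k) (b := b) .var)

theorem definable_rank {P : α → ℕ → Prop} (hP : DefinableSet P) (hf : Definable f) :
    Definable fun a => ((store a).fire k b).rank (P a) (f a) :=
  .countn (p := fun a y => P a y ∧ (((store a).fire k b).d y < ((store a).fire k b).d (f a) ∨
      ((store a).fire k b).d y = ((store a).fire k b).d (f a) ∧ y < f a))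
    (hP.and ((DefinablePred.lt (definable_d (k := k) (b := b) .var)
      (definable_d (k := k) (b := b) hf.wk)).or
      ((DefinablePred.eq (definable_d (k := k) (b := b) .var)
      (definable_d (k := k) (b := b) hf.wk)).and (.lt .var hf.wk))))

theorem definable_size {P : α → ℕ → Prop} (hP : DefinableSet P) :
    Definable fun a => ((store a).fire k b).size (P a) :=
  .countn hP

theorem definable_vertexAt {P : α → ℕ → Prop} (hP : DefinableSet P) (hf : Definable f) :
    Definable fun a => ((store a).fire k b).vertexAt (P a) (f a) :=
  .sumn (.ite_of (hP.and (.eq (definable_rank (k := k) (b := b) (P := fun x : α × ℕ => P x.1)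
    hP.swap .var) hf.wk)) .var (.const 0))

end FireData

/-- One round of the breadth-first search from all vertices: the pairs at distance `t` get the
entry `t + 1`. -/
noncomputable def distStep (M : Store) (t u v : ℕ) : ℕ :=
  if M.arr 5 (u * M.N + v) ≠ 0 then M.arr 5 (u * M.N + v) else
    if (t = 0 ∧ u = v) ∨ ∃ w < M.n, M.arr 5 (u * M.N + w) ≠ 0 ∧ M.arr 1 (w * M.n + v) ≠ 0
      then t + 1 else 0

theorem definable_distStep {c : α → ℕ} (hf : Definable f) (hg : Definable g) (hc : Definable c) :
    Definable fun a => distStep (store a) (f a) (g a) (c a) := by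
  have hr := Definable.entry (i := 5) (by decide) hg hc
  refine .ite_of (.ne_zero hr) hr (.ite_of (.or (.and (.eq hf (.const 0)) (.eq hg hc))
    (.exn (.and (.ne_zero (.entry (by decide) hg.wk .var)) (.ne_zero ?_))))
    (hf.add (.const 1)) (.const 0))
  refine (Definable.read (i := 1) (by decide) ((Definable.n.mul .var fun a ha => ?_).add
    hc.wk)).congr fun a _ => by rw [mul_comm]; rfl
  have := wf_store a ha
  omega

end Definability

/-! ### The program and its correctness -/

section Assembly

open Context

/-- The value of a definable function can be assigned to variable `2` in polynomial time. -/
theorem Definable.exists_output {g : Store → ℕ} (hg : Definable g) :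
    ∃ (P : RamProg) (C : Polynomial ℕ), ∀ M : Store, wf M →
      Triple (Represents M) P (C.eval M.N)
        (fun σ => σ.var 2 = g M ∧ ∀ a, a ≠ 4 → σ.arr a = M.arr a) := by
  obtain ⟨e, he⟩ := hg
  refine ⟨.seq (e.compile (fun _ => 0) 4) (.copy 2 4), e.cost + 1, fun M hM σ hσ => ?_⟩
  obtain ⟨t, τ, ht, hr, ⟨h1, h2⟩, h3⟩ := Expr.compile_spec M e (fun _ => 0) 4 σ le_rfl
    (fun _ => by omega) hσ σ ⟨rfl, fun _ _ => rfl⟩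
  refine ⟨t + 1, _, by simpa using ht, .seq hr (.copy _ _ _), ?_, fun a ha => ?_⟩
  · rw [RamState.setVar_var, if_pos rfl, h3]
    exact he M hM _ fun i hi => absurd hi (Nat.not_lt_zero i)
  · rw [RamState.setVar_arr, h1, hσ.2.2.2 a ha]

theorem Store.fire_congr {M M' : Store} {k b : ℕ} (hN : M'.N = M.N) (hn : M'.n = M.n)
    (hs : M'.s = M.s) (h5 : M'.arr 5 = M.arr 5) (h0 : M'.arr 0 = M.arr 0) :
    M'.fire k b = M.fire k b := by
  simp only [Store.fire, hN, hn, hs, h5, h0]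

theorem Store.iterFill_fire {a : ℕ} (f) (M : Store) (t : ℕ) {k b : ℕ} (h5 : 5 ≠ a) (h0 : 0 ≠ a) :
    (Store.iterFill a f M t).fire k b = M.fire k b :=
  Store.fire_congr (by simp) (by simp) (by simp) (Store.iterFill_arr_of_ne _ _ _ h5)
    (Store.iterFill_arr_of_ne _ _ _ h0)

theorem Store.iterFill_table {a : ℕ} (f) (M : Store) (t : ℕ) (h6 : 6 ≠ a) :
    (Store.iterFill a f M t).table = M.table := by
  funext κ c
  rw [Store.table, Store.table, Store.iterFill_N, Store.iterFill_arr_of_ne _ _ _ h6]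

/-- The breadth-first search computes the distances. -/
theorem iterFill_distStep {n : ℕ} (G : SimpleGraph (Fin n)) (hG : G.Connected) (M : Store)
    (hn : M.n = n) (hnN : n ≤ M.N) (h5 : ∀ i, M.arr 5 i = 0)
    (h1 : ∀ w v : Fin n, M.arr 1 (w * n + v) ≠ 0 ↔ G.Adj w v) (t : ℕ) (u v : Fin n) :
    (Store.iterFill 5 distStep M t).arr 5 (u * M.N + v) =
      if G.dist u v < t then G.dist u v + 1 else 0 := by
  induction t generalizing u v with
  | zero => simp [Store.iterFill, h5]
  | succ t ih =>
    rw [Store.iterFill_succ_arr 5 distStep M t (u.2.trans_le hnN) (v.2.trans_le hnN), distStep]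
    simp only [Store.iterFill_N, Store.iterFill_n, hn, ih,
      Store.iterFill_arr_of_ne distStep M t (show 1 ≠ 5 by decide)]
    by_cases hlt : G.dist u v < t
    · rw [if_pos hlt, if_pos (Nat.succ_ne_zero _), if_pos (by omega)]
    rw [if_neg hlt, if_neg (by simp)]
    by_cases heq : G.dist u v = t
    · rw [if_pos, if_pos (by omega), heq]
      by_cases huv : u = v
      · subst huv
        rw [SimpleGraph.dist_self] at heq
        exact .inl ⟨heq.symm, rfl⟩
      · obtain ⟨w, hw, hd⟩ := exists_adj_dist_add_one hG huv
        refine .inr ⟨w, w.2, ?_, (h1 w v).2 hw.symm⟩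
        rw [ih, if_pos (by omega)]
        exact Nat.succ_ne_zero _
    · rw [if_neg, if_neg (by omega)]
      rintro (⟨rfl, huv⟩ | ⟨w, hw, hr, hadj⟩)
      · rw [Fin.ext huv, SimpleGraph.dist_self] at heq
        exact heq rfl
      · have h2 := ih u ⟨w, hw⟩
        simp only at h2
        rw [h2] at hr
        have h3 := (h1 ⟨w, hw⟩ v).1 hadj
        have h4 := hG.dist_triangle (u := u) (v := ⟨w, hw⟩) (w := v)
        rw [SimpleGraph.dist_eq_one_iff_adj.2 h3] at h4
        split_ifs at hr with h6
        · omega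
        · exact hr rfl

/-- The set of vertices that the dynamic program chooses, from the tables in a store. -/
noncomputable def Store.chosen (k b : ℕ) (M : Store) : ℕ → Prop :=
  (M.fire k b).mem (M.table ((M.fire k b).best M.table))

theorem definableSet_chosen {α : Type} [Context α] (k b : ℕ) :
    DefinableSet fun a : α => (store a).chosen k b :=
  FireData.definable_mem (k := k) (b := b)
    (.table (FireData.definable_best (k := k) (b := b)).wk .var)

/-- All steps of the computation except for the last assignment: the distances go to array `5`, the
table of the dynamic program to array `6`, the protected vertices by increasing depth to array `2`,
and the times at which they are protected to array `3`. -/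
noncomputable def solve (k b : ℕ) (M : Store) : Store :=
  let M₁ := Store.iterFill 5 distStep M M.N
  let M₂ := Store.iterFill 6 (fun M t κ c => (M.fire k b).step M.table t κ c) M₁ M₁.N
  let M₃ := Store.iterFill 2 (fun M _ _ c => (M.fire k b).vertexAt (M.chosen k b) c) M₂ M₂.N
  Store.iterFill 3 (fun _ _ _ c => c / b + 1) M₃ M₃.N

theorem storeComputable_solve (k : ℕ) {b : ℕ} (hb : 1 ≤ b) : StoreComputable (solve k b) := by
  have h5 : StoreComputable fun M => Store.iterFill 5 distStep M M.N :=
    Definable.computable_iterFill (by decide)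
      (definable_distStep Definable.var.wk.wk Definable.var.wk .var)
  have h6 : StoreComputable fun M => Store.iterFill 6
      (fun M t κ c => (M.fire k b).step M.table t κ c) M M.N :=
    Definable.computable_iterFill (by decide)
      (FireData.definable_step (k := k) (b := b) Definable.var.wk.wk Definable.var.wk .var
        (fun _ ha => ha.1.1.2.le) fun _ ha => ha.2)
  have h2 : StoreComputable fun M => Store.iterFill 2
      (fun M _ _ c => (M.fire k b).vertexAt (M.chosen k b) c) M M.N :=
    Definable.computable_iterFill (by decide)
      (FireData.definable_vertexAt (k := k) (b := b) (definableSet_chosen k b) .var)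
  have h3 : StoreComputable fun M => Store.iterFill 3 (fun _ _ _ c => c / b + 1) M M.N :=
    Definable.computable_iterFill (by decide)
      ((Definable.div .var (.const b) (fun _ ha => ha.2.le) fun _ _ => hb).add (.const 1))
  exact h3.comp (h2.comp (h6.comp h5))

/-- The properties of the result of `solve`, for a store that encodes an instance. -/
theorem solve_spec {k b n : ℕ} (hk : 1 ≤ k) (hb : 1 ≤ b) (G : SimpleGraph (Fin n))
    (hG : IsKCaterpillar k G) (s : Fin n) (S : Finset (Fin n)) (M : Store) (hn : M.n = n)
    (hs : M.s = s) (hN : (n + 2) ^ (k + 4) ≤ M.N) (h5 : ∀ i, M.arr 5 i = 0)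
    (h1 : ∀ w v : Fin n, M.arr 1 (w * n + v) ≠ 0 ↔ G.Adj w v)
    (h0 : ∀ v : Fin n, M.arr 0 v ≠ 0 ↔ v ∈ S) (σ : RamState)
    (hσ2 : σ.var 2 = ((solve k b M).fire k b).size ((solve k b M).chosen k b))
    (hσ : ∀ a, a ≠ 4 → σ.arr a = (solve k b M).arr a) :
    ∃ Φ : Finset (Fin n × ℕ), EncodesStrategy σ Φ ∧ IsMaxSaveSolution b G s S Φ := by
  have hnN : n + 1 ≤ M.N := by
    have : (n + 2) ^ 1 ≤ (n + 2) ^ (k + 4) := Nat.pow_le_pow_right (by omega) (by omega)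
    rw [pow_one] at this
    omega
  set M₁ := Store.iterFill 5 distStep M M.N with hM₁
  set M₂ := Store.iterFill 6 (fun M t κ c => (M.fire k b).step M.table t κ c) M₁ M₁.N with hM₂
  set M₃ := Store.iterFill 2 (fun M _ _ c => (M.fire k b).vertexAt (M.chosen k b) c) M₂ M₂.N
    with hM₃
  have hsolve : solve k b M = Store.iterFill 3 (fun _ _ _ c => c / b + 1) M₃ M₃.N := rfl
  set I := M₁.fire k b with hI
  have hN₁ : M₁.N = M.N := Store.iterFill_N _ _ _ _
  have hN₂ : M₂.N = M.N := (Store.iterFill_N _ _ _ _).trans hN₁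
  have hN₃ : M₃.N = M.N := (Store.iterFill_N _ _ _ _).trans hN₂
  have hIN : I.N = M.N := hN₁
  have hIn : I.n = n := (Store.iterFill_n 5 distStep M M.N).trans hn
  have hIs : I.s = s := (Store.iterFill_s 5 distStep M M.N).trans hs
  have hc := hG.connected
  have hIg : ∀ u v : Fin n, I.g u v = G.dist u v := by
    intro u v
    change M₁.arr 5 (u * M₁.N + v) - 1 = _
    obtain ⟨p, hp, hlen⟩ := hc.exists_path_of_dist u v
    have h2 : G.dist u v < n := by rw [← hlen]; simpa using hp.length_lt
    rw [hN₁, hM₁, iterFill_distStep G hc M hn (by omega) h5 h1, if_pos (by omega),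
      Nat.add_sub_cancel]
  have hIS : ∀ v : Fin n, I.inS v ↔ v ∈ S := by
    intro v
    rw [← h0]
    change M₁.arr 0 v ≠ 0 ↔ _
    rw [hM₁, Store.iterFill_arr_of_ne _ _ _ (by decide)]
  have hbase : I.base ^ (I.k + 4) ≤ I.N := by
    rw [FireData.base, hIn, hIN]
    exact hN
  have hfire₂ : M₂.fire k b = I := Store.iterFill_fire _ _ _ (by decide) (by decide)
  set L : ℕ → ℕ → ℕ → ℕ := fun t => (Store.iterFill 6
    (fun M t κ c => (M.fire k b).step M.table t κ c) M₁ t).table with hL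
  have hstep : ∀ t < I.N, ∀ κ < I.N, ∀ c < I.N, L (t + 1) κ c = I.step (L t) t κ c := by
    intro t _ κ hκ c hc
    have := Store.iterFill_succ_arr 6 (fun M t κ c => (M.fire k b).step M.table t κ c) M₁ t hκ hc
    rw [Store.iterFill_fire _ _ _ (by decide) (by decide)] at this
    simp only [hL]
    rw [Store.table, Store.iterFill_N, this]
  have hchosen : M₂.chosen k b = I.mem (L I.N (I.best (L I.N))) := by
    rw [Store.chosen, hfire₂]
    rfl
  have hsize : M.N = M.N - 1 + 1 := by omega
  have hcol : ∀ r, r < n → r < M₂.N := fun r hr => by omega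
  have hch : ∀ T, (Store.iterFill 2 (fun M _ _ c => (M.fire k b).vertexAt (M.chosen k b) c)
      M₂ T).chosen k b = M₂.chosen k b := by
    intro T
    rw [Store.chosen, Store.chosen, Store.iterFill_fire _ _ _ (by decide) (by decide),
      Store.iterFill_table _ _ _ (by decide)]
  -- filling an array that a round does not read has the same effect in every round
  have h2arr : ∀ r < n, M₃.arr 2 r = I.vertexAt (M₂.chosen k b) r := by
    intro r hr
    have hpos : 0 < M₂.N := by omega
    have := Store.iterFill_succ_arr 2 (fun M _ _ c => (M.fire k b).vertexAt (M.chosen k b) c) M₂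
      (M.N - 1) hpos (hcol r hr)
    rw [← hsize, Store.iterFill_fire _ _ _ (by decide) (by decide), zero_mul, zero_add, hch,
      hfire₂] at this
    rw [hM₃, hN₂, this]
  have h3arr : ∀ r < n, (solve k b M).arr 3 r = r / b + 1 := by
    intro r hr
    have hpos : 0 < M₃.N := by omega
    have := Store.iterFill_succ_arr 3 (fun _ _ _ c => c / b + 1) M₃ (M.N - 1) hpos
      (show r < M₃.N by omega)
    rw [← hsize, zero_mul, zero_add] at this
    rw [hsolve, hN₃, this]
  have hfire₃ : M₃.fire k b = I :=
    (Store.iterFill_fire _ _ _ (by decide) (by decide)).trans hfire₂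
  have hfire₄ : (solve k b M).fire k b = I :=
    (Store.iterFill_fire _ _ _ (by decide) (by decide)).trans hfire₃
  have htable : (solve k b M).table = M₂.table :=
    (Store.iterFill_table _ _ _ (by decide)).trans (Store.iterFill_table _ _ _ (by decide))
  have hchosen₄ : (solve k b M).chosen k b = M₂.chosen k b := by
    rw [Store.chosen, hfire₄, htable, Store.chosen, hfire₂]
  have h2arr₄ : (solve k b M).arr 2 = M₃.arr 2 := Store.iterFill_arr_of_ne _ _ _ (by decide)
  rw [hfire₄, hchosen₄] at hσ2
  have hle : I.size (M₂.chosen k b) ≤ n := by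
    rw [← hIn]
    exact FireData.size_le
  have hbI : I.b = b := rfl
  have hkI : I.k = k := rfl
  clear_value I
  subst hIn
  subst hbI
  subst hkI
  have htree := I.isTreeLike_of_isKCaterpillar G hG s hIs hIg
  obtain ⟨hhall, hmax⟩ := FireData.best_spec htree hk hbase hstep
  rw [← hchosen] at hhall hmax
  refine FireData.exists_maxSaveSolution htree hb (by omega) G hc s hIs (hG.uniqueParent s)
    hIg S hIS ?_ hhall hmax σ hσ2 (fun r hr => ?_) fun r hr => ?_
  · intro x hx
    rw [hchosen] at hx
    exact ⟨hx.1, hx.2.1⟩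
  · rw [hσ 2 (by decide), h2arr₄, h2arr r (by omega)]
  · rw [hσ 3 (by decide), h3arr r (by omega)]

end Assembly

theorem mainTheorem6 (k b : ℕ) (hk : 1 ≤ k) (hb : 1 ≤ b) :
    MaxSavePolyTimeSolvableOn b (fun _ G => IsKCaterpillar k G) := by
  obtain ⟨P, C, hP⟩ := storeComputable_solve k hb
  obtain ⟨Q, C', hQ⟩ := (FireData.definable_size (α := Store) (k := k) (b := b)
    (definableSet_chosen k b)).exists_output
  -- all loops have the range `N = (n + 2) ^ (k + 4)`, so a bound in `N` is substituted
  refine ⟨.seq (powProg (k + 4)) (.seq P Q),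
    1 + Polynomial.C (k + 4) * (4 * Polynomial.X + 14) +
      (C + C').comp ((Polynomial.X + 2) ^ (k + 4)), fun n G s S hG => ?_⟩
  set σ₀ := encodeInstance G s S with hσ₀
  have hn0 : σ₀.var 0 = n := rfl
  have hs0 : σ₀.var 1 = s := rfl
  set M : Store := ⟨(n + 2) ^ (k + 4), n, s, σ₀.arr⟩ with hM
  have hpos : 0 < n := s.pos
  have hwf : Context.wf M := by
    refine ⟨hpos, ?_⟩
    have h1 : (n + 2) ^ 2 ≤ (n + 2) ^ (k + 4) := Nat.pow_le_pow_right (by omega) (by omega)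
    change n + 3 ≤ (n + 2) ^ (k + 4)
    nlinarith
  obtain ⟨h1, h2, h3⟩ := hP M hwf
  have h4 := hQ _ h2
  rw [h3] at h4
  have hpow := powProg_spec (k + 4) σ₀
  have hinit : Triple (fun σ => σ = σ₀) (powProg (k + 4)) _ (Represents M) :=
    hpow.conseq (fun _ h => h) le_rfl fun σ ⟨ha, hv0, hv1, hv3⟩ =>
      ⟨by rw [hv3, hn0], by rw [hv0, hn0], by rw [hv1, hs0], fun a _ => by rw [ha]⟩
  obtain ⟨t, σ, ht, hrun, hσ2, hσ⟩ := hinit.seq (h1.seq h4) σ₀ rfl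
  have hadj : ∀ w v : Fin n, M.arr 1 (w * n + v) ≠ 0 ↔ G.Adj w v := by
    intro w v
    have : M.arr 1 (w * n + v) ≠ 0 ↔
        ∃ u v' : Fin n, G.Adj u v' ∧ (w : ℕ) * n + v = (u : ℕ) * n + v' := by
      simp [hM, hσ₀, encodeInstance]
    rw [this]
    constructor
    · rintro ⟨u, v', h, he⟩
      have h5 := congrArg (· / n) he
      have h6 := congrArg (· % n) he
      simp only [Nat.mul_add_mod_of_lt v.2, Nat.mul_add_mod_of_lt v'.2] at h6
      simp only [mul_comm _ n, Nat.mul_add_div hpos, Nat.div_eq_of_lt v.2, Nat.div_eq_of_lt v'.2,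
        add_zero] at h5
      rwa [Fin.ext h5, Fin.ext h6]
    · exact fun h => ⟨w, v, h, rfl⟩
  have hS : ∀ v : Fin n, M.arr 0 v ≠ 0 ↔ v ∈ S := by
    intro v
    have : M.arr 0 v ≠ 0 ↔ ∃ w ∈ S, (v : ℕ) = w := by
      simp [hM, hσ₀, encodeInstance]
    rw [this]
    exact ⟨fun ⟨w, hw, h⟩ => by rwa [Fin.ext h], fun h => ⟨v, h, rfl⟩⟩
  obtain ⟨Φ, hΦ, hsol⟩ := solve_spec hk hb G hG s S M rfl rfl le_rfl (fun i => rfl) hadj hS σ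
    hσ2 hσ
  refine ⟨t, σ, Φ, ?_, hrun, hΦ, hsol⟩
  refine ht.trans ?_
  simp only [hn0, hM, Polynomial.eval_add, Polynomial.eval_mul, Polynomial.eval_comp,
    Polynomial.eval_pow, Polynomial.eval_X, Polynomial.eval_C, Polynomial.eval_one,
    Polynomial.eval_ofNat]
  omega
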